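/- Let $k,m\in\mathbb N$ with $k\ge 1$, let $T>0$ and $\mathbb F\in\{\mathbb R,\mathbb C\}$. Let $\alpha_1,\dots,\alpha_k\colon\mathbb R\to\mathbb F^{m\times m}$ be continuous and $T$-periodic with $\alpha_k(x)$ invertible for every $x\in\mathbb R$, and put $Au=\alpha_k\partial_x^k u+\dots+\alpha_1\partial_x u$. Let $\mathcal N\colon\mathbb F^m\times\mathbb R\to\mathbb F^m$ be continuous, $T$-periodic in its second argument, and twice continuously differentiable in its first argument, with $\partial_u\mathcal N$ continuous on $\mathbb F^m\times\mathbb R$. A stationary solution is a function $u$ with $$Au+\mathcal N(u,\cdot)=0 .\qquad (1)$$ For $L>0$ let $H^k_{\mathrm{per}}(0,L)$ be the space of $L$-periodic functions on $\mathbb R$ whose weak derivatives up to order $k$ are square integrable over a period, with norm $\big(\sum_{j=0}^k\int_0^L|\partial_x^j a|^2\,dx\big)^{1/2}$. Let $v\in H^k_{\mathrm{per}}(0,T)$ and $z\in H^k(\mathbb R)$ (with values in $\mathbb F^m$) be such that $v$ and $z+v$ are solutions of (1), and assume that the pulse $z+v$ is nondegenerate, i.e. that the linearization $\mathcal L(z+v)w=Aw+\partial_u\mathcal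 N(z+v,\cdot)w$, as an operator on $L^2(\mathbb R)$ with domain $H^k(\mathbb R)$, is invertible. Then there exist $C>0$ and $N\in\mathbb N$ such that the following holds. For each $n\ge N$ there exists a smooth $nT$-periodic cut-off function $\chi_n\colon\mathbb R\to[0,1]$ with $\|\chi_n\|_{W^{k,\infty}}=\max_{0\le j\le k}\|\partial_x^j\chi_n\|_{L^\infty}\le 1$, with $\chi_n=1$ on $[-\tfrac n6T,\tfrac n6T]$ and $\chi_n=0$ on $[-\tfrac n2T,-\tfrac n3T]\cup[\tfrac n3T,\tfrac n2T]$. Moreover, for any choice of such functions $\chi_n$, $n\ge N$, there exist for each $n\ge N$ an $nT$-periodic solution $u_n\in H^k_{\mathrm{per}}(0,nT)$ of (1) and a function $a_n\in H^k_{\mathrm{per}}(0,nT)$ with $$u_n(x)=\chi_n(x)z(x)+v(x)+a_n(x),\qquad x\in[-\tfrac n2T,\tfrac n2T),$$ $$\|a_n\|_{H^k_{\mathrm{per}}(0,nT)}\le C\,\|z\|_{H^k(\mathbb R\setminus(-\frac n6T,\frac n6T))},$$ and $\|a_n\|_{H^k_{\mathrm{per}}(0,nT)}\to0$ as $n\to\infty$.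 The constants $C$ and $N$ do not depend on the choice of the functions $\chi_n$. -/

import Mathlib

open MeasureTheory Filter Topology
open scoped ContDiff

noncomputable section

section Sobolev

variable {E : Type*} [NormedAddCommGroup E] [NormedSpace ℝ E]

/-- `g` is the `j`-th weak (distributional) derivative of `f` on the real line. -/
structure IsWeakDeriv (j : ℕ) (f g : ℝ → E) : Prop where
  locallyIntegrable_left : LocallyIntegrable f volume
  locallyIntegrable_right : LocallyIntegrable g volume
  integral_eq : ∀ φ : ℝ → ℝ, ContDiff ℝ ∞ φ → HasCompactSupport φ →
    ∫ x, iteratedDeriv j φ x • f x = (-1 : ℝ) ^ j • ∫ x, φ x • g x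

/-- Weak derivatives are unique up to null sets. -/
theorem IsWeakDeriv.ae_eq [CompleteSpace E] {j : ℕ} {f g h : ℝ → E}
    (hg : IsWeakDeriv j f g) (hh : IsWeakDeriv j f h) : g =ᵐ[volume] h := by
  refine ae_eq_of_integral_contDiff_smul_eq hg.locallyIntegrable_right
    hh.locallyIntegrable_right fun φ hφ hc => ?_
  have h1 := (hg.integral_eq φ hφ hc).symm.trans (hh.integral_eq φ hφ hc)
  have h2 : ((-1 : ℝ) ^ j) ≠ 0 := pow_ne_zero _ (by norm_num)
  exact smul_right_injective E h2 h1

open Classical in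
/-- The `j`-th weak derivative (well defined up to null sets; `0` if there is none). -/
def weakDeriv (j : ℕ) (f : ℝ → E) : ℝ → E :=
  if h : ∃ g, IsWeakDeriv j f g then h.choose else 0

theorem IsWeakDeriv.weakDeriv_spec {j : ℕ} {f g : ℝ → E} (h : IsWeakDeriv j f g) :
    IsWeakDeriv j f (weakDeriv j f) := by
  have h' : ∃ g, IsWeakDeriv j f g := ⟨g, h⟩
  rw [weakDeriv, dif_pos h']
  exact h'.choose_spec

/-- `f ∈ H^k(ℝ)`: all weak derivatives of order `0, …, k` exist and lie in `L²(ℝ)`. -/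
def MemHk (k : ℕ) (f : ℝ → E) : Prop :=
  ∀ j ≤ k, ∃ g, IsWeakDeriv j f g ∧ MemLp g 2 volume

/-- `f ∈ H^k_per(0,L)`: `f` is `L`-periodic on the line and its weak derivatives on the line of
order `0, …, k` exist and are square integrable over a period. -/
def MemHkPer (k : ℕ) (L : ℝ) (f : ℝ → E) : Prop :=
  Function.Periodic f L ∧
    ∀ j ≤ k, ∃ g, IsWeakDeriv j f g ∧ MemLp g 2 (volume.restrict (Set.Ioo 0 L))

/-- The `H^k`-norm over `S`: the square root of `∑_{j ≤ k} ∫_S |∂ʲ f|²`. -/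
def sobolevNorm (k : ℕ) (S : Set ℝ) (f : ℝ → E) : ℝ :=
  √(∑ j ∈ Finset.range (k + 1), ∫ x in S, ‖weakDeriv j f x‖ ^ 2)

end Sobolev

section Equation

variable {𝕜 : Type*} [RCLike 𝕜] {m : ℕ}

/-- The differential operator `A u = α_k ∂ᵏ u + … + α_1 ∂ u`. -/
def diffOp (k : ℕ) (α : ℕ → ℝ → Matrix (Fin m) (Fin m) 𝕜)
    (u : ℝ → EuclideanSpace 𝕜 (Fin m)) (x : ℝ) : EuclideanSpace 𝕜 (Fin m) :=
  ∑ i ∈ Finset.Icc 1 k, Matrix.toEuclideanCLM (𝕜 := 𝕜) (α i x) (weakDeriv i u x)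

/-- `u` has weak derivatives up to order `k` and solves `A u + 𝒩(u, ·) = 0`. -/
def SolvesStationary (k : ℕ) (α : ℕ → ℝ → Matrix (Fin m) (Fin m) 𝕜)
    (𝒩 : EuclideanSpace 𝕜 (Fin m) → ℝ → EuclideanSpace 𝕜 (Fin m))
    (u : ℝ → EuclideanSpace 𝕜 (Fin m)) : Prop :=
  (∀ j ≤ k, ∃ g, IsWeakDeriv j u g) ∧ ∀ᵐ x, diffOp k α u x + 𝒩 (u x) x = 0

/-- The linearization `ℒ(u) w = A w + ∂_u 𝒩(u, ·) w`. The derivative in `u` is the real Fréchet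
derivative; for a complex differentiable `𝒩(·, x)` it is the complex derivative. -/
def linearization (k : ℕ) (α : ℕ → ℝ → Matrix (Fin m) (Fin m) 𝕜)
    (𝒩 : EuclideanSpace 𝕜 (Fin m) → ℝ → EuclideanSpace 𝕜 (Fin m))
    (u w : ℝ → EuclideanSpace 𝕜 (Fin m)) (x : ℝ) : EuclideanSpace 𝕜 (Fin m) :=
  diffOp k α w x + fderiv ℝ (fun y => 𝒩 y x) (u x) (w x)

/-- `u` is nondegenerate: `ℒ(u) : H^k(ℝ) ⊂ L²(ℝ) → L²(ℝ)` is invertible, that is, `ℒ(u) w = g`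
has exactly one solution `w ∈ H^k(ℝ)` (up to null sets) for each `g ∈ L²(ℝ)`. Boundedness of the
inverse is then automatic. -/
def IsNondegenerate (k : ℕ) (α : ℕ → ℝ → Matrix (Fin m) (Fin m) 𝕜)
    (𝒩 : EuclideanSpace 𝕜 (Fin m) → ℝ → EuclideanSpace 𝕜 (Fin m))
    (u : ℝ → EuclideanSpace 𝕜 (Fin m)) : Prop :=
  ∀ g : ℝ → EuclideanSpace 𝕜 (Fin m), MemLp g 2 volume →
    ∃ w, (MemHk k w ∧ linearization k α 𝒩 u w =ᵐ[volume] g) ∧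
      ∀ w', MemHk k w' ∧ linearization k α 𝒩 u w' =ᵐ[volume] g → w' =ᵐ[volume] w

/-- `χ` is a smooth `L`-periodic cut-off function with values in `[0,1]` and derivatives up to
order `k` bounded by `1`, equal to `1` on `[-L/6, L/6]` and to `0` on
`[-L/2, -L/3] ∪ [L/3, L/2]`. -/
structure IsCutoff (k : ℕ) (L : ℝ) (χ : ℝ → ℝ) : Prop where
  smooth : ContDiff ℝ ∞ χ
  periodic : Function.Periodic χ L
  mem_Icc : ∀ x, χ x ∈ Set.Icc (0 : ℝ) 1
  deriv_le : ∀ j ≤ k, ∀ x, |iteratedDeriv j χ x| ≤ 1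
  eq_one : ∀ x ∈ Set.Icc (-(L / 6)) (L / 6), χ x = 1
  eq_zero : ∀ x ∈ Set.Icc (-(L / 2)) (-(L / 3)) ∪ Set.Icc (L / 3) (L / 2), χ x = 0

end Equation

end

/-!
The solution near the pulse is found by Newton's method around the periodic approximate solution
`w_n = χ_n z + v`, where the first summand is extended from `[-nT/2, nT/2)` with period `nT`.

*The residual.* On `[-nT/6, nT/6]` the profile `w_n` is the solution `z + v` itself; elsewhere its
residual is compared with that of the solution `v`. Hence the `L²`-norm of the residual over a period
is at most a constant times the `H^k`-norm of `z` outside `(-nT/6, nT/6)`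
(`IsPulse.exists_residual_bound`).

*Uniform invertibility.* The linearization at `z + v` maps `H^k(ℝ)` onto `L²(ℝ)`, so the open mapping
theorem gives a bounded right inverse `R` on the line (`exists_bounded_solution`). A periodic
right-hand side `g` is split into its parts on the half periods centred at `0` and at `nT/2`; `R` is
applied to each part on the line, the result is multiplied by a slowly varying cut-off supported in
the window of size `3nT/4` around the same centre, and is periodized. On both windows the
coefficients of the periodic linearization at `w_n` are uniformly close to those on the line, since
`z` vanishes at infinity (`IsPulse.periodicProfile_sub_small`), and the commutators with the cut-offs
are small; so the sum is a right inverse up to an error of norm at most `1/2`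
(`exists_local_approx_solution`), which a Neumann series removes (`exists_periodic_right_inverse`).
The bound does not depend on `n`. Neither injectivity of the linearization nor invertibility of the
leading coefficient enters.

*The nonlinear step.* The embedding of `H^k` into `L^∞` with a constant independent of the period
(`IsWeakDeriv.enorm_le`) makes the equation close to its linearization in a ball of fixed radius
around `w_n`, so a zero exists at a distance controlled by the residual (`exists_solution_near`).

The Sobolev spaces on the line and on circles are treated together. `IsUnitCovering π μ` expresses
that functions on the measure `μ` pull back along `π : ℝ → ℝ` to functions on the line, with control
over unit intervals; `sobolevSpace` is the closed subspace of those tuples in `L²(μ)` whose pull-backs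
are the weak derivatives of the first entry.
-/

noncomputable section

/-! ### Calculus of weak derivatives -/

theorem locallyIntegrable_congr_ae {E : Type*} [NormedAddCommGroup E] {f f' : ℝ → E}
    (hf : LocallyIntegrable f volume)
    (h : f =ᵐ[volume] f') : LocallyIntegrable f' volume := fun x =>
  let ⟨s, hs, hi⟩ := hf x
  ⟨s, hs, Integrable.congr hi (ae_restrict_of_ae h)⟩

section WeakCalculus

variable {E : Type*} [NormedAddCommGroup E] [NormedSpace ℝ E]

theorem hasCompactSupport_iteratedDeriv {φ : ℝ → ℝ} (hc : HasCompactSupport φ) (j : ℕ) :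
    HasCompactSupport (iteratedDeriv j φ) := by
  induction j with
  | zero => simpa [iteratedDeriv_zero] using hc
  | succ n ih => rw [iteratedDeriv_succ]; exact ih.deriv

theorem tsupport_iteratedDeriv_subset (φ : ℝ → ℝ) (j : ℕ) :
    tsupport (iteratedDeriv j φ) ⊆ tsupport φ := by
  induction j with
  | zero => simp [iteratedDeriv_zero]
  | succ n ih =>
    rw [iteratedDeriv_succ]
    exact (closure_minimal (support_deriv_subset) (isClosed_tsupport _)).trans ih

theorem contDiff_iteratedDeriv {φ : ℝ → ℝ} (hφ : ContDiff ℝ ∞ φ) (j : ℕ) :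
    ContDiff ℝ ∞ (iteratedDeriv j φ) := by
  induction j with
  | zero => simpa [iteratedDeriv_zero] using hφ
  | succ n ih => rw [iteratedDeriv_succ]; exact (contDiff_infty_iff_deriv.1 ih).2

theorem integrable_test_smul {φ : ℝ → ℝ} (hφ : Continuous φ) (hc : HasCompactSupport φ)
    {f : ℝ → E} (hf : LocallyIntegrable f volume) : Integrable (fun x => φ x • f x) volume :=
  hf.integrable_smul_left_of_hasCompactSupport hφ hc

theorem integrable_iteratedDeriv_smul {φ : ℝ → ℝ} (hφ : ContDiff ℝ ∞ φ)
    (hc : HasCompactSupport φ) {f : ℝ → E} (hf : LocallyIntegrable f volume) (j : ℕ) :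
    Integrable (fun x => iteratedDeriv j φ x • f x) volume :=
  integrable_test_smul (contDiff_iteratedDeriv hφ j).continuous
    (hasCompactSupport_iteratedDeriv hc j) hf

namespace IsWeakDeriv

variable {j : ℕ} {f f' g g' h : ℝ → E}

theorem congr (H : IsWeakDeriv j f g) (hf : f =ᵐ[volume] f') (hg : g =ᵐ[volume] g') :
    IsWeakDeriv j f' g' where
  locallyIntegrable_left := locallyIntegrable_congr_ae H.locallyIntegrable_left hf
  locallyIntegrable_right := locallyIntegrable_congr_ae H.locallyIntegrable_right hg
  integral_eq φ hφ hc := by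
    have h1 : ∫ x, iteratedDeriv j φ x • f' x = ∫ x, iteratedDeriv j φ x • f x :=
      integral_congr_ae (hf.mono fun x hx => by simp [hx])
    have h2 : ∫ x, φ x • g' x = ∫ x, φ x • g x :=
      integral_congr_ae (hg.mono fun x hx => by simp [hx])
    rw [h1, h2, H.integral_eq φ hφ hc]

theorem zero_self (hf : LocallyIntegrable f volume) : IsWeakDeriv 0 f f :=
  ⟨hf, hf, fun φ _ _ => by simp⟩

theorem weakDeriv_ae_eq [CompleteSpace E] (H : IsWeakDeriv j f g) :
    weakDeriv j f =ᵐ[volume] g :=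
  H.weakDeriv_spec.ae_eq H

theorem eq_of_zero [CompleteSpace E] (H : IsWeakDeriv 0 f g) : f =ᵐ[volume] g :=
  (zero_self H.locallyIntegrable_left).ae_eq H

theorem add (H : IsWeakDeriv j f g) (H' : IsWeakDeriv j f' g') :
    IsWeakDeriv j (fun x => f x + f' x) (fun x => g x + g' x) where
  locallyIntegrable_left := H.locallyIntegrable_left.add H'.locallyIntegrable_left
  locallyIntegrable_right := H.locallyIntegrable_right.add H'.locallyIntegrable_right
  integral_eq φ hφ hc := by
    simp only [smul_add]
    rw [integral_add, integral_add, H.integral_eq φ hφ hc, H'.integral_eq φ hφ hc, smul_add]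
    · exact integrable_test_smul hφ.continuous hc H.locallyIntegrable_right
    · exact integrable_test_smul hφ.continuous hc H'.locallyIntegrable_right
    · exact integrable_iteratedDeriv_smul hφ hc H.locallyIntegrable_left j
    · exact integrable_iteratedDeriv_smul hφ hc H'.locallyIntegrable_left j

theorem const_smul (c : ℝ) (H : IsWeakDeriv j f g) :
    IsWeakDeriv j (fun x => c • f x) (fun x => c • g x) where
  locallyIntegrable_left := H.locallyIntegrable_left.smul c
  locallyIntegrable_right := H.locallyIntegrable_right.smul c
  integral_eq φ hφ hc := by
    have h1 : ∀ (ψ : ℝ → ℝ) (q : ℝ → E), ∫ x, ψ x • c • q x = c • ∫ x, ψ x • q x := by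
      intro ψ q
      rw [← integral_smul]
      exact integral_congr_ae (.of_forall fun x => smul_comm _ _ _)
    rw [h1, h1, H.integral_eq φ hφ hc, smul_comm]

theorem sub (H : IsWeakDeriv j f g) (H' : IsWeakDeriv j f' g') :
    IsWeakDeriv j (fun x => f x - f' x) (fun x => g x - g' x) := by
  simpa [sub_eq_add_neg] using H.add (H'.const_smul (-1))

theorem zero : IsWeakDeriv j (fun _ => (0 : E)) (fun _ => 0) :=
  ⟨locallyIntegrable_zero, locallyIntegrable_zero, fun φ _ _ => by simp⟩

theorem sum {ι : Type*} (s : Finset ι) {F G : ι → ℝ → E}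
    (H : ∀ i ∈ s, IsWeakDeriv j (F i) (G i)) :
    IsWeakDeriv j (fun x => ∑ i ∈ s, F i x) (fun x => ∑ i ∈ s, G i x) := by
  classical
  induction s using Finset.induction_on with
  | empty => simpa using zero
  | insert a s ha ih =>
    simp only [Finset.sum_insert ha]
    exact (H a (by simp)).add (ih fun i hi => H i (by simp [hi]))

/-- The `(j+1)`-st weak derivative is the first weak derivative of the `j`-th. -/
theorem one_of_succ (H : IsWeakDeriv j f g) (H' : IsWeakDeriv (j + 1) f h) :
    IsWeakDeriv 1 g h where
  locallyIntegrable_left := H.locallyIntegrable_right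
  locallyIntegrable_right := H'.locallyIntegrable_right
  integral_eq φ hφ hc := by
    have h1 := H.integral_eq (iteratedDeriv 1 φ) (contDiff_iteratedDeriv hφ 1)
      (hasCompactSupport_iteratedDeriv hc 1)
    have h2 := H'.integral_eq φ hφ hc
    have h3 : iteratedDeriv j (iteratedDeriv 1 φ) = iteratedDeriv (j + 1) φ := by
      rw [iteratedDeriv_one, ← iteratedDeriv_succ']
    rw [h3, h2, pow_succ, mul_smul] at h1
    simpa using (smul_right_injective E (pow_ne_zero j (by norm_num : (-1 : ℝ) ≠ 0)) h1).symm

theorem succ (H : IsWeakDeriv j f g) (H' : IsWeakDeriv 1 g h) : IsWeakDeriv (j + 1) f h where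
  locallyIntegrable_left := H.locallyIntegrable_left
  locallyIntegrable_right := H'.locallyIntegrable_right
  integral_eq φ hφ hc := by
    have h1 := H.integral_eq (iteratedDeriv 1 φ) (contDiff_iteratedDeriv hφ 1)
      (hasCompactSupport_iteratedDeriv hc 1)
    have h3 : iteratedDeriv j (iteratedDeriv 1 φ) = iteratedDeriv (j + 1) φ := by
      rw [iteratedDeriv_one, ← iteratedDeriv_succ']
    rw [h3, H'.integral_eq φ hφ hc] at h1
    rw [h1, pow_one, smul_smul, ← pow_succ]

theorem comp_sub_const (H : IsWeakDeriv j f g) (a : ℝ) :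
    IsWeakDeriv j (fun x => f (x - a)) (fun x => g (x - a)) := by
  have hloc : ∀ {q : ℝ → E}, LocallyIntegrable q volume →
      LocallyIntegrable (fun x => q (x - a)) volume := by
    intro q hq
    rw [locallyIntegrable_iff] at hq ⊢
    intro K hK
    have h1 := hq ((fun x => x - a) '' K) (hK.image (by fun_prop))
    have h2 := (measurePreserving_sub_right (volume : Measure ℝ) a).integrableOn_image
      (MeasurableEquiv.subRight a).measurableEmbedding (f := q) (s := K)
    exact h2.1 h1
  refine ⟨hloc H.locallyIntegrable_left, hloc H.locallyIntegrable_right, fun φ hφ hc => ?_⟩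
  have hφ' : ContDiff ℝ ∞ (fun x => φ (x + a)) := hφ.comp (contDiff_id.add contDiff_const)
  have hc' : HasCompactSupport (fun x => φ (x + a)) :=
    hc.comp_homeomorph (Homeomorph.addRight a)
  have h1 := H.integral_eq _ hφ' hc'
  rw [← integral_sub_right_eq_self (fun x => iteratedDeriv j (fun x => φ (x + a)) x • f x) a,
    ← integral_sub_right_eq_self (fun x => φ (x + a) • g x) a] at h1
  simpa [iteratedDeriv_comp_add_const] using h1

/-- Weak differentiability is a local property. -/
theorem of_local (H : ∀ R : ℝ, ∃ F G, IsWeakDeriv j F G ∧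
    (∀ x ∈ Set.Ioo (-R) R, f x = F x) ∧ ∀ x ∈ Set.Ioo (-R) R, g x = G x) :
    IsWeakDeriv j f g := by
  have hloc : ∀ {q : ℝ → E}, (∀ R : ℝ, ∃ Q, LocallyIntegrable Q volume ∧
      ∀ x ∈ Set.Ioo (-R) R, q x = Q x) → LocallyIntegrable q volume := by
    intro q hq x
    obtain ⟨Q, hQ, hqQ⟩ := hq (|x| + 1)
    obtain ⟨s, hs, hi⟩ := hQ x
    have hx : Set.Ioo (-(|x| + 1)) (|x| + 1) ∈ 𝓝 x :=
      Ioo_mem_nhds (by linarith [neg_abs_le x]) (by linarith [le_abs_self x])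
    obtain ⟨t, ht, hts, hxt⟩ := mem_nhds_iff.1 (Filter.inter_mem hs hx)
    refine ⟨t, hts.mem_nhds hxt, ?_⟩
    refine (hi.mono_set fun y hy => (ht hy).1).congr_fun (fun y hy => ?_) hts.measurableSet
    exact (hqQ y (ht hy).2).symm
  refine ⟨hloc fun R => ?_, hloc fun R => ?_, fun φ hφ hc => ?_⟩
  · obtain ⟨F, G, h1, h2, h3⟩ := H R
    exact ⟨F, h1.locallyIntegrable_left, h2⟩
  · obtain ⟨F, G, h1, h2, h3⟩ := H R
    exact ⟨G, h1.locallyIntegrable_right, h3⟩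
  · obtain ⟨R, hR⟩ := hc.isBounded.subset_ball 0
    rw [Real.ball_eq_Ioo, zero_sub, zero_add] at hR
    obtain ⟨F, G, h1, h2, h3⟩ := H R
    have e1 : ∀ x, iteratedDeriv j φ x • f x = iteratedDeriv j φ x • F x := by
      intro x
      by_cases hx : x ∈ Set.Ioo (-R) R
      · rw [h2 x hx]
      · have : iteratedDeriv j φ x = 0 := by
          by_contra h0
          exact hx (hR (tsupport_iteratedDeriv_subset φ j (subset_tsupport _ h0)))
        simp [this]
    have e2 : ∀ x, φ x • g x = φ x • G x := by
      intro x
      by_cases hx : x ∈ Set.Ioo (-R) R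
      · rw [h3 x hx]
      · have : φ x = 0 := by
          by_contra h0
          exact hx (hR (subset_tsupport _ h0))
        simp [this]
    simp only [e1, e2]
    exact h1.integral_eq φ hφ hc

/-- Leibniz rule of first order. -/
theorem smul_smooth {ψ : ℝ → ℝ} (hψ : ContDiff ℝ ∞ ψ) (H : IsWeakDeriv 1 f g) :
    IsWeakDeriv 1 (fun x => ψ x • f x) (fun x => ψ x • g x + deriv ψ x • f x) := by
  have hdψ : ContDiff ℝ ∞ (deriv ψ) := (contDiff_infty_iff_deriv.1 hψ).2
  have hl : ∀ {χ : ℝ → ℝ} {q : ℝ → E}, Continuous χ → LocallyIntegrable q volume →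
      LocallyIntegrable (fun x => χ x • q x) volume := by
    intro χ q hχ hq
    rw [locallyIntegrable_iff] at hq ⊢
    intro K hK
    exact (hq K hK).continuousOn_smul hχ.continuousOn hK
  have hf := H.locallyIntegrable_left
  have hg := H.locallyIntegrable_right
  refine ⟨hl hψ.continuous hf, (hl hψ.continuous hg).add (hl hdψ.continuous hf), ?_⟩
  intro φ hφ hc
  have h1 := H.integral_eq (fun x => φ x * ψ x) (hφ.mul hψ) hc.mul_right
  have hd : ∀ x, iteratedDeriv 1 (fun x => φ x * ψ x) x = deriv φ x * ψ x + φ x * deriv ψ x := by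
    intro x
    rw [iteratedDeriv_one]
    exact deriv_fun_mul (hφ.differentiable (by simp) x) (hψ.differentiable (by simp) x)
  simp only [hd, iteratedDeriv_one, add_smul, mul_smul, smul_add] at h1 ⊢
  have i1 : Integrable (fun x => deriv φ x • ψ x • f x) volume :=
    integrable_test_smul (contDiff_infty_iff_deriv.1 hφ).2.continuous hc.deriv
      (hl hψ.continuous hf)
  have i2 : Integrable (fun x => φ x • deriv ψ x • f x) volume :=
    integrable_test_smul hφ.continuous hc (hl hdψ.continuous hf)
  have i3 : Integrable (fun x => φ x • ψ x • g x) volume :=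
    integrable_test_smul hφ.continuous hc (hl hψ.continuous hg)
  rw [integral_add i1 i2] at h1
  rw [integral_add i3 i2, smul_add, ← h1]
  simp

/-- Leibniz rule for a product with a smooth function. -/
theorem leibniz {ψ : ℝ → ℝ} (hψ : ContDiff ℝ ∞ ψ) {k : ℕ} {w : ℕ → ℝ → E}
    (H : ∀ j ≤ k, IsWeakDeriv j (w 0) (w j)) (hj : j ≤ k) :
    IsWeakDeriv j (fun x => ψ x • w 0 x)
      (fun x => ∑ p ∈ Finset.HasAntidiagonal.antidiagonal j,
        (j.choose p.1) • iteratedDeriv p.1 ψ x • w p.2 x) := by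
  induction j with
  | zero =>
    simp only [Finset.Nat.antidiagonal_zero, Finset.sum_singleton, Nat.choose_self,
      iteratedDeriv_zero,
      one_smul]
    refine zero_self ?_
    have := (H 0 (Nat.zero_le _)).locallyIntegrable_left
    rw [locallyIntegrable_iff] at this ⊢
    intro K hK
    exact (this K hK).continuousOn_smul hψ.continuous.continuousOn hK
  | succ j ih =>
    refine (ih (by omega)).succ ?_
    have h1 : IsWeakDeriv 1
        (fun x => ∑ p ∈ Finset.HasAntidiagonal.antidiagonal j,
          (j.choose p.1) • iteratedDeriv p.1 ψ x • w p.2 x)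
        (fun x => ∑ p ∈ Finset.HasAntidiagonal.antidiagonal j,
          (j.choose p.1) • (iteratedDeriv p.1 ψ x • w (p.2 + 1) x +
            iteratedDeriv (p.1 + 1) ψ x • w p.2 x)) := by
      refine sum _ fun p hp => ?_
      have hp' : p.1 + p.2 = j := by simpa using hp
      have h2 : IsWeakDeriv 1 (w p.2) (w (p.2 + 1)) :=
        (H p.2 (by omega)).one_of_succ (H (p.2 + 1) (by omega))
      have h3 := (h2.smul_smooth (contDiff_iteratedDeriv hψ p.1)).const_smul (j.choose p.1)
      simpa only [iteratedDeriv_succ, Nat.cast_smul_eq_nsmul] using h3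
    convert h1 using 2 with x
    rw [Finset.sum_antidiagonal_choose_succ_nsmul
      (fun a b => iteratedDeriv a ψ x • w b x)]
    simp only [smul_add, Finset.sum_add_distrib]
    congr 1
    refine Finset.sum_congr rfl fun p hp => ?_
    rw [Nat.choose_symm_of_eq_add (Finset.HasAntidiagonal.mem_antidiagonal.1 hp).symm]

end IsWeakDeriv

end WeakCalculus

/-! ### One-dimensional Sobolev embedding -/

section Embedding

variable {E : Type*} [NormedAddCommGroup E] [NormedSpace ℝ E]

/-- An integrable function is the weak derivative of its primitive. -/
theorem isWeakDeriv_primitive [CompleteSpace E] {G : ℝ → E} (hG : Integrable G volume) :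
    IsWeakDeriv 1 (fun x => ∫ t in Set.Iic x, G t) G := by
  have hcont : Continuous (fun x => ∫ t in Set.Iic x, G t) := by
    have h1 : ∀ x, ∫ t in Set.Iic x, G t = (∫ t in Set.Iic 0, G t) + ∫ t in (0 : ℝ)..x, G t := by
      intro x
      rw [← intervalIntegral.integral_Iic_sub_Iic hG.integrableOn hG.integrableOn]
      abel
    rw [funext h1]
    exact continuous_const.add (intervalIntegral.continuous_primitive
      (fun a b => hG.intervalIntegrable) 0)
  refine ⟨hcont.locallyIntegrable, hG.locallyIntegrable, fun φ hφ hc => ?_⟩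
  have hd : Continuous (deriv φ) := (contDiff_infty_iff_deriv.1 hφ).2.continuous
  have hdi : Integrable (deriv φ) volume := hd.integrable_of_hasCompactSupport hc.deriv
  rw [iteratedDeriv_one]
  set S : Set (ℝ × ℝ) := {p | p.2 ≤ p.1} with hS
  have hSm : MeasurableSet S := measurableSet_le measurable_snd measurable_fst
  have hint : Integrable (S.indicator fun p : ℝ × ℝ => deriv φ p.1 • G p.2)
      ((volume : Measure ℝ).prod volume) := (hdi.smul_prod hG).indicator hSm
  have hswap := integral_integral_swap (μ := (volume : Measure ℝ)) (ν := (volume : Measure ℝ))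
    (f := fun x t => S.indicator (fun p : ℝ × ℝ => deriv φ p.1 • G p.2) (x, t)) hint
  have e1 : ∀ x, ∫ t, S.indicator (fun p : ℝ × ℝ => deriv φ p.1 • G p.2) (x, t) =
      deriv φ x • ∫ t in Set.Iic x, G t := by
    intro x
    rw [← integral_smul, ← integral_indicator measurableSet_Iic]
    rfl
  have e2 : ∀ t, ∫ x, S.indicator (fun p : ℝ × ℝ => deriv φ p.1 • G p.2) (x, t) =
      -(φ t • G t) := by
    intro t
    have : ∫ x in Set.Ici t, deriv φ x • G t = -(φ t • G t) := by
      rw [integral_smul_const, integral_Ici_eq_integral_Ioi,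
        HasCompactSupport.integral_Ioi_deriv_eq (hφ.of_le (by norm_cast)) hc,
        neg_smul]
    rw [← this, ← integral_indicator measurableSet_Ici]
    rfl
  simp only [e1, e2] at hswap
  rw [hswap, integral_neg]
  simp

theorem contDiff_primitive_Iic {θ : ℝ → ℝ} (hθ : ContDiff ℝ ∞ θ) (hc : HasCompactSupport θ) :
    (∀ x, HasDerivAt (fun x => ∫ t in Set.Iic x, θ t) (θ x) x) ∧
      ContDiff ℝ ∞ (fun x => ∫ t in Set.Iic x, θ t) := by
  have hi : Integrable θ volume := hθ.continuous.integrable_of_hasCompactSupport hc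
  have hd : ∀ x, HasDerivAt (fun x => ∫ t in Set.Iic x, θ t) (θ x) x := by
    intro x
    have h1 : ∀ x, ∫ t in Set.Iic x, θ t = (∫ t in Set.Iic 0, θ t) + ∫ t in (0 : ℝ)..x, θ t := by
      intro x
      rw [← intervalIntegral.integral_Iic_sub_Iic hi.integrableOn hi.integrableOn]
      abel
    rw [funext h1]
    exact (intervalIntegral.integral_hasDerivAt_right hi.intervalIntegrable
      hθ.continuous.stronglyMeasurable.stronglyMeasurableAtFilter
      hθ.continuous.continuousAt).const_add _
  refine ⟨hd, contDiff_infty_iff_deriv.2 ⟨fun x => (hd x).differentiableAt, ?_⟩⟩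
  rwa [funext fun x => (hd x).deriv]

/-- A function with vanishing weak derivative is constant. -/
theorem IsWeakDeriv.const_of_zero [CompleteSpace E] {f : ℝ → E}
    (H : IsWeakDeriv 1 f (fun _ => 0)) : ∃ c : E, f =ᵐ[volume] fun _ => c := by
  let η : ContDiffBump (0 : ℝ) := ⟨1, 2, by norm_num, by norm_num⟩
  set e : ℝ → ℝ := η.normed volume with he
  have he1 : ContDiff ℝ ∞ e := η.contDiff_normed
  have he2 : HasCompactSupport e := η.hasCompactSupport_normed
  have he3 : ∫ x, e x = 1 := η.integral_normed
  refine ⟨∫ x, e x • f x, ae_eq_of_integral_contDiff_smul_eq H.locallyIntegrable_left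
    (locallyIntegrable_const _) fun φ hφ hc => ?_⟩
  have hφi : Integrable φ volume := hφ.continuous.integrable_of_hasCompactSupport hc
  have hei : Integrable e volume := he1.continuous.integrable_of_hasCompactSupport he2
  set c := ∫ x, φ x with hcdef
  set θ : ℝ → ℝ := fun x => φ x - c * e x with hθdef
  have hθ : ContDiff ℝ ∞ θ := hφ.sub (contDiff_const.mul he1)
  have hθc : HasCompactSupport θ := hc.sub (he2.mul_left (f := fun _ => c))
  have hθi : Integrable θ volume := hφi.sub (hei.const_mul c)
  have hθ0 : ∫ x, θ x = 0 := by
    rw [hθdef, integral_sub hφi (hei.const_mul c), integral_const_mul, he3]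
    simp [hcdef]
  obtain ⟨hd, hsm⟩ := contDiff_primitive_Iic hθ hθc
  -- the primitive of `θ` is again a test function, because `θ` has mean zero
  have hcs : HasCompactSupport (fun x => ∫ t in Set.Iic x, θ t) := by
    obtain ⟨R, hR⟩ := hθc.isBounded.subset_ball 0
    rw [Real.ball_eq_Ioo, zero_sub, zero_add] at hR
    refine HasCompactSupport.of_support_subset_isCompact (isCompact_Icc (a := -R) (b := R)) ?_
    intro x hx
    by_contra hxR
    refine hx ?_
    have hz : ∀ t, t ∉ Set.Ioo (-R) R → θ t = 0 := fun t ht => by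
      by_contra h0
      exact ht (hR (subset_tsupport _ h0))
    rcases lt_or_ge x (-R) with h | h
    · show ∫ t in Set.Iic x, θ t = 0
      refine setIntegral_eq_zero_of_forall_eq_zero fun t ht => hz t fun ht' => ?_
      exact absurd ht'.1 (not_lt.2 (le_trans (Set.mem_Iic.1 ht) h.le))
    · have hxR' : R < x := by
        by_contra h'
        exact hxR ⟨h, not_lt.1 h'⟩
      show ∫ t in Set.Iic x, θ t = 0
      rw [← hθ0]
      refine setIntegral_eq_integral_of_forall_compl_eq_zero fun t ht => hz t fun ht' => ?_
      exact ht (Set.mem_Iic.2 (ht'.2.le.trans hxR'.le))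
  have h1 := H.integral_eq _ hsm hcs
  rw [iteratedDeriv_one, funext fun x => (hd x).deriv] at h1
  simp only [smul_zero, integral_zero] at h1
  have i1 := integrable_test_smul hφ.continuous hc H.locallyIntegrable_left
  have i2 := integrable_test_smul he1.continuous he2 H.locallyIntegrable_left
  have h2 : ∀ x, θ x • f x = φ x • f x - c • (e x • f x) := fun x => by
    rw [hθdef, sub_smul, mul_smul]
  simp only [h2] at h1
  have h3 : ∫ x, c • (e x • f x) = c • ∫ x, e x • f x := integral_smul c _
  have h4 := integral_sub i1 (i2.smul c)
  simp only [Pi.smul_apply] at h4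
  rw [h4, h3, sub_eq_zero] at h1
  rw [h1, integral_smul_const]

/-- On bounded intervals a weakly differentiable function is almost everywhere a primitive of its
weak derivative. -/
theorem IsWeakDeriv.exists_primitive [CompleteSpace E] {f g : ℝ → E} (H : IsWeakDeriv 1 f g)
    (R : ℝ) : ∃ F : ℝ → E,
      (∀ x ∈ Set.Ioo (-R) R, ∀ y ∈ Set.Ioo (-R) R, x ≤ y → F y - F x = ∫ t in Set.Ioc x y, g t) ∧
      ∀ᵐ x, x ∈ Set.Ioo (-R) R → f x = F x := by
  let η : ContDiffBump (0 : ℝ) := ⟨|R| + 1, |R| + 2, by positivity, by linarith⟩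
  have hψ : ContDiff ℝ ∞ (η : ℝ → ℝ) := η.contDiff
  have hψc : HasCompactSupport (η : ℝ → ℝ) := η.hasCompactSupport
  have hball : ∀ x ∈ Set.Ioo (-R) R, x ∈ Metric.ball (0 : ℝ) (|R| + 1) := by
    intro x hx
    rw [mem_ball_zero_iff, Real.norm_eq_abs, abs_lt]
    exact ⟨by linarith [hx.1, le_abs_self R], by linarith [hx.2, le_abs_self R]⟩
  have hone : ∀ x ∈ Set.Ioo (-R) R, η x = 1 := fun x hx =>
    η.one_of_mem_closedBall (Metric.ball_subset_closedBall (hball x hx))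
  have hder : ∀ x ∈ Set.Ioo (-R) R, deriv η x = 0 := by
    intro x hx
    have : (η : ℝ → ℝ) =ᶠ[𝓝 x] fun _ => 1 := by
      filter_upwards [Ioo_mem_nhds hx.1 hx.2] with y hy using hone y hy
    rw [this.deriv_eq, deriv_const]
  have h1 := H.smul_smooth hψ
  have hdc : Continuous (deriv η) := (contDiff_infty_iff_deriv.1 hψ).2.continuous
  have hG : Integrable (fun x => η x • g x + deriv η x • f x) volume :=
    (integrable_test_smul hψ.continuous hψc H.locallyIntegrable_right).add
      (integrable_test_smul hdc hψc.deriv H.locallyIntegrable_left)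
  have h2 := h1.sub (isWeakDeriv_primitive hG)
  simp only [sub_self] at h2
  obtain ⟨c, hc⟩ := h2.const_of_zero
  refine ⟨fun x => c + ∫ t in Set.Iic x, (η t • g t + deriv η t • f t), ?_, ?_⟩
  · intro x hx y hy hxy
    rw [add_sub_add_left_eq_sub, intervalIntegral.integral_Iic_sub_Iic hG.integrableOn
      hG.integrableOn, intervalIntegral.integral_of_le hxy]
    refine setIntegral_congr_fun measurableSet_Ioc fun t ht => ?_
    have ht' : t ∈ Set.Ioo (-R) R := ⟨hx.1.trans ht.1, ht.2.trans_lt hy.2⟩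
    simp [hone t ht', hder t ht']
  · filter_upwards [hc] with x hx hxR
    rw [← hx, hone x hxR]
    simp

/-- Sobolev embedding `H¹ ⊂ L^∞` in its uniformly local form: almost every value of `f` is bounded
by the `L²`-norms of `f` and of its weak derivative on the adjacent unit interval. -/
theorem IsWeakDeriv.enorm_le [CompleteSpace E] {f g : ℝ → E} (H : IsWeakDeriv 1 f g) :
    ∀ᵐ x, ‖f x‖ₑ ≤ eLpNorm f 2 (volume.restrict (Set.Ioc x (x + 1))) +
      eLpNorm g 2 (volume.restrict (Set.Ioc x (x + 1))) := by
  have key : ∀ n : ℕ, ∀ᵐ x, x ∈ Set.Ioo (-(n : ℝ)) (n - 1) →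
      ‖f x‖ₑ ≤ eLpNorm f 2 (volume.restrict (Set.Ioc x (x + 1))) +
      eLpNorm g 2 (volume.restrict (Set.Ioc x (x + 1))) := by
    intro n
    obtain ⟨F, hF, hfF⟩ := H.exists_primitive n
    filter_upwards [hfF] with x hx hxn
    have hxI : x ∈ Set.Ioo (-(n : ℝ)) n := ⟨hxn.1, by linarith [hxn.2]⟩
    set ν : Measure ℝ := volume.restrict (Set.Ioc x (x + 1)) with hν
    have : IsProbabilityMeasure ν := ⟨by simp [hν]⟩
    have hfm : AEStronglyMeasurable f ν := H.locallyIntegrable_left.aestronglyMeasurable.restrict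
    have hgm : AEStronglyMeasurable g ν := H.locallyIntegrable_right.aestronglyMeasurable.restrict
    have hgi : ∀ y ∈ Set.Ioc x (x + 1), ‖∫ t in Set.Ioc x y, g t‖ₑ ≤ eLpNorm g 1 ν := by
      intro y hy
      rw [eLpNorm_one_eq_lintegral_enorm]
      exact (enorm_integral_le_lintegral_enorm _).trans
        (lintegral_mono' (Measure.restrict_mono (Set.Ioc_subset_Ioc_right hy.2) le_rfl) le_rfl)
    have h3 : ∀ᵐ y ∂ν, ‖f x‖ₑ ≤ ‖f y‖ₑ + eLpNorm g 1 ν := by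
      rw [hν, ae_restrict_iff' measurableSet_Ioc]
      filter_upwards [hfF] with y hy hyI
      have hyI' : y ∈ Set.Ioo (-(n : ℝ)) n :=
        ⟨by linarith [hxn.1, hyI.1], by linarith [hxn.2, hyI.2]⟩
      have h4 := hF x hxI y hyI' hyI.1.le
      have h5 : f x = f y - ∫ t in Set.Ioc x y, g t := by
        rw [hx hxI, hy hyI', ← h4]; abel
      rw [h5]
      exact (enorm_sub_le).trans (add_le_add le_rfl (hgi y hyI))
    have h6 : ‖f x‖ₑ ≤ eLpNorm f 1 ν + eLpNorm g 1 ν := by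
      have h7 := lintegral_mono_ae h3
      rw [lintegral_const, measure_univ, mul_one, lintegral_add_right _ measurable_const,
        lintegral_const, measure_univ, mul_one, ← eLpNorm_one_eq_lintegral_enorm] at h7
      exact h7
    exact h6.trans (add_le_add (eLpNorm_le_eLpNorm_of_exponent_le (by norm_num) hfm)
      (eLpNorm_le_eLpNorm_of_exponent_le (by norm_num) hgm))
  filter_upwards [ae_all_iff.2 key] with x hx
  obtain ⟨n, hn⟩ := exists_nat_gt (|x| + 1)
  exact hx n ⟨by linarith [neg_abs_le x], by linarith [le_abs_self x]⟩

end Embedding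

/-! ### Periodic extension -/

section Periodize

theorem toIcoMod_eq_sub_mul {L : ℝ} (hL : 0 < L) (c x : ℝ) :
    toIcoMod hL c x = x - toIcoDiv hL c x * L := by
  rw [toIcoMod, zsmul_eq_mul]

theorem measurable_toIcoMod {L : ℝ} (hL : 0 < L) (c : ℝ) : Measurable (toIcoMod hL c) := by
  have : toIcoMod hL c = fun x => x - (⌊(x - c) / L⌋ : ℝ) * L := by
    funext x
    rw [toIcoMod_eq_sub_mul, toIcoDiv_eq_floor]
  rw [this]
  fun_prop

/-- On a bounded set the periodic extension of a function supported in one period is a finite sum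
of translates. -/
theorem exists_comp_toIcoMod_eq_sum {F : Type*} [AddCommMonoid F] {L : ℝ} (hL : 0 < L) (c R : ℝ) :
    ∃ s : Finset ℤ, ∀ f : ℝ → F, (∀ x ∉ Set.Ico c (c + L), f x = 0) →
      ∀ x ∈ Set.Ioo (-R) R, f (toIcoMod hL c x) = ∑ i ∈ s, f (x - i * L) := by
  refine ⟨Finset.Icc ⌊(-R - c) / L⌋ ⌊(R - c) / L⌋, fun f hf x hx => ?_⟩
  rw [toIcoMod_eq_sub_mul]
  refine (Finset.sum_eq_single (f := fun i : ℤ => f (x - i * L)) (toIcoDiv hL c x)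
    (fun i _ hi => hf _ fun hmem => hi ?_)
    fun h => absurd ?_ h).symm
  · refine (toIcoDiv_eq_of_sub_zsmul_mem_Ico hL ?_).symm
    rwa [zsmul_eq_mul]
  · rw [toIcoDiv_eq_floor, Finset.mem_Icc]
    constructor <;> apply Int.floor_le_floor <;> gcongr <;> linarith [hx.1, hx.2]

variable {E : Type*} [NormedAddCommGroup E] [NormedSpace ℝ E]

theorem IsWeakDeriv.periodize {j : ℕ} {f g : ℝ → E} (H : IsWeakDeriv j f g) {L : ℝ} (hL : 0 < L)
    (c : ℝ) (hf : ∀ x ∉ Set.Ico c (c + L), f x = 0) (hg : ∀ x ∉ Set.Ico c (c + L), g x = 0) :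
    IsWeakDeriv j (fun x => f (toIcoMod hL c x)) (fun x => g (toIcoMod hL c x)) := by
  refine IsWeakDeriv.of_local fun R => ?_
  obtain ⟨s, hs⟩ := exists_comp_toIcoMod_eq_sum (F := E) hL c R
  exact ⟨_, _, IsWeakDeriv.sum s fun (i : ℤ) _ => H.comp_sub_const (i * L), hs f hf, hs g hg⟩

theorem measurePreserving_toIcoMod {L : ℝ} (hL : 0 < L) (c d : ℝ) :
    MeasurePreserving (toIcoMod hL c) (volume.restrict (Set.Ico d (d + L)))
      (volume.restrict (Set.Ico c (c + L))) := by
  refine ⟨measurable_toIcoMod hL c, Measure.ext fun A hA => ?_⟩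
  have hm := measurable_toIcoMod hL c
  rw [Measure.map_apply hm hA, Measure.restrict_apply (hm hA), Measure.restrict_apply hA]
  have h1 : ∀ (B : Set ℝ) (e : ℝ), volume (B ∩ Set.Ico e (e + L)) =
      volume (B ∩ Set.Ioc e (e + L)) := fun B e =>
    measure_congr ((ae_eq_refl _).inter Ico_ae_eq_Ioc)
  have h2 : volume (toIcoMod hL c ⁻¹' A ∩ Set.Ioc d (d + L)) =
      volume (toIcoMod hL c ⁻¹' A ∩ Set.Ioc c (c + L)) := by
    refine (isAddFundamentalDomain_Ioc hL d volume).measure_set_eq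
      (isAddFundamentalDomain_Ioc hL c volume) (hm hA) ?_
    rintro ⟨g, hg⟩
    obtain ⟨n, rfl⟩ := AddSubgroup.mem_zmultiples_iff.1 hg
    ext x
    simp [AddSubgroup.vadd_def]
  rw [h1, h2, ← h1]
  congr 1
  ext x
  refine and_congr_left fun hx => ?_
  rw [Set.mem_preimage, (toIcoMod_eq_self hL).2 hx]

/-- `π : ℝ → ℝ` exhibits the line as a covering of the measure `μ` which is injective on unit
intervals: functions on `μ` pull back to the line with control over every unit interval. The two
instances are the identity of the line and the reduction modulo a period `L ≥ 1`. -/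
structure IsUnitCovering (π : ℝ → ℝ) (μ : Measure ℝ) : Prop where
  measurable : Measurable π
  map_restrict_le : ∀ x, (volume.restrict (Set.Ioc x (x + 1))).map π ≤ μ
  null_of_preimage : ∀ s : Set ℝ, volume (π ⁻¹' s) = 0 → μ s = 0

theorem isUnitCovering_id : IsUnitCovering (fun x => x) volume where
  measurable := measurable_id
  map_restrict_le x := by
    change (Measure.map id _) ≤ _
    rw [Measure.map_id]; exact Measure.restrict_le_self
  null_of_preimage _ h := h

theorem isUnitCovering_toIcoMod {L : ℝ} (hL : 0 < L) (hL1 : 1 ≤ L) (c : ℝ) :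
    IsUnitCovering (toIcoMod hL c) (volume.restrict (Set.Ico c (c + L))) where
  measurable := measurable_toIcoMod hL c
  map_restrict_le x := by
    rw [← (measurePreserving_toIcoMod hL c x).map_eq]
    refine Measure.map_mono ?_ (measurable_toIcoMod hL c)
    rw [← restrict_Ico_eq_restrict_Ioc]
    exact Measure.restrict_mono (Set.Ico_subset_Ico_right (by linarith)) le_rfl
  null_of_preimage s hs := by
    rw [Measure.restrict_apply' measurableSet_Ico]
    refine measure_mono_null (fun x hx => ?_) hs
    rw [Set.mem_preimage, (toIcoMod_eq_self hL).2 hx.2]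
    exact hx.1

namespace IsUnitCovering

variable {π : ℝ → ℝ} {μ : Measure ℝ}

theorem quasiMeasurePreserving (h : IsUnitCovering π μ) :
    Measure.QuasiMeasurePreserving π volume μ := by
  refine ⟨h.measurable, fun A hA => ?_⟩
  obtain ⟨B, hAB, hB, hB0⟩ := exists_measurable_superset_of_null hA
  refine measure_mono_null hAB ?_
  rw [Measure.map_apply h.measurable hB]
  have hU : π ⁻¹' B = ⋃ n : ℤ, π ⁻¹' B ∩ Set.Ioc (n : ℝ) (n + 1) := by
    rw [← Set.inter_iUnion, iUnion_Ioc_intCast, Set.inter_univ]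
  rw [hU, measure_iUnion_null_iff]
  intro n
  have h1 := h.map_restrict_le n B
  rw [Measure.map_apply h.measurable hB, Measure.restrict_apply (h.measurable hB), hB0] at h1
  exact le_antisymm h1 bot_le

theorem ae_of_ae_comp (h : IsUnitCovering π μ) {p : ℝ → Prop} (hp : ∀ᵐ x, p (π x)) :
    ∀ᵐ y ∂μ, p y :=
  h.null_of_preimage {y | ¬p y} hp

theorem eLpNorm_comp_le (h : IsUnitCovering π μ) {F : Type*} [NormedAddCommGroup F] {f : ℝ → F}
    (hf : AEStronglyMeasurable f μ) (x : ℝ) :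
    eLpNorm (fun x => f (π x)) 2 (volume.restrict (Set.Ioc x (x + 1))) ≤ eLpNorm f 2 μ := by
  have h1 := eLpNorm_map_measure (p := 2) (μ := volume.restrict (Set.Ioc x (x + 1)))
    (hf.mono_measure (h.map_restrict_le x)) h.measurable.aemeasurable
  change eLpNorm (f ∘ π) _ _ ≤ _
  rw [← h1]
  exact eLpNorm_mono_measure _ (h.map_restrict_le x)

end IsUnitCovering

end Periodize

/-! ### Sobolev spaces as closed subspaces of products of `L²` -/

section Space

variable {E : Type*} [NormedAddCommGroup E] {π : ℝ → ℝ} {μ : Measure ℝ}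

namespace IsUnitCovering

theorem lintegral_comp_le (h : IsUnitCovering π μ) {f : ℝ → E}
    (hf : AEStronglyMeasurable f μ) (a : ℝ) (n : ℕ) :
    ∫⁻ x in Set.Ioc a (a + n), ‖f (π x)‖ₑ ≤ n * eLpNorm f 2 μ := by
  induction n with
  | zero => simp
  | succ n ih =>
    have h1 : Set.Ioc a (a + (n + 1 : ℕ)) ⊆
        Set.Ioc a (a + n) ∪ Set.Ioc (a + n) (a + n + 1) := by
      rw [Set.Ioc_union_Ioc_eq_Ioc (by linarith [Nat.cast_nonneg (α := ℝ) n]) (by linarith)]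
      push_cast
      rw [add_assoc]
    have h2 : ∫⁻ x in Set.Ioc (a + n) (a + n + 1), ‖f (π x)‖ₑ ≤ eLpNorm f 2 μ := by
      have : IsProbabilityMeasure (volume.restrict (Set.Ioc (a + n) (a + n + 1))) :=
        ⟨by simp⟩
      refine le_trans ?_ (h.eLpNorm_comp_le hf (a + n))
      rw [← eLpNorm_one_eq_lintegral_enorm]
      exact eLpNorm_le_eLpNorm_of_exponent_le (by norm_num)
        (hf.comp_quasiMeasurePreserving h.quasiMeasurePreserving).restrict
    calc _ ≤ ∫⁻ x in Set.Ioc a (a + n) ∪ Set.Ioc (a + n) (a + n + 1), ‖f (π x)‖ₑ :=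
          lintegral_mono_set h1
      _ ≤ _ := lintegral_union_le _ _ _
      _ ≤ n * eLpNorm f 2 μ + eLpNorm f 2 μ := add_le_add ih h2
      _ = _ := by push_cast; ring

theorem locallyIntegrable_comp (h : IsUnitCovering π μ) {f : ℝ → E} (hf : MemLp f 2 μ) :
    LocallyIntegrable (fun x => f (π x)) volume := by
  intro x
  refine ⟨Set.Ioc (x - 1) (x - 1 + (2 : ℕ)), Ioc_mem_nhds (by linarith) (by push_cast; linarith),
    (hf.1.comp_quasiMeasurePreserving h.quasiMeasurePreserving).restrict, ?_⟩
  exact (h.lintegral_comp_le hf.1 (x - 1) 2).trans_lt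
    (ENNReal.mul_lt_top (by simp) hf.2)

variable [NormedSpace ℝ E]

theorem exists_norm_integral_comp_le (h : IsUnitCovering π μ) {φ : ℝ → ℝ} (hφ : Continuous φ)
    (hc : HasCompactSupport φ) :
    ∃ C : ℝ, ∀ f : Lp E 2 μ, ‖∫ x, φ x • f (π x)‖ ≤ C * ‖f‖ := by
  obtain ⟨M, hM⟩ := hc.exists_bound_of_continuous hφ
  obtain ⟨R, hR⟩ := hc.isBounded.subset_ball 0
  rw [Real.ball_eq_Ioo, zero_sub, zero_add] at hR
  obtain ⟨n, hn⟩ := exists_nat_gt R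
  have hM0 : 0 ≤ M := (norm_nonneg _).trans (hM 0)
  refine ⟨M * (2 * n : ℕ), fun f => ?_⟩
  have hfm := Lp.memLp f
  have h1 : ‖∫ x, φ x • f (π x)‖ₑ ≤ ENNReal.ofReal M * ((2 * n : ℕ) * eLpNorm f 2 μ) := by
    calc ‖∫ x, φ x • f (π x)‖ₑ ≤ ∫⁻ x, ‖φ x • f (π x)‖ₑ := enorm_integral_le_lintegral_enorm _
      _ ≤ ∫⁻ x, (Set.Ioc (-n : ℝ) (-n + (2 * n : ℕ))).indicator
            (fun x => ENNReal.ofReal M * ‖f (π x)‖ₑ) x := by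
          refine lintegral_mono fun x => ?_
          by_cases hx : x ∈ Set.Ioc (-n : ℝ) (-n + (2 * n : ℕ))
          · rw [Set.indicator_of_mem hx, enorm_smul]
            gcongr
            rw [← ofReal_norm]
            exact ENNReal.ofReal_le_ofReal (hM x)
          · have : φ x = 0 := by
              by_contra h0
              have := hR (subset_tsupport _ h0)
              refine hx ⟨by linarith [this.1], ?_⟩
              push_cast; linarith [this.2]
            simp [this]
      _ = ENNReal.ofReal M * ∫⁻ x in Set.Ioc (-n : ℝ) (-n + (2 * n : ℕ)), ‖f (π x)‖ₑ := by
          rw [lintegral_indicator measurableSet_Ioc, lintegral_const_mul' _ _ ENNReal.ofReal_ne_top]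
      _ ≤ _ := by gcongr; exact h.lintegral_comp_le hfm.1 _ _
  have h2 := ENNReal.toReal_mono (ENNReal.mul_ne_top ENNReal.ofReal_ne_top
    (ENNReal.mul_ne_top (ENNReal.natCast_ne_top _) hfm.2.ne)) h1
  rw [toReal_enorm] at h2
  simpa [ENNReal.toReal_mul, hM0, mul_assoc, Lp.norm_def] using h2

/-- Pairing of the pull-back of an `L²` function with a compactly supported function. -/
def testPairing (h : IsUnitCovering π μ) {φ : ℝ → ℝ} (hφ : Continuous φ)
    (hc : HasCompactSupport φ) : Lp E 2 μ →L[ℝ] E :=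
  LinearMap.mkContinuousOfExistsBound
    { toFun := fun f => ∫ x, φ x • f (π x)
      map_add' := fun f g => by
        rw [← integral_add
          (integrable_test_smul hφ hc (h.locallyIntegrable_comp (Lp.memLp f)))
          (integrable_test_smul hφ hc (h.locallyIntegrable_comp (Lp.memLp g)))]
        refine integral_congr_ae ?_
        filter_upwards [h.quasiMeasurePreserving.ae (Lp.coeFn_add f g)] with x hx
        rw [hx, Pi.add_apply, smul_add]
      map_smul' := fun c f => by
        rw [RingHom.id_apply, ← integral_smul]
        refine integral_congr_ae ?_
        filter_upwards [h.quasiMeasurePreserving.ae (Lp.coeFn_smul c f)] with x hx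
        rw [hx, Pi.smul_apply, smul_comm] }
    (h.exists_norm_integral_comp_le hφ hc)

theorem isWeakDeriv_comp_iff (h : IsUnitCovering π μ) {j : ℕ} (f g : Lp E 2 μ) :
    IsWeakDeriv j (fun x => f (π x)) (fun x => g (π x)) ↔
      ∀ (φ : ℝ → ℝ) (hφ : ContDiff ℝ ∞ φ) (hc : HasCompactSupport φ),
        h.testPairing (contDiff_iteratedDeriv hφ j).continuous
          (hasCompactSupport_iteratedDeriv hc j) f =
        (-1 : ℝ) ^ j • h.testPairing hφ.continuous hc g :=
  ⟨fun H => H.integral_eq, fun H => ⟨h.locallyIntegrable_comp (Lp.memLp f),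
    h.locallyIntegrable_comp (Lp.memLp g), H⟩⟩

variable (E) in
/-- The Sobolev space of order `k` over `μ`: tuples `(w₀, …, w_k)` of `L²` functions whose
pull-backs to the line satisfy `w_j = ∂ʲ w₀`. For the identity of the line this is `H^k(ℝ)`, for
the reduction modulo `L` it is `H^k_per(0, L)`. -/
def sobolevSpace (h : IsUnitCovering π μ) (k : ℕ) : Submodule ℝ (Fin (k + 1) → Lp E 2 μ) where
  carrier := {w | ∀ j : Fin (k + 1), IsWeakDeriv j (fun x => w 0 (π x)) (fun x => w j (π x))}
  zero_mem' j := (h.isWeakDeriv_comp_iff _ _).2 fun φ hφ hc => by simp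
  add_mem' {v w} hv hw j := (h.isWeakDeriv_comp_iff _ _).2 fun φ hφ hc => by
    rw [Pi.add_apply, Pi.add_apply, map_add, map_add, (h.isWeakDeriv_comp_iff _ _).1 (hv j) φ hφ hc,
      (h.isWeakDeriv_comp_iff _ _).1 (hw j) φ hφ hc, smul_add]
  smul_mem' c w hw j := (h.isWeakDeriv_comp_iff _ _).2 fun φ hφ hc => by
    rw [Pi.smul_apply, Pi.smul_apply, map_smul, map_smul,
      (h.isWeakDeriv_comp_iff _ _).1 (hw j) φ hφ hc, smul_comm]

theorem isClosed_sobolevSpace (h : IsUnitCovering π μ) (k : ℕ) :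
    IsClosed (h.sobolevSpace E k : Set (Fin (k + 1) → Lp E 2 μ)) := by
  have : (h.sobolevSpace E k : Set (Fin (k + 1) → Lp E 2 μ)) =
      ⋂ (j : Fin (k + 1)) (φ : ℝ → ℝ) (hφ : ContDiff ℝ ∞ φ) (hc : HasCompactSupport φ),
        {w | h.testPairing (contDiff_iteratedDeriv hφ j).continuous
          (hasCompactSupport_iteratedDeriv hc j) (w 0) =
        (-1 : ℝ) ^ (j : ℕ) • h.testPairing hφ.continuous hc (w j)} := by
    ext w
    simp only [Set.mem_iInter]
    exact forall_congr' fun j => h.isWeakDeriv_comp_iff _ _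
  rw [this]
  refine isClosed_iInter fun j => isClosed_iInter fun φ => isClosed_iInter fun hφ =>
    isClosed_iInter fun hc => isClosed_eq ?_ ?_
  · exact (ContinuousLinearMap.continuous _).comp (continuous_apply _)
  · exact ((ContinuousLinearMap.continuous _).comp (continuous_apply _)).const_smul _

instance [CompleteSpace E] (h : IsUnitCovering π μ) (k : ℕ) :
    CompleteSpace (h.sobolevSpace E k) :=
  (h.isClosed_sobolevSpace k).completeSpace_coe

/-- The element of the Sobolev space given by a function and its derivatives. -/
def sobolevMk (h : IsUnitCovering π μ) {k : ℕ} (f : ℕ → ℝ → E)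
    (hf : ∀ j ≤ k, IsWeakDeriv j (fun x => f 0 (π x)) (fun x => f j (π x)))
    (hm : ∀ j ≤ k, MemLp (f j) 2 μ) : h.sobolevSpace E k :=
  ⟨fun j => (hm j (Nat.lt_succ_iff.1 j.2)).toLp (f j), fun j =>
    (hf j (Nat.lt_succ_iff.1 j.2)).congr
      (h.quasiMeasurePreserving.ae (hm 0 (Nat.zero_le k)).coeFn_toLp.symm)
      (h.quasiMeasurePreserving.ae (hm j (Nat.lt_succ_iff.1 j.2)).coeFn_toLp.symm)⟩

theorem coeFn_sobolevMk (h : IsUnitCovering π μ) {k : ℕ} (f : ℕ → ℝ → E)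
    (hf : ∀ j ≤ k, IsWeakDeriv j (fun x => f 0 (π x)) (fun x => f j (π x)))
    (hm : ∀ j ≤ k, MemLp (f j) 2 μ) (j : Fin (k + 1)) :
    (h.sobolevMk f hf hm).1 j =ᵐ[μ] f j :=
  (hm j (Nat.lt_succ_iff.1 j.2)).coeFn_toLp

theorem norm_apply_le (h : IsUnitCovering π μ) {k : ℕ} (w : h.sobolevSpace E k)
    (j : Fin (k + 1)) : ‖w.1 j‖ ≤ ‖w‖ :=
  norm_le_pi_norm w.1 j

/-- Sobolev embedding `H^k ⊂ L^∞`, with a constant that does not depend on the covering. -/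
theorem ae_norm_le [CompleteSpace E] (h : IsUnitCovering π μ) {k : ℕ} (hk : 1 ≤ k)
    (w : h.sobolevSpace E k) : ∀ᵐ x ∂μ, ‖w.1 0 x‖ ≤ 2 * ‖w‖ := by
  obtain ⟨k, rfl⟩ := Nat.exists_eq_add_of_le' hk
  refine h.ae_of_ae_comp ?_
  have h1 : IsWeakDeriv 1 (fun x => w.1 0 (π x)) (fun x => w.1 1 (π x)) := by
    simpa using w.2 1
  filter_upwards [h1.enorm_le] with x hx
  have h2 : ‖w.1 0 (π x)‖ₑ ≤ eLpNorm (w.1 0) 2 μ + eLpNorm (w.1 1) 2 μ :=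
    hx.trans (add_le_add (h.eLpNorm_comp_le (Lp.memLp _).1 x) (h.eLpNorm_comp_le (Lp.memLp _).1 x))
  have h3 := ENNReal.toReal_mono (ENNReal.add_ne_top.2 ⟨(Lp.memLp _).2.ne, (Lp.memLp _).2.ne⟩) h2
  rw [toReal_enorm, ENNReal.toReal_add (Lp.memLp _).2.ne (Lp.memLp _).2.ne, ← Lp.norm_def,
    ← Lp.norm_def] at h3
  linarith [h.norm_apply_le w 0, h.norm_apply_le w 1]

end IsUnitCovering

/-! ### Linear differential operators -/

variable [NormedSpace ℝ E]

/-- The linear map `w ↦ ∑ᵢ bᵢ wᵢ` from tuples of `L²` functions to `L²`. -/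
def coeffOp {k : ℕ} {b : ℕ → ℝ → E →L[ℝ] E} (hb : ∀ i ≤ k, MemLp (b i) ⊤ μ) :
    (Fin (k + 1) → Lp E 2 μ) →L[ℝ] Lp E 2 μ :=
  ∑ i : Fin (k + 1), ((ContinuousLinearMap.id ℝ (E →L[ℝ] E)).holderL μ ⊤ 2 2
    ((hb i (Nat.lt_succ_iff.1 i.2)).toLp (b i))).comp (ContinuousLinearMap.proj i)

theorem coeFn_coeffOp {k : ℕ} {b : ℕ → ℝ → E →L[ℝ] E} (hb : ∀ i ≤ k, MemLp (b i) ⊤ μ)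
    (w : Fin (k + 1) → Lp E 2 μ) :
    coeffOp hb w =ᵐ[μ] fun x => ∑ i : Fin (k + 1), b i x (w i x) := by
  have h1 : ∀ i : Fin (k + 1), ((ContinuousLinearMap.id ℝ (E →L[ℝ] E)).holderL μ ⊤ 2 2
      ((hb i (Nat.lt_succ_iff.1 i.2)).toLp (b i))) (w i) =ᵐ[μ] fun x => b i x (w i x) := by
    intro i
    refine ((ContinuousLinearMap.id ℝ (E →L[ℝ] E)).coeFn_holder (r := 2)
      ((hb i (Nat.lt_succ_iff.1 i.2)).toLp (b i)) (w i)).trans ?_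
    filter_upwards [(hb i (Nat.lt_succ_iff.1 i.2)).coeFn_toLp] with x hx
    rw [hx]; rfl
  rw [coeffOp, sum_apply]
  refine (Lp.coeFn_finsetSum _ _).trans ?_
  filter_upwards [ae_all_iff.2 h1] with x hx
  rw [Finset.sum_apply]
  exact Finset.sum_congr rfl fun i _ => hx i

/-- A linear differential operator that maps `H^k(ℝ)` onto `L²(ℝ)` has a bounded right inverse. -/
theorem exists_bounded_solution [CompleteSpace E] {k : ℕ} {b : ℕ → ℝ → E →L[ℝ] E}
    (hb : ∀ i ≤ k, MemLp (b i) ⊤ volume)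
    (hsurj : ∀ g : ℝ → E, MemLp g 2 volume → ∃ f : ℝ → E, MemHk k f ∧
      ∀ᵐ x, ∑ i ∈ Finset.range (k + 1), b i x (weakDeriv i f x) = g x) :
    ∃ K : ℝ, 0 < K ∧ ∀ g : ℝ → E, MemLp g 2 volume → ∃ f : ℕ → ℝ → E,
      (∀ j ≤ k, IsWeakDeriv j (f 0) (f j)) ∧
      (∀ j ≤ k, MemLp (f j) 2 volume ∧
        eLpNorm (f j) 2 volume ≤ ENNReal.ofReal K * eLpNorm g 2 volume) ∧
      ∀ᵐ x, ∑ i ∈ Finset.range (k + 1), b i x (f i x) = g x := by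
  have h := isUnitCovering_id
  let A : h.sobolevSpace E k →L[ℝ] Lp E 2 volume := (coeffOp hb).comp (Submodule.subtypeL _)
  have hA : ∀ w : h.sobolevSpace E k, A w =ᵐ[volume] fun x => ∑ i : Fin (k + 1), b i x (w.1 i x) :=
    fun w => coeFn_coeffOp hb w.1
  have hAs : Function.Surjective A := by
    intro g
    obtain ⟨f, hf, hfg⟩ := hsurj g (Lp.memLp g)
    have hwd : ∀ j ≤ k, IsWeakDeriv j f (weakDeriv j f) := fun j hj =>
      (hf j hj).choose_spec.1.weakDeriv_spec
    have hm : ∀ j ≤ k, MemLp (weakDeriv j f) 2 volume := fun j hj =>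
      (memLp_congr_ae (hf j hj).choose_spec.1.weakDeriv_ae_eq).2 (hf j hj).choose_spec.2
    refine ⟨h.sobolevMk (fun j => weakDeriv j f)
      (fun j hj => (hwd j hj).congr (hwd 0 (Nat.zero_le k)).eq_of_zero (ae_eq_refl _)) hm,
      Lp.ext ((hA _).trans ?_)⟩
    filter_upwards [hfg, ae_all_iff.2 (h.coeFn_sobolevMk (fun j => weakDeriv j f) (fun j hj =>
      (hwd j hj).congr (hwd 0 (Nat.zero_le k)).eq_of_zero (ae_eq_refl _)) hm)] with x hx hx'
    rw [← hx, Finset.sum_range]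
    exact Finset.sum_congr rfl fun i _ => by rw [hx' i]
  obtain ⟨K, hK0, hK⟩ := A.exists_preimage_norm_le hAs
  refine ⟨K, hK0, fun g hg => ?_⟩
  obtain ⟨w, hw, hwn⟩ := hK (hg.toLp g)
  refine ⟨fun j => if hj : j < k + 1 then w.1 ⟨j, hj⟩ else 0, fun j hj => ?_, fun j hj => ?_, ?_⟩
  · have := w.2 ⟨j, Nat.lt_succ_of_le hj⟩
    simpa [Nat.lt_succ_of_le hj] using this
  · simp only [Nat.lt_succ_of_le hj, dite_true]
    refine ⟨Lp.memLp _, ?_⟩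
    have h1 := (h.norm_apply_le w ⟨j, Nat.lt_succ_of_le hj⟩).trans hwn
    rw [Lp.norm_toLp, Lp.norm_def] at h1
    rw [← ENNReal.ofReal_toReal (Lp.memLp (w.1 ⟨j, Nat.lt_succ_of_le hj⟩)).2.ne,
      ← ENNReal.ofReal_toReal hg.2.ne, ← ENNReal.ofReal_mul hK0.le]
    exact ENNReal.ofReal_le_ofReal h1
  · filter_upwards [hA w, hg.coeFn_toLp] with x hx hx'
    rw [← hx', ← hw, hx, Finset.sum_range]
    exact Finset.sum_congr rfl fun i _ => by rw [dif_pos i.2]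

end Space

/-! ### Solving nonlinear equations with an approximate right inverse -/

section Newton

variable {X Y : Type*} [NormedAddCommGroup X] [NormedSpace ℝ X] [CompleteSpace X]
  [NormedAddCommGroup Y] [NormedSpace ℝ Y]

/-- An operator with a bounded approximate right inverse has a bounded right inverse. -/
theorem exists_preimage_of_approx (A : X →L[ℝ] Y) {K : ℝ}
    (h : ∀ y, ∃ x, ‖x‖ ≤ K * ‖y‖ ∧ ‖A x - y‖ ≤ 1 / 2 * ‖y‖) (y : Y) :
    ∃ x, A x = y ∧ ‖x‖ ≤ 2 * K * ‖y‖ := by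
  choose R hR1 hR2 using h
  let r : ℕ → Y := fun n => Nat.rec y (fun _ r => r - A (R r)) n
  have hr : ∀ n, r (n + 1) = r n - A (R (r n)) := fun n => rfl
  have hrn : ∀ n, ‖r n‖ ≤ (1 / 2) ^ n * ‖y‖ := by
    intro n
    induction n with
    | zero => simp [r]
    | succ n ih =>
      rw [hr, norm_sub_rev, pow_succ]
      linarith [hR2 (r n)]
  by_cases hy : y = 0
  · exact ⟨0, by simp [hy], by simp [hy]⟩
  have hK : 0 ≤ K := by
    by_contra hK
    have := (norm_nonneg _).trans (hR1 y)
    nlinarith [norm_pos_iff.2 hy]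
  have hs : ∀ n, ‖R (r n)‖ ≤ K * ‖y‖ * (1 / 2) ^ n := fun n =>
    (hR1 _).trans (by nlinarith [hrn n])
  have hg : HasSum (fun n : ℕ => K * ‖y‖ * (1 / 2 : ℝ) ^ n) (K * ‖y‖ * 2) :=
    hasSum_geometric_two.mul_left _
  have hsum : Summable fun n => R (r n) := .of_norm_bounded hg.summable hs
  refine ⟨∑' n, R (r n), ?_, ?_⟩
  · have h1 : Tendsto (fun n => A (∑ i ∈ Finset.range n, R (r i))) atTop (𝓝 (A (∑' n, R (r n)))) :=
      (A.continuous.tendsto _).comp hsum.hasSum.tendsto_sum_nat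
    have h2 : ∀ n, A (∑ i ∈ Finset.range n, R (r i)) = y - r n := by
      intro n
      induction n with
      | zero => simp [r]
      | succ n ih => rw [Finset.sum_range_succ, map_add, ih, hr]; abel
    have h3 : Tendsto r atTop (𝓝 0) := by
      refine squeeze_zero_norm hrn ?_
      have := (tendsto_pow_atTop_nhds_zero_of_lt_one (r := (1 / 2 : ℝ)) (by norm_num)
        (by norm_num)).mul_const ‖y‖
      simpa using this
    simp only [h2] at h1
    refine tendsto_nhds_unique h1 ?_
    simpa using tendsto_const_nhds.sub h3
  · refine (tsum_of_norm_bounded hg hs).trans (le_of_eq (by ring))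

/-- A map close to a linear operator with bounded right inverse has a zero close to any
approximate zero. -/
theorem exists_zero_of_approx (F : X → Y) (A : X →L[ℝ] Y) (u₀ : X) {K r : ℝ} (hK : 0 < K)
    (hA : ∀ y, ∃ x, A x = y ∧ ‖x‖ ≤ K * ‖y‖)
    (hF : ∀ u u', ‖u - u₀‖ ≤ r → ‖u' - u₀‖ ≤ r →
      ‖F u - F u' - A (u - u')‖ ≤ 1 / (2 * K) * ‖u - u'‖)
    (hsmall : 2 * K * ‖F u₀‖ ≤ r) : ∃ u, F u = 0 ∧ ‖u - u₀‖ ≤ 2 * K * ‖F u₀‖ := by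
  choose R hR1 hR2 using hA
  have hF' : ApproximatesLinearOn F A (Metric.closedBall u₀ r) (1 / (2 * K)).toNNReal := by
    intro u hu u' hu'
    rw [Real.coe_toNNReal _ (by positivity)]
    exact hF u u' (by simpa [dist_eq_norm] using hu) (by simpa [dist_eq_norm] using hu')
  have h1 := hF'.surjOn_closedBall_of_nonlinearRightInverse
    (ε := 2 * K * ‖F u₀‖) (b := u₀) ⟨R, K.toNNReal, fun y => by
      rw [Real.coe_toNNReal _ hK.le]; exact hR2 y, hR1⟩
    (by positivity) (Metric.closedBall_subset_closedBall hsmall)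
  have h2 : (0 : Y) ∈ Metric.closedBall (F u₀)
      ((((K.toNNReal : NNReal) : ℝ)⁻¹ - (1 / (2 * K)).toNNReal) * (2 * K * ‖F u₀‖)) := by
    rw [Real.coe_toNNReal _ hK.le, Real.coe_toNNReal _ (by positivity), Metric.mem_closedBall,
      dist_eq_norm, zero_sub, norm_neg]
    refine le_of_eq ?_
    field_simp
    ring
  obtain ⟨u, hu, hu0⟩ := h1 h2
  exact ⟨u, hu0, by simpa [dist_eq_norm] using hu⟩

end Newton

/-! ### Cut-off functions -/

section Cutoff

variable {E : Type*} [NormedAddCommGroup E] [NormedSpace ℝ E]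

/-- The `j`-th derivative of the product `ψ w₀` by the Leibniz rule, where `w j` stands for the
`j`-th derivative of `w₀`. -/
def leibnizSum (ψ : ℝ → ℝ) (w : ℕ → ℝ → E) (j : ℕ) (x : ℝ) : E :=
  ∑ p ∈ Finset.HasAntidiagonal.antidiagonal j, (j.choose p.1) • iteratedDeriv p.1 ψ x • w p.2 x

theorem leibnizSum_zero (ψ : ℝ → ℝ) (w : ℕ → ℝ → E) (x : ℝ) :
    leibnizSum ψ w 0 x = ψ x • w 0 x := by
  simp [leibnizSum]

theorem sum_antidiagonal_choose (j : ℕ) :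
    ∑ p ∈ Finset.HasAntidiagonal.antidiagonal j, (j.choose p.1 : ℝ) = 2 ^ j := by
  have := Nat.sum_range_choose j
  rw [Finset.Nat.sum_antidiagonal_eq_sum_range_succ_mk]
  exact_mod_cast this

theorem norm_leibnizSum_le {ψ : ℝ → ℝ} {w : ℕ → ℝ → E} {k j : ℕ} (hj : j ≤ k) {x : ℝ}
    (hψ : ∀ i ≤ k, |iteratedDeriv i ψ x| ≤ 1) :
    ‖leibnizSum ψ w j x‖ ≤ 2 ^ k * ∑ i ∈ Finset.range (k + 1), ‖w i x‖ := by
  set S := ∑ i ∈ Finset.range (k + 1), ‖w i x‖ with hS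
  have hS0 : 0 ≤ S := Finset.sum_nonneg fun _ _ => norm_nonneg _
  have hwS : ∀ i ≤ k, ‖w i x‖ ≤ S := fun i hi =>
    Finset.single_le_sum (f := fun i => ‖w i x‖) (fun _ _ => norm_nonneg _)
      (Finset.mem_range.2 (Nat.lt_succ_of_le hi))
  calc ‖leibnizSum ψ w j x‖ ≤
      ∑ p ∈ Finset.HasAntidiagonal.antidiagonal j, (j.choose p.1 : ℝ) * S := by
        refine norm_sum_le_of_le _ fun p hp => ?_
        have hp' := Finset.HasAntidiagonal.mem_antidiagonal.1 hp
        rw [← Nat.cast_smul_eq_nsmul ℝ, norm_smul, norm_smul, RCLike.norm_natCast, Real.norm_eq_abs]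
        gcongr
        calc _ ≤ 1 * S :=
              mul_le_mul (hψ _ (by omega)) (hwS _ (by omega)) (norm_nonneg _) zero_le_one
          _ = S := one_mul _
    _ = 2 ^ j * S := by rw [← Finset.sum_mul, sum_antidiagonal_choose]
    _ ≤ 2 ^ k * S := by gcongr; norm_num

/-- If the derivatives of `ψ` are small, then multiplication by `ψ` almost commutes with
differentiation. -/
theorem norm_leibnizSum_sub_le {ψ : ℝ → ℝ} {w : ℕ → ℝ → E} {k j : ℕ} (hj : j ≤ k) {x δ : ℝ}
    (hδ : 0 ≤ δ) (hψ : ∀ i, 1 ≤ i → i ≤ k → |iteratedDeriv i ψ x| ≤ δ) :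
    ‖leibnizSum ψ w j x - ψ x • w j x‖ ≤ 2 ^ k * δ * ∑ i ∈ Finset.range (k + 1), ‖w i x‖ := by
  set S := ∑ i ∈ Finset.range (k + 1), ‖w i x‖ with hS
  have hS0 : 0 ≤ S := Finset.sum_nonneg fun _ _ => norm_nonneg _
  have hwS : ∀ i ≤ k, ‖w i x‖ ≤ S := fun i hi =>
    Finset.single_le_sum (f := fun i => ‖w i x‖) (fun _ _ => norm_nonneg _)
      (Finset.mem_range.2 (Nat.lt_succ_of_le hi))
  have h0 : ((0, j) : ℕ × ℕ) ∈ Finset.HasAntidiagonal.antidiagonal j := by simp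
  have h1 : leibnizSum ψ w j x - ψ x • w j x =
      ∑ p ∈ (Finset.HasAntidiagonal.antidiagonal j).erase (0, j),
        (j.choose p.1) • iteratedDeriv p.1 ψ x • w p.2 x := by
    rw [leibnizSum, ← Finset.add_sum_erase _ _ h0]
    simp
  rw [h1]
  calc _ ≤ ∑ p ∈ (Finset.HasAntidiagonal.antidiagonal j).erase (0, j),
          (j.choose p.1 : ℝ) * (δ * S) := by
        refine norm_sum_le_of_le _ fun p hp => ?_
        have hp' := Finset.HasAntidiagonal.mem_antidiagonal.1 (Finset.mem_of_mem_erase hp)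
        have hp1 : 1 ≤ p.1 := by
          by_contra hlt
          have h01 : p.1 = 0 := by omega
          exact Finset.ne_of_mem_erase hp (Prod.ext h01 (by simp; omega))
        rw [← Nat.cast_smul_eq_nsmul ℝ, norm_smul, norm_smul, RCLike.norm_natCast, Real.norm_eq_abs]
        gcongr
        · exact hψ _ hp1 (by omega)
        · exact hwS _ (by omega)
    _ ≤ ∑ p ∈ Finset.HasAntidiagonal.antidiagonal j, (j.choose p.1 : ℝ) * (δ * S) :=
        Finset.sum_le_sum_of_subset_of_nonneg (Finset.erase_subset _ _) fun _ _ _ => by positivity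
    _ = 2 ^ j * (δ * S) := by rw [← Finset.sum_mul, sum_antidiagonal_choose]
    _ ≤ 2 ^ k * (δ * S) := by gcongr; norm_num
    _ = _ := by ring

theorem leibnizSum_eq_zero {ψ : ℝ → ℝ} (w : ℕ → ℝ → E) (j : ℕ) {x : ℝ} (hx : x ∉ tsupport ψ) :
    leibnizSum ψ w j x = 0 := by
  refine Finset.sum_eq_zero fun p _ => ?_
  have : iteratedDeriv p.1 ψ x = 0 := by
    by_contra h
    exact hx (tsupport_iteratedDeriv_subset ψ p.1 (subset_tsupport _ h))
  rw [this, zero_smul, smul_zero]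

theorem iteratedDeriv_comp_div {θ : ℝ → ℝ} (hθ : ContDiff ℝ ∞ θ) (L : ℝ) (j : ℕ) (x : ℝ) :
    iteratedDeriv j (fun x => θ (x / L)) x = (L⁻¹) ^ j * iteratedDeriv j θ (x / L) := by
  have h1 := iteratedDeriv_comp_const_mul (n := j) (hθ.of_le (by exact_mod_cast le_top)) L⁻¹
  have h2 : (fun x => θ (x / L)) = fun x => θ (L⁻¹ * x) := by
    funext y; rw [div_eq_inv_mul]
  rw [h2, h1, div_eq_inv_mul]

/-- A function on the line whose derivatives are bounded becomes slowly varying when dilated. -/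
theorem exists_dilation_bound {θ : ℝ → ℝ} (hθ : ContDiff ℝ ∞ θ) (k : ℕ)
    (hb : ∀ j ≤ k, ∃ M, ∀ x, |iteratedDeriv j θ x| ≤ M) {δ : ℝ} (hδ : 0 < δ) :
    ∃ L₀ : ℝ, 1 ≤ L₀ ∧ ∀ L ≥ L₀, ∀ j, 1 ≤ j → j ≤ k → ∀ x,
      |iteratedDeriv j (fun x => θ (x / L)) x| ≤ δ := by
  have hb' : ∃ M : ℝ, ∀ j ≤ k, ∀ x, |iteratedDeriv j θ x| ≤ M := by
    choose! M hM using hb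
    refine ⟨∑ j ∈ Finset.range (k + 1), |M j|, fun j hj x => (hM j hj x).trans ?_⟩
    exact (le_abs_self _).trans (Finset.single_le_sum (f := fun j => |M j|)
      (fun _ _ => abs_nonneg _) (Finset.mem_range.2 (Nat.lt_succ_of_le hj)))
  obtain ⟨M, hM⟩ := hb'
  refine ⟨max 1 (M / δ), le_max_left _ _, fun L hL j hj1 hjk x => ?_⟩
  have hL1 : 1 ≤ L := (le_max_left _ _).trans hL
  have hLM : M / δ ≤ L := (le_max_right _ _).trans hL
  have hL0 : 0 < L := by linarith
  rw [iteratedDeriv_comp_div hθ, abs_mul, abs_of_nonneg (by positivity)]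
  have hM0 : 0 ≤ M := (abs_nonneg _).trans (hM j hjk x)
  calc L⁻¹ ^ j * |iteratedDeriv j θ (x / L)| ≤ L⁻¹ ^ 1 * M := by
        gcongr ?_ * ?_
        · exact pow_le_pow_of_le_one (by positivity) (inv_le_one_of_one_le₀ hL1) hj1
        · exact hM j hjk _
    _ ≤ δ := by
        rw [pow_one, inv_mul_le_iff₀ hL0]
        rwa [div_le_iff₀ hδ] at hLM

theorem bddAbove_iteratedDeriv {θ : ℝ → ℝ} (hθ : ContDiff ℝ ∞ θ) (hc : HasCompactSupport θ)
    (j : ℕ) : ∃ M, ∀ x, |iteratedDeriv j θ x| ≤ M :=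
  (hasCompactSupport_iteratedDeriv hc j).exists_bound_of_continuous
    (contDiff_iteratedDeriv hθ j).continuous

/-- Slowly varying cut-offs of size `L` around any point. -/
theorem exists_slow_bump (k : ℕ) {δ : ℝ} (hδ : 0 < δ) :
    ∃ L₀ : ℝ, 1 ≤ L₀ ∧ ∀ L ≥ L₀, ∀ c : ℝ, ∃ ψ : ℝ → ℝ, ContDiff ℝ ∞ ψ ∧
      (∀ x, |ψ x| ≤ 1) ∧ (∀ x, |x - c| ≤ L / 4 → ψ x = 1) ∧
      (∀ x ∈ tsupport ψ, |x - c| ≤ 3 * L / 8) ∧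
      ∀ i, 1 ≤ i → i ≤ k → ∀ x, |iteratedDeriv i ψ x| ≤ δ := by
  let η : ContDiffBump (0 : ℝ) := ⟨1 / 4, 3 / 8, by norm_num, by norm_num⟩
  obtain ⟨L₀, h1, hL₀⟩ := exists_dilation_bound η.contDiff k
    (fun j _ => bddAbove_iteratedDeriv η.contDiff η.hasCompactSupport j) hδ
  refine ⟨L₀, h1, fun L hL c => ⟨fun x => η ((x - c) / L), ?_, ?_, ?_, ?_, ?_⟩⟩
  · exact η.contDiff.comp ((contDiff_id.sub contDiff_const).div_const L)
  · intro x
    rw [abs_of_nonneg η.nonneg]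
    exact η.le_one
  · intro x hx
    have hL0 : 0 < L := by linarith
    refine η.one_of_mem_closedBall ?_
    rw [mem_closedBall_zero_iff, Real.norm_eq_abs, abs_div, abs_of_pos hL0, div_le_iff₀ hL0]
    show _ ≤ 1 / 4 * L
    linarith
  · have hL0 : 0 < L := by linarith
    have hcl : IsClosed {x : ℝ | |x - c| ≤ 3 * L / 8} := isClosed_le (by fun_prop) (by fun_prop)
    refine fun x hx => closure_minimal (fun y hy => ?_) hcl hx
    have h2 : (y - c) / L ∈ Function.support η := hy
    rw [η.support_eq, mem_ball_zero_iff, Real.norm_eq_abs, abs_div, abs_of_pos hL0,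
      div_lt_iff₀ hL0] at h2
    have h3 : |y - c| < 3 / 8 * L := h2
    show |y - c| ≤ 3 * L / 8
    linarith
  · intro i hi1 hik x
    have := hL₀ L hL i hi1 hik (x - c)
    rwa [← congrFun (iteratedDeriv_comp_sub_const i (fun x => η (x / L)) c) x] at this

theorem contDiff_comp_toIcoMod {L : ℝ} (hL : 0 < L) (c : ℝ) {θ : ℝ → ℝ} (hθ : ContDiff ℝ ∞ θ)
    (h0 : ∀ x ∉ Set.Ico c (c + L), θ x = 0) : ContDiff ℝ ∞ (fun x => θ (toIcoMod hL c x)) := by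
  rw [contDiff_iff_contDiffAt]
  intro x
  obtain ⟨s, hs⟩ := exists_comp_toIcoMod_eq_sum (F := ℝ) hL c (|x| + 1)
  have h1 : ContDiffAt ℝ ∞ (fun x => ∑ i ∈ s, θ (x - i * L)) x :=
    ContDiff.contDiffAt (ContDiff.sum fun i _ => hθ.comp (contDiff_id.sub contDiff_const))
  refine h1.congr_of_eventuallyEq ?_
  filter_upwards [Ioo_mem_nhds (show -(|x| + 1) < x by linarith [neg_abs_le x])
    (show x < |x| + 1 by linarith [le_abs_self x])] with y hy using hs θ h0 y hy

theorem continuous_periodic_bounded {F : Type*} [NormedAddCommGroup F] {g : ℝ → F} {T : ℝ}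
    (hT : 0 < T) (hg : Continuous g) (hp : Function.Periodic g T) : ∃ M, ∀ x, ‖g x‖ ≤ M := by
  obtain ⟨M, hM⟩ := (isCompact_Icc (a := (0 : ℝ)) (b := T)).exists_bound_of_continuousOn
    hg.continuousOn
  refine ⟨M, fun x => ?_⟩
  obtain ⟨y, hy, hxy⟩ := hp.exists_mem_Ico₀ hT x
  rw [hxy]
  exact hM y (Set.Ico_subset_Icc_self hy)

theorem exists_isCutoff (k : ℕ) : ∃ L₀ : ℝ, 1 ≤ L₀ ∧ ∀ L ≥ L₀, ∃ χ, IsCutoff k L χ := by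
  let η : ContDiffBump (0 : ℝ) := ⟨1 / 6, 1 / 3, by norm_num, by norm_num⟩
  let θ : ℝ → ℝ := fun x => η (toIcoMod one_pos (-(1 / 2) : ℝ) x)
  have hη0 : ∀ x : ℝ, 1 / 3 ≤ |x| → η x = 0 := fun x hx =>
    η.zero_of_le_dist (by rw [Real.dist_eq, sub_zero]; exact hx)
  have hθ : ContDiff ℝ ∞ θ := by
    refine contDiff_comp_toIcoMod one_pos _ η.contDiff fun x hx => hη0 x ?_
    by_contra h
    rw [not_le, abs_lt] at h
    exact hx ⟨by linarith, by linarith⟩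
  have hper : Function.Periodic θ 1 := fun x => by
    simp only [θ]; rw [toIcoMod_add_right]
  have hself : ∀ x ∈ Set.Ico (-(1 / 2) : ℝ) (1 / 2), θ x = η x := fun x hx => by
    have : toIcoMod one_pos (-(1 / 2) : ℝ) x = x := (toIcoMod_eq_self one_pos).2
      ⟨hx.1, by linarith [hx.2]⟩
    simp only [θ, this]
  have hb : ∀ j ≤ k, ∃ M, ∀ x, |iteratedDeriv j θ x| ≤ M := fun j _ => by
    refine continuous_periodic_bounded one_pos (contDiff_iteratedDeriv hθ j).continuous fun x => ?_
    have := iteratedDeriv_comp_add_const j θ 1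
    rw [funext hper] at this
    exact (congrFun this x).symm
  obtain ⟨L₀, h1, hL₀⟩ := exists_dilation_bound hθ k hb one_pos
  refine ⟨L₀, h1, fun L hL => ⟨fun x => θ (x / L), ?_⟩⟩
  have hL0 : 0 < L := by linarith
  have hI : ∀ x, θ x ∈ Set.Icc (0 : ℝ) 1 := fun x => ⟨η.nonneg, η.le_one⟩
  have hhalf : θ (1 / 2) = 0 := by
    have := hper (-(1 / 2))
    rw [show (-(1 / 2) + 1 : ℝ) = 1 / 2 by norm_num] at this
    rw [this, hself _ ⟨le_refl _, by norm_num⟩]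
    exact hη0 _ (by rw [abs_neg, abs_of_pos] <;> norm_num)
  refine ⟨hθ.comp (contDiff_id.div_const L), fun x => ?_, fun x => hI _, fun j hj x => ?_,
    fun x hx => ?_, fun x hx => ?_⟩
  · show θ ((x + L) / L) = θ (x / L)
    rw [add_div, div_self hL0.ne', hper]
  · rcases Nat.eq_zero_or_pos j with rfl | hj0
    · rw [iteratedDeriv_zero, abs_of_nonneg (hI _).1]
      exact (hI _).2
    · exact hL₀ L hL j hj0 hj x
  · have h2 : |x / L| ≤ 1 / 6 := by
      rw [abs_div, abs_of_pos hL0, div_le_iff₀ hL0, abs_le]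
      constructor <;> linarith [hx.1, hx.2]
    have h3 := abs_le.1 h2
    rw [hself _ ⟨by linarith, by linarith⟩]
    refine η.one_of_mem_closedBall ?_
    rw [mem_closedBall_zero_iff]
    exact h2
  · have h2 : 1 / 3 ≤ |x / L| ∧ |x / L| ≤ 1 / 2 := by
      rw [abs_div, abs_of_pos hL0, div_le_iff₀ hL0, le_div_iff₀ hL0]
      rcases hx with hx | hx
      · rw [abs_of_nonpos (by linarith [hx.2])]
        constructor <;> linarith [hx.1, hx.2]
      · rw [abs_of_nonneg (by linarith [hx.1])]
        constructor <;> linarith [hx.1, hx.2]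
    have h3 := abs_le.1 h2.2
    rcases h3.2.lt_or_eq with h4 | h4
    · rw [hself _ ⟨h3.1, h4⟩]
      exact hη0 _ h2.1
    · rw [h4, hhalf]

/-- One period of a periodic cut-off is a compactly supported cut-off. -/
theorem IsCutoff.exists_compact {k : ℕ} {L : ℝ} (hL : 0 < L) {χ : ℝ → ℝ} (h : IsCutoff k L χ) :
    ∃ ψ : ℝ → ℝ, ContDiff ℝ ∞ ψ ∧ (∀ x ∈ Set.Ico (-(L / 2)) (L / 2), ψ x = χ x) ∧
      (∀ x ∈ tsupport ψ, |x| ≤ L / 3) ∧ (∀ x, ψ x ∈ Set.Icc (0 : ℝ) 1) ∧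
      (∀ j ≤ k, ∀ x, |iteratedDeriv j ψ x| ≤ 1) ∧ ∀ x, |x| ≤ L / 6 → ψ x = 1 := by
  let η : ContDiffBump (0 : ℝ) := ⟨L / 3, 5 * L / 12, by positivity,
    by show L / 3 < 5 * L / 12; linarith⟩
  have hη1 : ∀ x : ℝ, |x| ≤ L / 3 → η x = 1 := fun x hx =>
    η.one_of_mem_closedBall (by simpa using hx)
  have hη0 : ∀ x : ℝ, 5 * L / 12 ≤ |x| → η x = 0 := fun x hx =>
    η.zero_of_le_dist (by simpa [Real.dist_eq] using hx)
  have hz : ∀ x : ℝ, L / 3 ≤ |x| → |x| ≤ L / 2 → χ x = 0 := by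
    intro x h1 h2
    refine h.eq_zero x ?_
    rcases abs_cases x with ⟨h3, _⟩ | ⟨h3, _⟩
    · right; constructor <;> linarith
    · left; constructor <;> linarith
  have heq : ∀ x : ℝ, |x| ≤ L / 2 → χ x * η x = χ x := by
    intro x hx
    rcases le_total |x| (L / 3) with h1 | h1
    · rw [hη1 x h1, mul_one]
    · rw [hz x h1 hx, zero_mul]
  have hout : ∀ x : ℝ, L / 3 < |x| → χ x * η x = 0 := by
    intro x hx
    rcases le_total |x| (L / 2) with h1 | h1
    · rw [hz x hx.le h1, zero_mul]
    · rw [hη0 x (by linarith), mul_zero]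
  have hsupp : ∀ x ∈ tsupport (fun x => χ x * η x), |x| ≤ L / 3 := by
    intro x hx
    refine closure_minimal (t := {x : ℝ | |x| ≤ L / 3}) (fun y hy => ?_)
      (isClosed_le (by fun_prop) (by fun_prop)) hx
    by_contra h1
    exact hy (hout y (not_le.1 h1))
  refine ⟨fun x => χ x * η x, h.smooth.mul η.contDiff, fun x hx => heq x ?_, hsupp, fun x => ?_,
    fun j hj x => ?_, fun x hx => ?_⟩
  · exact abs_le.2 ⟨hx.1, hx.2.le⟩
  · exact ⟨mul_nonneg (h.mem_Icc x).1 η.nonneg, mul_le_one₀ (h.mem_Icc x).2 η.nonneg η.le_one⟩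
  · by_cases hx : x ∈ tsupport (fun x => χ x * η x)
    · have h1 : |x| < L / 2 := by linarith [hsupp x hx]
      have h2 : (fun x => χ x * η x) =ᶠ[𝓝 x] χ := by
        filter_upwards [(isOpen_lt continuous_abs continuous_const).mem_nhds h1] with y hy
        exact heq y (le_of_lt hy)
      rw [h2.iteratedDeriv_eq j]
      exact h.deriv_le j hj x
    · have : iteratedDeriv j (fun x => χ x * η x) x = 0 := by
        by_contra h0
        exact hx (tsupport_iteratedDeriv_subset _ j (subset_tsupport _ h0))
      rw [this]; simp
  · simp only
    rw [heq x (by linarith)]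
    exact h.eq_one x (abs_le.1 hx)

end Cutoff

/-! ### Approximate inversion of the periodic problem -/

section Approx

theorem eLpNorm_sum_norm_le {E : Type*} [NormedAddCommGroup E] {k : ℕ} {f : ℕ → ℝ → E}
    {μ : Measure ℝ} {A : ENNReal}
    (hm : ∀ j ≤ k, AEStronglyMeasurable (f j) μ) (hf : ∀ j ≤ k, eLpNorm (f j) 2 μ ≤ A) :
    eLpNorm (fun x => ∑ i ∈ Finset.range (k + 1), ‖f i x‖) 2 μ ≤ (k + 1 : ℕ) * A := by
  have h1 : (fun x => ∑ i ∈ Finset.range (k + 1), ‖f i x‖) =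
      ∑ i ∈ Finset.range (k + 1), fun x => ‖f i x‖ := by
    funext x; rw [Finset.sum_apply]
  rw [h1]
  refine (eLpNorm_sum_le (fun i hi => (hm i ?_).norm) (by norm_num)).trans ?_
  · exact Nat.lt_succ_iff.1 (Finset.mem_range.1 hi)
  · refine (Finset.sum_le_card_nsmul _ _ A fun i hi => ?_).trans ?_
    · rw [eLpNorm_norm]
      exact hf i (Nat.lt_succ_iff.1 (Finset.mem_range.1 hi))
    · simp

variable {E : Type*} [NormedAddCommGroup E] [NormedSpace ℝ E]

theorem Function.Periodic.comp_toIcoMod {F : Type*} {f : ℝ → F} {L : ℝ}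
    (hf : Function.Periodic f L) (hL : 0 < L) (c x : ℝ) : f (toIcoMod hL c x) = f x := by
  rw [toIcoMod]; exact hf.sub_zsmul_eq _

theorem eLpNorm_comp_toIcoMod_le {F : Type*} [NormedAddCommGroup F] {L : ℝ} (hL : 0 < L)
    (c d : ℝ) {f : ℝ → F} (hf : AEStronglyMeasurable f volume) :
    eLpNorm (fun x => f (toIcoMod hL c x)) 2 (volume.restrict (Set.Ico d (d + L))) ≤
      eLpNorm f 2 volume := by
  refine (eLpNorm_comp_measurePreserving (p := 2) hf.restrict
    (measurePreserving_toIcoMod hL c d)).trans_le ?_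
  exact eLpNorm_mono_measure _ Measure.restrict_le_self

theorem aestronglyMeasurable_apply {μ : Measure ℝ} {b : ℝ → E →L[ℝ] E} {f : ℝ → E}
    (hb : AEStronglyMeasurable b μ) (hf : AEStronglyMeasurable f μ) :
    AEStronglyMeasurable (fun x => b x (f x)) μ :=
  (ContinuousLinearMap.id ℝ (E →L[ℝ] E)).aestronglyMeasurable_comp₂ hb hf

/-- The solution operator of the line, localized to a window of length `L` around `c` and extended
periodically, solves the periodic problem for the part of `g` in the inner half of the window up to
an error of order `δ`. The coefficients are assumed to agree up to `δ` where the localizing function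
`ψ` lives, and the derivatives of `ψ` to be at most `δ`. -/
theorem exists_local_approx_solution {k : ℕ} {b bn : ℕ → ℝ → E →L[ℝ] E} {K M δ L c : ℝ}
    (hM : 0 ≤ M) (hδ : 0 < δ) (hδ1 : δ ≤ 1)
    (hbM : ∀ i ≤ k, ∀ᵐ x, ‖b i x‖ ≤ M)
    (hsol : ∀ g : ℝ → E, MemLp g 2 volume → ∃ f : ℕ → ℝ → E,
      (∀ j ≤ k, IsWeakDeriv j (f 0) (f j)) ∧
      (∀ j ≤ k, MemLp (f j) 2 volume ∧
        eLpNorm (f j) 2 volume ≤ ENNReal.ofReal K * eLpNorm g 2 volume) ∧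
      ∀ᵐ x, ∑ i ∈ Finset.range (k + 1), b i x (f i x) = g x)
    (hL : 0 < L)
    (hbn : ∀ i ≤ k, AEStronglyMeasurable (bn i) volume)
    (hbnp : ∀ i ≤ k, Function.Periodic (bn i) L)
    (hbe : ∀ i, 1 ≤ i → i ≤ k → bn i = b i)
    (hb0 : ∀ᵐ x, |x - c| ≤ 3 * L / 8 → ‖bn 0 x - b 0 x‖ ≤ δ)
    {ψ : ℝ → ℝ} (hψ : ContDiff ℝ ∞ ψ) (hψ1 : ∀ x, |ψ x| ≤ 1)
    (hψone : ∀ x, |x - c| ≤ L / 4 → ψ x = 1) (hψs : ∀ x ∈ tsupport ψ, |x - c| ≤ 3 * L / 8)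
    (hψd : ∀ i, 1 ≤ i → i ≤ k → ∀ x, |iteratedDeriv i ψ x| ≤ δ)
    (d : ℝ) {g : ℝ → E} (hg : MemLp g 2 (volume.restrict (Set.Ico d (d + L)))) :
    ∃ p : ℕ → ℝ → E,
      (∀ j ≤ k, IsWeakDeriv j (fun x => p 0 (toIcoMod hL d x)) (fun x => p j (toIcoMod hL d x))) ∧
      (∀ j ≤ k, AEStronglyMeasurable (p j) (volume.restrict (Set.Ico d (d + L))) ∧
        eLpNorm (p j) 2 (volume.restrict (Set.Ico d (d + L))) ≤
        ENNReal.ofReal (2 ^ k * (k + 1) * K) * eLpNorm g 2 (volume.restrict (Set.Ico d (d + L)))) ∧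
      eLpNorm (fun x => ∑ i ∈ Finset.range (k + 1), bn i x (p i x) -
        {x | toIcoMod hL (c - L / 2) x ∈ Set.Ico (c - L / 4) (c + L / 4)}.indicator g x) 2
          (volume.restrict (Set.Ico d (d + L))) ≤
        ENNReal.ofReal ((1 + (k + 1) * M * 2 ^ k) * (k + 1) * K * δ) *
          eLpNorm g 2 (volume.restrict (Set.Ico d (d + L))) := by
  set μ := volume.restrict (Set.Ico d (d + L)) with hμ
  set W := Set.Ico (c - L / 2) (c - L / 2 + L) with hW
  set I := Set.Ico (c - L / 4) (c + L / 4) with hI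
  set ϖ := toIcoMod hL (c - L / 2) with hϖ
  set π := toIcoMod hL d with hπ
  have hIW : I ⊆ W := Set.Ico_subset_Ico (by linarith) (by linarith)
  -- the part of `g` in the inner half of the window, unrolled to a function on the line
  have hgW : MemLp (fun x => g (π x)) 2 (volume.restrict W) :=
    hg.comp_measurePreserving (measurePreserving_toIcoMod hL d (c - L / 2))
  have hGm : MemLp (I.indicator fun x => g (π x)) 2 volume := by
    rw [memLp_indicator_iff_restrict measurableSet_Ico]
    exact hgW.mono_measure (Measure.restrict_mono hIW le_rfl)
  have hGn : eLpNorm (I.indicator fun x => g (π x)) 2 volume ≤ eLpNorm g 2 μ := by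
    rw [eLpNorm_indicator_eq_eLpNorm_restrict measurableSet_Ico]
    refine (eLpNorm_mono_measure _ (Measure.restrict_mono hIW le_rfl)).trans ?_
    exact (eLpNorm_comp_measurePreserving (p := 2) hg.1
      (measurePreserving_toIcoMod hL d (c - L / 2))).le
  obtain ⟨f, hf1, hf2, hf3⟩ := hsol _ hGm
  set S : ℝ → ℝ := fun x => ∑ i ∈ Finset.range (k + 1), ‖f i x‖ with hS
  have hSn : eLpNorm S 2 volume ≤ ENNReal.ofReal ((k + 1) * K) * eLpNorm g 2 μ := by
    refine (eLpNorm_sum_norm_le (fun j hj => (hf2 j hj).1.1) fun j hj => (hf2 j hj).2).trans ?_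
    rw [ENNReal.ofReal_mul (by positivity), mul_assoc]
    gcongr
    exact_mod_cast (ENNReal.ofReal_natCast (k + 1)).ge
  have hS0 : ∀ x, 0 ≤ S x := fun x => Finset.sum_nonneg fun _ _ => norm_nonneg _
  have hsuppW : ∀ x, x ∉ W → x ∉ tsupport ψ := fun x hx hxs => by
    have := abs_le.1 (hψs x hxs)
    exact hx ⟨by linarith [this.1], by linarith [this.2]⟩
  have hP0 : ∀ (j : ℕ) (x : ℝ), x ∉ W → leibnizSum ψ f j x = 0 := fun j x hx =>
    leibnizSum_eq_zero f j (hsuppW x hx)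
  have hwd : ∀ j ≤ k, IsWeakDeriv j (fun x => leibnizSum ψ f 0 x) (leibnizSum ψ f j) := by
    intro j hj
    simp only [leibnizSum_zero]
    exact IsWeakDeriv.leibniz hψ hf1 hj
  have hPm : ∀ j ≤ k, AEStronglyMeasurable (leibnizSum ψ f j) volume := fun j hj =>
    (hwd j hj).locallyIntegrable_right.aestronglyMeasurable
  have hππ : ∀ x, ϖ (π x) = ϖ x := fun x => toIcoMod_toIcoMod hL _ _ _
  have hπϖ : ∀ x, π (ϖ x) = π x := fun x => toIcoMod_toIcoMod hL _ _ _
  have hmp : MeasurePreserving ϖ μ (volume.restrict W) :=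
    measurePreserving_toIcoMod hL (c - L / 2) d
  have hd1 : ∀ x, ∀ i ≤ k, |iteratedDeriv i ψ x| ≤ 1 := by
    intro x i hi
    rcases Nat.eq_zero_or_pos i with rfl | h0
    · simpa using hψ1 x
    · exact (hψd i h0 hi x).trans hδ1
  refine ⟨fun j x => leibnizSum ψ f j (ϖ x), fun j hj => ?_, fun j hj => ⟨?_, ?_⟩, ?_⟩
  · simp only [hππ]
    exact (hwd j hj).periodize hL (c - L / 2) (hP0 0) (hP0 j)
  · exact (hPm j hj).restrict.comp_measurePreserving hmp
  · refine (eLpNorm_comp_toIcoMod_le hL _ _ (hPm j hj)).trans ?_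
    have h1 : eLpNorm (leibnizSum ψ f j) 2 volume ≤ ENNReal.ofReal (2 ^ k) * eLpNorm S 2 volume :=
      eLpNorm_le_mul_eLpNorm_of_ae_le_mul (.of_forall fun x => by
        rw [Real.norm_of_nonneg (hS0 x)]
        exact norm_leibnizSum_le hj (hd1 x)) 2
    refine h1.trans ?_
    rw [mul_assoc, ENNReal.ofReal_mul (by positivity), mul_assoc]
    gcongr
  · set e : ℝ → E := fun x => ∑ i ∈ Finset.range (k + 1), bn i x (leibnizSum ψ f i x) -
      I.indicator (fun x => g (π x)) x with he
    have hem : AEStronglyMeasurable e volume := by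
      refine AEStronglyMeasurable.sub ?_ hGm.1
      refine Finset.aestronglyMeasurable_fun_sum _ fun i hi => ?_
      have hi' := Nat.lt_succ_iff.1 (Finset.mem_range.1 hi)
      exact aestronglyMeasurable_apply (hbn i hi') (hPm i hi')
    have heq : (fun x => ∑ i ∈ Finset.range (k + 1), bn i x (leibnizSum ψ f i (ϖ x)) -
        {x | ϖ x ∈ I}.indicator g x) =ᵐ[μ] fun x => e (ϖ x) := by
      rw [hμ]
      filter_upwards [ae_restrict_mem measurableSet_Ico] with x hx
      have h1 : ∀ i ∈ Finset.range (k + 1), bn i (ϖ x) = bn i x := fun i hi =>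
        (hbnp i (Nat.lt_succ_iff.1 (Finset.mem_range.1 hi))).comp_toIcoMod hL _ x
      have h2 : π x = x := (toIcoMod_eq_self hL).2 hx
      simp only [he]
      congr 1
      · exact Finset.sum_congr rfl fun i hi => by rw [h1 i hi]
      · by_cases hxI : ϖ x ∈ I
        · rw [Set.indicator_of_mem hxI, Set.indicator_of_mem (by exact hxI), hπϖ, h2]
        · rw [Set.indicator_of_notMem hxI, Set.indicator_of_notMem (by exact hxI)]
    rw [eLpNorm_congr_ae heq]
    refine (eLpNorm_comp_toIcoMod_le hL _ _ hem).trans ?_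
    have hpt : ∀ᵐ x, ‖e x‖ ≤ ((1 + (k + 1) * M * 2 ^ k) * δ) * ‖S x‖ := by
      have hbM' : ∀ᵐ x, ∀ i ≤ k, ‖b i x‖ ≤ M :=
        ae_all_iff.2 fun i => by
          by_cases hi : i ≤ k
          · filter_upwards [hbM i hi] with x hx _ using hx
          · exact .of_forall fun x h => absurd h hi
      filter_upwards [hf3, hb0, hbM'] with x hx hx0 hxM
      rw [Real.norm_of_nonneg (hS0 x)]
      have hpos : 0 ≤ (1 + (k + 1) * M * 2 ^ k) * δ * S x :=
        mul_nonneg (by positivity) (hS0 x)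
      by_cases hxs : x ∈ tsupport ψ
      · -- `ψ G = G`, so the error consists of the commutator and of the change of coefficients
        have hψG : ψ x • I.indicator (fun x => g (π x)) x = I.indicator (fun x => g (π x)) x := by
          by_cases hxI : x ∈ I
          · rw [hψone x (abs_le.2 ⟨by linarith [hxI.1], by linarith [hxI.2]⟩), one_smul]
          · rw [Set.indicator_of_notMem hxI, smul_zero]
        have hdec : e x = ψ x • (bn 0 x - b 0 x) (f 0 x) +
            ∑ i ∈ Finset.range (k + 1), bn i x (leibnizSum ψ f i x - ψ x • f i x) := by
          have h1 : ∑ i ∈ Finset.range (k + 1), bn i x (f i x) =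
              (bn 0 x - b 0 x) (f 0 x) + I.indicator (fun x => g (π x)) x := by
            rw [← hx, Finset.sum_range_succ', Finset.sum_range_succ']
            have : ∀ i ∈ Finset.range k, bn (i + 1) x (f (i + 1) x) = b (i + 1) x (f (i + 1) x) :=
              fun i hi => by rw [hbe (i + 1) (by omega) (by have := Finset.mem_range.1 hi; omega)]
            rw [Finset.sum_congr rfl this, sub_apply]
            abel
          simp only [he, map_sub, map_smul, Finset.sum_sub_distrib, ← Finset.smul_sum]
          rw [h1, smul_add, hψG]
          abel
        have hterm : ∀ i ∈ Finset.range (k + 1),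
            ‖bn i x (leibnizSum ψ f i x - ψ x • f i x)‖ ≤ M * (2 ^ k * δ * S x) := by
          intro i hi
          have hi' := Nat.lt_succ_iff.1 (Finset.mem_range.1 hi)
          have hnn : 0 ≤ M * (2 ^ k * δ * S x) := by have := hS0 x; positivity
          rcases Nat.eq_zero_or_pos i with rfl | h0
          · rw [leibnizSum_zero, sub_self, map_zero, norm_zero]; exact hnn
          · rw [hbe i h0 hi']
            refine (ContinuousLinearMap.le_opNorm _ _).trans ?_
            gcongr
            · exact hxM i hi'
            · exact norm_leibnizSum_sub_le hi' hδ.le fun i h1 h2 => hψd i h1 h2 x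
        have h0S : ‖f 0 x‖ ≤ S x :=
          Finset.single_le_sum (f := fun i => ‖f i x‖) (fun _ _ => norm_nonneg _)
            (Finset.mem_range.2 (Nat.succ_pos k))
        have hfirst : ‖ψ x • (bn 0 x - b 0 x) (f 0 x)‖ ≤ δ * S x := by
          rw [norm_smul, Real.norm_eq_abs]
          calc _ ≤ 1 * ‖(bn 0 x - b 0 x) (f 0 x)‖ := by gcongr; exact hψ1 x
            _ ≤ ‖bn 0 x - b 0 x‖ * ‖f 0 x‖ := by
                rw [one_mul]; exact ContinuousLinearMap.le_opNorm _ _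
            _ ≤ δ * S x := by
                gcongr
                exact hx0 (hψs x hxs)
        rw [hdec]
        refine (norm_add_le _ _).trans ((add_le_add hfirst ((norm_sum_le _ _).trans
          (Finset.sum_le_card_nsmul _ _ _ hterm))).trans (le_of_eq ?_))
        rw [Finset.card_range, nsmul_eq_mul]
        push_cast
        ring
      · have hxI : x ∉ I := fun hxI => by
          have h1 := hψone x (abs_le.2 ⟨by linarith [hxI.1], by linarith [hxI.2]⟩)
          exact hxs (subset_tsupport _ (by rw [Function.mem_support, h1]; exact one_ne_zero))
        have : e x = 0 := by
          simp only [he, leibnizSum_eq_zero f _ hxs, map_zero, Finset.sum_const_zero,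
            Set.indicator_of_notMem hxI, sub_zero]
        rw [this, norm_zero]
        exact hpos
    refine (eLpNorm_le_mul_eLpNorm_of_ae_le_mul hpt 2).trans ?_
    have : (1 + (k + 1) * M * 2 ^ k) * (k + 1) * K * δ =
        ((1 + (k + 1) * M * 2 ^ k) * δ) * ((k + 1) * K) := by ring
    rw [this, ENNReal.ofReal_mul (p := (1 + (k + 1) * M * 2 ^ k) * δ) (by positivity),
      mul_assoc (ENNReal.ofReal _) (ENNReal.ofReal _)]
    gcongr

end Approx

/-! ### Right inverses on long periods -/

section RightInverse

/-- The half periods centred at `0` and at `L / 2` form a partition of the circle of length `L`. -/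
theorem indicator_add_indicator_halfPeriod {E : Type*} [NormedAddCommGroup E] {L : ℝ}
    (hL : 0 < L) (g : ℝ → E) {x : ℝ}
    (hx : x ∈ Set.Ico (-(L / 2)) (-(L / 2) + L)) :
    {x | toIcoMod hL (0 - L / 2) x ∈ Set.Ico (0 - L / 4) (0 + L / 4)}.indicator g x +
      {x | toIcoMod hL (L / 2 - L / 2) x ∈ Set.Ico (L / 2 - L / 4) (L / 2 + L / 4)}.indicator g x =
    g x := by
  have h1 : toIcoMod hL (0 - L / 2) x = x :=
    (toIcoMod_eq_self hL).2 ⟨by linarith [hx.1], by linarith [hx.2]⟩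
  have h2 : toIcoMod hL (L / 2 - L / 2) x = if x < 0 then x + L else x := by
    split_ifs with h
    · exact (toIcoMod_eq_iff hL).2 ⟨⟨by linarith [hx.1], by linarith⟩, -1, by simp⟩
    · exact (toIcoMod_eq_self hL).2 ⟨by linarith, by linarith [hx.2]⟩
  by_cases hin : x ∈ Set.Ico (0 - L / 4) (0 + L / 4)
  · rw [Set.indicator_of_mem (by rw [Set.mem_ofPred_eq, h1]; exact hin),
      Set.indicator_of_notMem, add_zero]
    rw [Set.mem_ofPred_eq, h2]
    rintro ⟨h3, h4⟩
    split_ifs at h3 h4 with h <;> linarith [hin.1, hin.2]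
  · rw [Set.indicator_of_notMem (by rw [Set.mem_ofPred_eq, h1]; exact hin),
      Set.indicator_of_mem, zero_add]
    rw [Set.mem_ofPred_eq, h2]
    have h5 : x < 0 - L / 4 ∨ 0 + L / 4 ≤ x := by
      by_contra h6
      rw [not_or, not_lt, not_le] at h6
      exact hin h6
    split_ifs with h
    · rcases h5 with h5 | h5
      · exact ⟨by linarith [hx.1], by linarith⟩
      · linarith
    · rcases h5 with h5 | h5
      · linarith
      · exact ⟨by linarith, by linarith [hx.2]⟩

variable {E : Type*} [NormedAddCommGroup E] [NormedSpace ℝ E]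

/-- A differential operator with periodic coefficients that are, on most of a long period, close to
those of an operator with a bounded right inverse on the line has a right inverse on periodic
functions that is bounded independently of the period. The right-hand side is split into its parts
on the half periods centred at `0` and at `L / 2`, and each part is solved for on the line. The same
operator on the line serves both windows: for the linearization at a pulse, the pulse is negligible
on the window `[L / 8, 7 L / 8]` around `L / 2`. -/
theorem exists_periodic_right_inverse [CompleteSpace E] {k : ℕ} {b : ℕ → ℝ → E →L[ℝ] E} {K M : ℝ}
    (hK : 0 < K) (hM : 0 ≤ M) (hbM : ∀ i ≤ k, ∀ᵐ x, ‖b i x‖ ≤ M)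
    (hsol : ∀ g : ℝ → E, MemLp g 2 volume → ∃ f : ℕ → ℝ → E,
      (∀ j ≤ k, IsWeakDeriv j (f 0) (f j)) ∧
      (∀ j ≤ k, MemLp (f j) 2 volume ∧
        eLpNorm (f j) 2 volume ≤ ENNReal.ofReal K * eLpNorm g 2 volume) ∧
      ∀ᵐ x, ∑ i ∈ Finset.range (k + 1), b i x (f i x) = g x) :
    ∃ C δ L₀ : ℝ, 0 < C ∧ 0 < δ ∧ ∀ (L : ℝ) (hL : 0 < L) (hL1 : 1 ≤ L), L₀ ≤ L →
      ∀ (bn : ℕ → ℝ → E →L[ℝ] E)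
        (hbn : ∀ i ≤ k, MemLp (bn i) ⊤ (volume.restrict (Set.Ico (-(L / 2)) (-(L / 2) + L)))),
        (∀ i ≤ k, AEStronglyMeasurable (bn i) volume) →
        (∀ i ≤ k, Function.Periodic (bn i) L) → (∀ i, 1 ≤ i → i ≤ k → bn i = b i) →
        (∀ᵐ x, |x| ≤ 3 * L / 8 ∨ |x - L / 2| ≤ 3 * L / 8 → ‖bn 0 x - b 0 x‖ ≤ δ) →
        ∀ g : Lp E 2 (volume.restrict (Set.Ico (-(L / 2)) (-(L / 2) + L))),
          ∃ w : (isUnitCovering_toIcoMod hL hL1 (-(L / 2))).sobolevSpace E k,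
            coeffOp hbn w.1 = g ∧ ‖w‖ ≤ C * ‖g‖ := by
  set C₀ : ℝ := 2 ^ k * (k + 1) * K with hC₀
  set C₁ : ℝ := (1 + (k + 1) * M * 2 ^ k) * (k + 1) * K with hC₁
  have hC₀0 : 0 < C₀ := by positivity
  have hC₁0 : 0 < C₁ := by positivity
  set δ : ℝ := min 1 (1 / (4 * C₁)) with hδdef
  have hδ : 0 < δ := lt_min one_pos (by positivity)
  have hδ1 : δ ≤ 1 := min_le_left _ _
  have hδC : C₁ * δ ≤ 1 / 4 := by
    calc C₁ * δ ≤ C₁ * (1 / (4 * C₁)) := by gcongr; exact min_le_right _ _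
      _ = 1 / 4 := by field_simp
  obtain ⟨L₀, -, hbump⟩ := exists_slow_bump k hδ
  refine ⟨2 * (2 * C₀), δ, L₀, by positivity, hδ, fun L hL hL1 hLL bn hbn hbnm hbnp hbe hb0 => ?_⟩
  set μ := volume.restrict (Set.Ico (-(L / 2)) (-(L / 2) + L)) with hμ
  set h := isUnitCovering_toIcoMod hL hL1 (-(L / 2)) with hh
  refine exists_preimage_of_approx
    ((coeffOp hbn).comp (h.sobolevSpace E k).subtypeL) fun g => ?_
  have hg := Lp.memLp g
  obtain ⟨ψ, h1, h2, h3, h4, h5⟩ := hbump L hLL 0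
  obtain ⟨p, hp1, hp2, hp3⟩ := exists_local_approx_solution hM hδ hδ1 hbM hsol hL hbnm hbnp hbe
    (by filter_upwards [hb0] with x hx hx0 using hx (Or.inl (by simpa using hx0)))
    h1 h2 h3 h4 h5 (-(L / 2)) hg
  obtain ⟨ψ', h1', h2', h3', h4', h5'⟩ := hbump L hLL (L / 2)
  obtain ⟨q, hq1, hq2, hq3⟩ := exists_local_approx_solution hM hδ hδ1 hbM hsol hL hbnm hbnp hbe
    (by filter_upwards [hb0] with x hx hx0 using hx (Or.inr hx0))
    h1' h2' h3' h4' h5' (-(L / 2)) hg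
  have hgt : eLpNorm g 2 μ ≠ ⊤ := hg.2.ne
  have hfin : ∀ c : ℝ, ENNReal.ofReal c * eLpNorm g 2 μ ≠ ⊤ := fun c =>
    ENNReal.mul_ne_top ENNReal.ofReal_ne_top hgt
  have hsum : ∀ {f₁ f₂ : ℝ → E} {c : ℝ}, 0 ≤ c → AEStronglyMeasurable f₁ μ →
      AEStronglyMeasurable f₂ μ →
      eLpNorm f₁ 2 μ ≤ ENNReal.ofReal c * eLpNorm g 2 μ →
      eLpNorm f₂ 2 μ ≤ ENNReal.ofReal c * eLpNorm g 2 μ →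
      eLpNorm (fun x => f₁ x + f₂ x) 2 μ ≤ ENNReal.ofReal (2 * c) * eLpNorm g 2 μ := by
    intro f₁ f₂ c hc m1 m2 e1 e2
    refine (eLpNorm_add_le m1 m2 (by norm_num)).trans ((add_le_add e1 e2).trans ?_)
    rw [two_mul, ENNReal.ofReal_add hc hc, add_mul]
  have hreal : ∀ {t : ENNReal} {c : ℝ}, 0 ≤ c → t ≤ ENNReal.ofReal c * eLpNorm g 2 μ →
      t.toReal ≤ c * ‖g‖ := by
    intro t c hc ht
    have := ENNReal.toReal_mono (hfin c) ht
    rwa [ENNReal.toReal_mul, ENNReal.toReal_ofReal hc, ← Lp.norm_def] at this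
  have hr : ∀ j ≤ k, eLpNorm (fun x => p j x + q j x) 2 μ ≤
      ENNReal.ofReal (2 * C₀) * eLpNorm g 2 μ := fun j hj =>
    hsum hC₀0.le (hp2 j hj).1 (hq2 j hj).1 (hp2 j hj).2 (hq2 j hj).2
  have hrm : ∀ j ≤ k, MemLp (fun x => p j x + q j x) 2 μ := fun j hj =>
    ⟨(hp2 j hj).1.add (hq2 j hj).1, (hr j hj).trans_lt (hfin _).lt_top⟩
  have hrd : ∀ j ≤ k, IsWeakDeriv j
      (fun x => p 0 (toIcoMod hL (-(L / 2)) x) + q 0 (toIcoMod hL (-(L / 2)) x))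
      (fun x => p j (toIcoMod hL (-(L / 2)) x) + q j (toIcoMod hL (-(L / 2)) x)) :=
    fun j hj => (hp1 j hj).add (hq1 j hj)
  set w := h.sobolevMk (fun j x => p j x + q j x) hrd hrm with hw
  refine ⟨w, ?_, ?_⟩
  · change ‖w.1‖ ≤ _
    refine (pi_norm_le_iff_of_nonneg (by positivity)).2 fun j => ?_
    have hj := Nat.lt_succ_iff.1 j.2
    rw [Lp.norm_def, eLpNorm_congr_ae (h.coeFn_sobolevMk _ hrd hrm j)]
    exact hreal (by positivity) (hr j hj)
  · rw [Lp.norm_def]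
    have hae : ((coeffOp hbn w.1 - g : Lp E 2 μ) : ℝ → E) =ᵐ[μ] fun x =>
        (∑ i ∈ Finset.range (k + 1), bn i x (p i x) -
          {x | toIcoMod hL (0 - L / 2) x ∈ Set.Ico (0 - L / 4) (0 + L / 4)}.indicator g x) +
        (∑ i ∈ Finset.range (k + 1), bn i x (q i x) -
          {x | toIcoMod hL (L / 2 - L / 2) x ∈
            Set.Ico (L / 2 - L / 4) (L / 2 + L / 4)}.indicator g x) := by
      filter_upwards [Lp.coeFn_sub (coeffOp hbn w.1) g, coeFn_coeffOp hbn w.1,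
        ae_all_iff.2 (h.coeFn_sobolevMk _ hrd hrm), ae_restrict_mem measurableSet_Ico]
        with x e1 e2 e3 e4
      rw [e1, Pi.sub_apply, e2, ← indicator_add_indicator_halfPeriod hL g e4]
      have e5 : ∑ i : Fin (k + 1), bn i x (w.1 i x) =
          ∑ i ∈ Finset.range (k + 1), bn i x (p i x) +
            ∑ i ∈ Finset.range (k + 1), bn i x (q i x) := by
        rw [← Finset.sum_add_distrib, Finset.sum_range]
        exact Finset.sum_congr rfl fun i _ => by rw [e3 i, map_add]
      rw [e5]
      abel
    have hm : ∀ (p : ℕ → ℝ → E) (c : ℝ), (∀ j ≤ k, AEStronglyMeasurable (p j) μ) →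
        AEStronglyMeasurable (fun x => ∑ i ∈ Finset.range (k + 1), bn i x (p i x) -
          {x | toIcoMod hL (c - L / 2) x ∈ Set.Ico (c - L / 4) (c + L / 4)}.indicator g x) μ := by
      intro p c hp
      refine AEStronglyMeasurable.sub (Finset.aestronglyMeasurable_fun_sum _ fun i hi => ?_)
        (hg.1.indicator (measurable_toIcoMod hL _ measurableSet_Ico))
      have hi' := Nat.lt_succ_iff.1 (Finset.mem_range.1 hi)
      exact aestronglyMeasurable_apply (hbn i hi').1 (hp i hi')
    have hE := hsum (by positivity) (hm p 0 fun j hj => (hp2 j hj).1)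
      (hm q (L / 2) fun j hj => (hq2 j hj).1) hp3 hq3
    change ENNReal.toReal (eLpNorm ((coeffOp hbn w.1 - g : Lp E 2 μ) : ℝ → E) 2 μ) ≤ _
    rw [eLpNorm_congr_ae hae]
    refine (hreal (by positivity) hE).trans ?_
    gcongr
    linarith

end RightInverse

/-! ### Bounds on the nonlinearity and on the pulse -/

section Bounds

variable {E F : Type*} [NormedAddCommGroup E] [NormedAddCommGroup F]

theorem exists_bound_of_periodic [ProperSpace E] {G : E → ℝ → F} {T : ℝ} (hT : 0 < T)
    (hG : Continuous fun p : E × ℝ => G p.1 p.2) (hp : ∀ y, Function.Periodic (G y) T) (R : ℝ) :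
    ∃ M, 0 ≤ M ∧ ∀ y, ‖y‖ ≤ R → ∀ x, ‖G y x‖ ≤ M := by
  obtain ⟨M, hM⟩ := ((isCompact_closedBall (0 : E) R).prod
    (isCompact_Icc (a := (0 : ℝ)) (b := T))).exists_bound_of_continuousOn hG.continuousOn
  refine ⟨max M 0, le_max_right _ _, fun y hy x => ?_⟩
  obtain ⟨x', hx', he⟩ := (hp y).exists_mem_Ico₀ hT x
  rw [he]
  exact (hM (y, x') ⟨by simpa using hy, Set.Ico_subset_Icc_self hx'⟩).trans (le_max_left _ _)

theorem exists_uniform_of_periodic [ProperSpace E] {G : E → ℝ → F} {T : ℝ} (hT : 0 < T)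
    (hG : Continuous fun p : E × ℝ => G p.1 p.2) (hp : ∀ y, Function.Periodic (G y) T) (R : ℝ)
    {δ : ℝ} (hδ : 0 < δ) :
    ∃ ρ > 0, ∀ y y', ‖y‖ ≤ R → ‖y'‖ ≤ R → ‖y - y'‖ ≤ ρ → ∀ x, ‖G y x - G y' x‖ ≤ δ := by
  have huc := ((isCompact_closedBall (0 : E) R).prod
    (isCompact_Icc (a := (0 : ℝ)) (b := T))).uniformContinuousOn_of_continuous hG.continuousOn
  rw [Metric.uniformContinuousOn_iff] at huc
  obtain ⟨ρ, hρ, H⟩ := huc δ hδ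
  refine ⟨ρ / 2, by positivity, fun y y' hy hy' hyy x => ?_⟩
  obtain ⟨n, hn, -⟩ := existsUnique_add_zsmul_mem_Ico hT x 0
  have he : ∀ y, G y x = G y (x + n • T) := fun y => ((hp y).zsmul n x).symm
  rw [he y, he y', ← dist_eq_norm]
  rw [zero_add] at hn
  refine (H (y, x + n • T) ⟨by simpa using hy, Set.Ico_subset_Icc_self hn⟩ (y', x + n • T)
    ⟨by simpa using hy', Set.Ico_subset_Icc_self hn⟩ ?_).le
  rw [Prod.dist_eq, dist_self, dist_eq_norm]
  exact max_lt (by linarith) hρ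

/-- The square of the `L²`-norm as an integral. -/
theorem eLpNorm_two_eq_ofReal_sqrt {μ : Measure ℝ} {f : ℝ → E} (hf : MemLp f 2 μ) :
    eLpNorm f 2 μ = ENNReal.ofReal (√(∫ x, ‖f x‖ ^ 2 ∂μ)) := by
  rw [hf.eLpNorm_eq_integral_rpow_norm (by norm_num) (by norm_num), Real.sqrt_eq_rpow]
  simp

theorem tendsto_integral_tail {f : ℝ → E} (hf : MemLp f 2 volume) :
    Tendsto (fun R : ℝ => ∫ x in (Set.Ioo (-R) R)ᶜ, ‖f x‖ ^ 2) atTop (𝓝 0) := by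
  have hi : Integrable (fun x => ‖f x‖ ^ 2) volume := hf.norm.integrable_sq
  have hanti : Antitone fun R : ℝ => (Set.Ioo (-R) R)ᶜ := fun R R' h =>
    Set.compl_subset_compl.2 (Set.Ioo_subset_Ioo (neg_le_neg h) h)
  have h1 := tendsto_setIntegral_of_antitone (μ := volume) (f := fun x => ‖f x‖ ^ 2)
    (fun R : ℝ => (measurableSet_Ioo (a := -R) (b := R)).compl) hanti ⟨0, hi.integrableOn⟩
  have h2 : ⋂ R : ℝ, (Set.Ioo (-R) R)ᶜ = (∅ : Set ℝ) := by
    refine Set.eq_empty_iff_forall_notMem.2 fun x hx => ?_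
    refine Set.mem_iInter.1 hx (|x| + 1) ⟨?_, ?_⟩
    · linarith [neg_abs_le x]
    · linarith [le_abs_self x]
  rwa [h2, setIntegral_empty] at h1

theorem tendsto_eLpNorm_tail {f : ℝ → E} (hf : MemLp f 2 volume) :
    Tendsto (fun R : ℝ => eLpNorm f 2 (volume.restrict (Set.Ioo (-R) R)ᶜ)) atTop (𝓝 0) := by
  have h1 : Tendsto (fun R : ℝ => √(∫ x in (Set.Ioo (-R) R)ᶜ, ‖f x‖ ^ 2)) atTop (𝓝 0) := by
    have := (Real.continuous_sqrt.tendsto 0).comp (tendsto_integral_tail hf)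
    rwa [Real.sqrt_zero] at this
  have h2 := (ENNReal.tendsto_ofReal h1)
  rw [ENNReal.ofReal_zero] at h2
  exact h2.congr fun R =>
    (eLpNorm_two_eq_ofReal_sqrt (hf.mono_measure Measure.restrict_le_self)).symm

variable [NormedSpace ℝ E] [CompleteSpace E]

/-- Functions in `H¹(ℝ)` vanish at infinity. -/
theorem IsWeakDeriv.eventually_ae_small {f g : ℝ → E} (H : IsWeakDeriv 1 f g)
    (hf : MemLp f 2 volume) (hg : MemLp g 2 volume) {ε : ℝ} (hε : 0 < ε) :
    ∃ R₀ : ℝ, ∀ᵐ x, R₀ ≤ |x| → ‖f x‖ ≤ ε := by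
  have h0 : (0 : ENNReal) < ENNReal.ofReal (ε / 2) := ENNReal.ofReal_pos.2 (by positivity)
  obtain ⟨R, h1, h2⟩ := (((tendsto_eLpNorm_tail hf).eventually_le_const h0).and
    ((tendsto_eLpNorm_tail hg).eventually_le_const h0)).exists
  refine ⟨R + 1, ?_⟩
  filter_upwards [H.enorm_le] with x hx hxR
  have hsub : Set.Ioc x (x + 1) ⊆ (Set.Ioo (-R) R)ᶜ := by
    rintro y ⟨hy1, hy2⟩ ⟨hy3, hy4⟩
    rcases le_abs.1 hxR with h | h <;> linarith
  have h3 : ∀ q : ℝ → E, eLpNorm q 2 (volume.restrict (Set.Ioc x (x + 1))) ≤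
      eLpNorm q 2 (volume.restrict (Set.Ioo (-R) R)ᶜ) := fun q =>
    eLpNorm_mono_measure _ (Measure.restrict_mono hsub le_rfl)
  have h4 := hx.trans (add_le_add ((h3 f).trans h1) ((h3 g).trans h2))
  rw [← ENNReal.ofReal_add (by positivity) (by positivity), add_halves, ← ofReal_norm] at h4
  exact (ENNReal.ofReal_le_ofReal_iff hε.le).1 h4

/-- Functions in `H¹(ℝ)` and in `H¹_per` are essentially bounded. -/
theorem IsWeakDeriv.exists_ae_bound {π : ℝ → ℝ} {μ : Measure ℝ} (h : IsUnitCovering π μ)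
    {f g : ℝ → E} (H : IsWeakDeriv 1 (fun x => f (π x)) (fun x => g (π x)))
    (hf : MemLp f 2 μ) (hg : MemLp g 2 μ) : ∃ R : ℝ, 0 ≤ R ∧ ∀ᵐ x, ‖f (π x)‖ ≤ R := by
  refine ⟨(eLpNorm f 2 μ + eLpNorm g 2 μ).toReal, ENNReal.toReal_nonneg, ?_⟩
  filter_upwards [H.enorm_le] with x hx
  have h2 := hx.trans (add_le_add (h.eLpNorm_comp_le hf.1 x) (h.eLpNorm_comp_le hg.1 x))
  have h3 := ENNReal.toReal_mono (ENNReal.add_ne_top.2 ⟨hf.2.ne, hg.2.ne⟩) h2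
  rwa [toReal_enorm] at h3

end Bounds

section PeriodicLp

theorem memLp_restrict_Ico_nat_mul {F : Type*} [NormedAddCommGroup F] {T : ℝ} (hT : 0 < T)
    {f : ℝ → F} (hp : Function.Periodic f T)
    (hf : MemLp f 2 (volume.restrict (Set.Ico 0 (0 + T)))) (n : ℕ) (d : ℝ) :
    MemLp f 2 (volume.restrict (Set.Ico d (d + n * T))) := by
  have h1 : ∀ e : ℝ, MemLp f 2 (volume.restrict (Set.Ico e (e + T))) := fun e => by
    have := hf.comp_measurePreserving (measurePreserving_toIcoMod hT 0 e)
    rwa [show f ∘ toIcoMod hT 0 = f from funext fun x => hp.comp_toIcoMod hT 0 x] at this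
  induction n with
  | zero => simp
  | succ n ih =>
    have h2 : Set.Ico d (d + (n + 1 : ℕ) * T) =
        Set.Ico d (d + n * T) ∪ Set.Ico (d + n * T) (d + n * T + T) := by
      rw [Set.Ico_union_Ico_eq_Ico (by nlinarith [Nat.cast_nonneg (α := ℝ) n]) (by linarith)]
      congr 1
      push_cast
      ring
    rw [h2]
    refine ⟨(aestronglyMeasurable_union_iff).2 ⟨ih.1, (h1 _).1⟩, ?_⟩
    have h3 := ih.2
    have h4 := (h1 (d + n * T)).2
    rw [eLpNorm_lt_top_iff_lintegral_rpow_enorm_lt_top (by norm_num) (by norm_num)] at h3 h4 ⊢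
    exact (lintegral_union_le _ _ _).trans_lt (ENNReal.add_lt_top.2 ⟨h3, h4⟩)

end PeriodicLp

/-! ### Solutions of the nonlinear equation close to an approximate solution -/

section Nonlinear

variable {E : Type*} [NormedAddCommGroup E] [NormedSpace ℝ E]

/-- The derivative of `N` with respect to its first argument. -/
def fderivFst (N : E → ℝ → E) (y : E) (x : ℝ) : E →L[ℝ] E := fderiv ℝ (fun y => N y x) y

/-- Newton's method in the Sobolev space: if the linearization at `w` has a right inverse with bound
`C` and the residual of `w` is small in terms of `C` and of the modulus of continuity of `∂_u N`,
then there is a solution near `w`. -/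
theorem exists_solution_near [CompleteSpace E] {π : ℝ → ℝ} {μ : Measure ℝ} [IsFiniteMeasure μ]
    (h : IsUnitCovering π μ) {k : ℕ} (hk : 1 ≤ k) {a bn : ℕ → ℝ → E →L[ℝ] E} {N : E → ℝ → E}
    (ha : ∀ i ≤ k, MemLp (a i) ⊤ μ) (hNc : Continuous fun p : E × ℝ => N p.1 p.2)
    (hNb : ∀ R, ∃ M, 0 ≤ M ∧ ∀ y, ‖y‖ ≤ R → ∀ x, ‖N y x‖ ≤ M)
    (hNd : ∀ x, Differentiable ℝ fun y => N y x) {R ρ C res : ℝ} (hC : 0 < C)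
    (w : h.sobolevSpace E k) (hwR : ∀ᵐ x ∂μ, ‖w.1 0 x‖ ≤ R)
    (hunif : ∀ y y', ‖y‖ ≤ R → ‖y' - y‖ ≤ ρ → ∀ x,
      ‖fderivFst N y' x - fderivFst N y x‖ ≤ 1 / (2 * C))
    (hbn : ∀ i ≤ k, MemLp (bn i) ⊤ μ)
    (hbn0 : ∀ᵐ x ∂μ, bn 0 x = a 0 x + fderivFst N (w.1 0 x) x)
    (hbne : ∀ i, 1 ≤ i → i ≤ k → bn i = a i)
    (hinv : ∀ g : Lp E 2 μ, ∃ u : h.sobolevSpace E k, coeffOp hbn u.1 = g ∧ ‖u‖ ≤ C * ‖g‖)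
    (hres0 : 0 ≤ res)
    (hres : eLpNorm (fun x => ∑ i : Fin (k + 1), a i x (w.1 i x) + N (w.1 0 x) x) 2 μ ≤
      ENNReal.ofReal res) (hsmall : 2 * C * res ≤ ρ / 2) :
    ∃ A : h.sobolevSpace E k, ‖A‖ ≤ 2 * C * res ∧
      ∀ᵐ x ∂μ, ∑ i : Fin (k + 1), a i x (w.1 i x + A.1 i x) + N (w.1 0 x + A.1 0 x) x = 0 := by
  have hN : ∀ u : h.sobolevSpace E k, MemLp (fun x => N (u.1 0 x) x) 2 μ := by
    intro u
    obtain ⟨M, -, hM⟩ := hNb (2 * ‖u‖)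
    refine MemLp.of_bound (hNc.comp_aestronglyMeasurable
      ((Lp.memLp (u.1 0)).1.prodMk aestronglyMeasurable_id)) M ?_
    filter_upwards [h.ae_norm_le hk u] with x hx using hM _ hx x
  let F : h.sobolevSpace E k → Lp E 2 μ := fun u => coeffOp ha u.1 + (hN u).toLp _
  have hF : ∀ u, F u =ᵐ[μ] fun x => ∑ i : Fin (k + 1), a i x (u.1 i x) + N (u.1 0 x) x := by
    intro u
    filter_upwards [Lp.coeFn_add (coeffOp ha u.1) ((hN u).toLp _), coeFn_coeffOp ha u.1,
      (hN u).coeFn_toLp] with x h1 h2 h3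
    rw [h1, Pi.add_apply, h2, h3]
  have hFw : ‖F w‖ ≤ res := by
    rw [Lp.norm_def, eLpNorm_congr_ae (hF w)]
    exact ENNReal.toReal_le_of_le_ofReal hres0 hres
  have hsub : ∀ u u' : h.sobolevSpace E k,
      ∀ᵐ x ∂μ, ∀ i : Fin (k + 1), (u - u').1 i x = u.1 i x - u'.1 i x := fun u u' =>
    ae_all_iff.2 fun i => Lp.coeFn_sub (u.1 i) (u'.1 i)
  have hclose : ∀ u : h.sobolevSpace E k, ‖u - w‖ ≤ ρ / 2 →
      ∀ᵐ x ∂μ, ‖u.1 0 x - w.1 0 x‖ ≤ ρ := by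
    intro u hu
    filter_upwards [h.ae_norm_le hk (u - w), hsub u w] with x h1 h2
    rw [← h2 0]
    linarith
  -- the embedding `‖u‖_∞ ≤ 2 ‖u‖` turns the radius `ρ / 2` in the Sobolev space into `ρ`
  obtain ⟨u, hu0, hu⟩ := exists_zero_of_approx F
    ((coeffOp hbn).comp (h.sobolevSpace E k).subtypeL) w (r := ρ / 2) hC hinv
    (fun u u' hu hu' => by
      have hae : ∀ᵐ x ∂μ, ‖(F u - F u' - coeffOp hbn (u - u').1 : Lp E 2 μ) x‖ ≤
          1 / (2 * C) * ‖(u - u').1 0 x‖ := by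
        filter_upwards [Lp.coeFn_sub (F u - F u') (coeffOp hbn (u - u').1),
          Lp.coeFn_sub (F u) (F u'), hF u, hF u', coeFn_coeffOp hbn (u - u').1, hsub u u', hwR,
          hclose u hu, hclose u' hu', hbn0] with x h1 h2 h3 h4 h5 h6 h7 h8 h9 h10
        have e1 : ∑ i : Fin (k + 1), bn i x ((u - u').1 i x) =
            (∑ i : Fin (k + 1), a i x (u.1 i x) - ∑ i : Fin (k + 1), a i x (u'.1 i x)) +
            fderivFst N (w.1 0 x) x (u.1 0 x - u'.1 0 x) := by
          rw [← Finset.sum_sub_distrib, Fin.sum_univ_succ, Fin.sum_univ_succ]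
          have e2 : ∀ i : Fin k, bn (i.succ : Fin (k + 1)) x ((u - u').1 i.succ x) =
              a (i.succ : Fin (k + 1)) x (u.1 i.succ x) -
                a (i.succ : Fin (k + 1)) x (u'.1 i.succ x) := fun i => by
            rw [hbne _ (by simp) (by simp only [Fin.val_succ]; omega), h6, map_sub]
          rw [Finset.sum_congr rfl fun i _ => e2 i, h6, Fin.val_zero, h10, add_apply, ← map_sub]
          abel
        rw [h1, Pi.sub_apply, h2, Pi.sub_apply, h3, h4, h5, e1, h6 0]
        have e3 := (convex_closedBall (w.1 0 x) ρ).norm_image_sub_le_of_norm_fderiv_le' (𝕜 := ℝ)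
          (f := fun y => N y x) (φ := fderivFst N (w.1 0 x) x) (C := 1 / (2 * C))
          (fun y _ => hNd x y) (fun y hy => hunif _ y h7 (by simpa [dist_eq_norm] using hy) x)
          (by simpa [dist_eq_norm] using h9) (by simpa [dist_eq_norm] using h8)
        refine le_trans (le_of_eq ?_) e3
        congr 1
        abel
      refine (Lp.norm_le_mul_norm_of_ae_le_mul hae).trans ?_
      gcongr
      exact h.norm_apply_le (u - u') 0)
    (le_trans (by gcongr) hsmall)
  refine ⟨u - w, hu.trans (by gcongr), ?_⟩
  have h0 : F u =ᵐ[μ] 0 := by rw [hu0]; exact Lp.coeFn_zero _ _ _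
  filter_upwards [h0, hF u, hsub u w] with x h1 h2 h3
  have e : ∀ i : Fin (k + 1), w.1 i x + (u - w).1 i x = u.1 i x := fun i => by rw [h3 i]; abel
  simp only [e]
  rw [← h2, h1]
  rfl

end Nonlinear

/-! ### Pulses on a periodic background -/

section Tail

variable {E : Type*} [NormedAddCommGroup E]

/-- The `H^k`-norm of `Z` outside `(-r, r)`. -/
def tailNorm (k : ℕ) (Z : ℕ → ℝ → E) (r : ℝ) : ℝ :=
  √(∑ j ∈ Finset.range (k + 1), ∫ x in (Set.Ioo (-r) r)ᶜ, ‖Z j x‖ ^ 2)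

theorem tendsto_tailNorm {k : ℕ} {Z : ℕ → ℝ → E} (hZ : ∀ j ≤ k, MemLp (Z j) 2 volume) :
    Tendsto (tailNorm k Z) atTop (𝓝 0) := by
  have h1 : Tendsto (fun r : ℝ => ∑ j ∈ Finset.range (k + 1),
      ∫ x in (Set.Ioo (-r) r)ᶜ, ‖Z j x‖ ^ 2) atTop (𝓝 (∑ j ∈ Finset.range (k + 1), 0)) :=
    tendsto_finsetSum _ fun j hj =>
      tendsto_integral_tail (hZ j (Nat.lt_succ_iff.1 (Finset.mem_range.1 hj)))
  have h2 := (Real.continuous_sqrt.tendsto _).comp h1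
  rwa [Finset.sum_const_zero, Real.sqrt_zero] at h2

theorem eLpNorm_tail_le {k : ℕ} {Z : ℕ → ℝ → E} (hZ : ∀ j ≤ k, MemLp (Z j) 2 volume) (r : ℝ)
    {j : ℕ} (hj : j ≤ k) :
    eLpNorm (Z j) 2 (volume.restrict (Set.Ioo (-r) r)ᶜ) ≤ ENNReal.ofReal (tailNorm k Z r) := by
  rw [eLpNorm_two_eq_ofReal_sqrt ((hZ j hj).mono_measure Measure.restrict_le_self)]
  refine ENNReal.ofReal_le_ofReal (Real.sqrt_le_sqrt ?_)
  exact Finset.single_le_sum (f := fun j => ∫ x in (Set.Ioo (-r) r)ᶜ, ‖Z j x‖ ^ 2)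
    (fun _ _ => integral_nonneg fun _ => by positivity)
    (Finset.mem_range.2 (Nat.lt_succ_of_le hj))

end Tail

section Pulse

variable {E : Type*} [NormedAddCommGroup E] [NormedSpace ℝ E]

/-- The data of the equation `∑ᵢ aᵢ ∂ⁱu + N(u, ·) = 0` with a `T`-periodic solution `V 0` and a
further solution `Z 0 + V 0` with `Z 0 ∈ H^k(ℝ)`; `V j` and `Z j` are the derivatives of `V 0` and
`Z 0`. -/
structure IsPulse (k : ℕ) (T : ℝ) (a : ℕ → ℝ → E →L[ℝ] E) (N : E → ℝ → E) (V Z : ℕ → ℝ → E) :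
    Prop where
  one_le : 1 ≤ k
  pos : 0 < T
  coeff_cont : ∀ i ≤ k, Continuous (a i)
  coeff_per : ∀ i ≤ k, Function.Periodic (a i) T
  cont : Continuous fun p : E × ℝ => N p.1 p.2
  diff : ∀ x, Differentiable ℝ fun y => N y x
  deriv_cont : Continuous fun p : E × ℝ => fderivFst N p.1 p.2
  per : ∀ y, Function.Periodic (N y) T
  V_weakDeriv : ∀ j ≤ k, IsWeakDeriv j (V 0) (V j)
  V_per : ∀ j ≤ k, Function.Periodic (V j) T
  V_memLp : ∀ j ≤ k, MemLp (V j) 2 (volume.restrict (Set.Ico 0 (0 + T)))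
  Z_weakDeriv : ∀ j ≤ k, IsWeakDeriv j (Z 0) (Z j)
  Z_memLp : ∀ j ≤ k, MemLp (Z j) 2 volume
  V_sol : ∀ᵐ x, ∑ i ∈ Finset.range (k + 1), a i x (V i x) + N (V 0 x) x = 0
  ZV_sol : ∀ᵐ x, ∑ i ∈ Finset.range (k + 1), a i x (Z i x + V i x) + N (Z 0 x + V 0 x) x = 0

/-- The coefficients of the linearization at `u`. -/
def linCoeff (a : ℕ → ℝ → E →L[ℝ] E) (N : E → ℝ → E) (u : ℝ → E) (i : ℕ) (x : ℝ) : E →L[ℝ] E :=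
  if i = 0 then a 0 x + fderivFst N (u x) x else a i x

/-- The periodic approximate solution `ψ Z + V` and its derivatives: the cut-off pulse is extended
with period `L` from `[-L/2, L/2)`. -/
def periodicProfile {L : ℝ} (hL : 0 < L) (ψ : ℝ → ℝ) (Z V : ℕ → ℝ → E) (j : ℕ) (x : ℝ) : E :=
  leibnizSum ψ Z j (toIcoMod hL (-(L / 2)) x) + V j x

namespace IsPulse

variable {k : ℕ} {T : ℝ} {a : ℕ → ℝ → E →L[ℝ] E} {N : E → ℝ → E} {V Z : ℕ → ℝ → E}

theorem fderivFst_per (H : IsPulse k T a N V Z) (y : E) :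
    Function.Periodic (fderivFst N y) T := fun x => by
  have : (fun y => N y (x + T)) = fun y => N y x := funext fun y => H.per y x
  simp only [fderivFst, this]

theorem exists_ae_bound [CompleteSpace E] (H : IsPulse k T a N V Z) :
    ∃ R, 0 ≤ R ∧ ∀ᵐ x, ‖V 0 x‖ ≤ R ∧ ‖Z 0 x‖ ≤ R := by
  obtain ⟨n, hn⟩ := exists_nat_ge (1 / T)
  have hn1 : 1 ≤ n * T := by
    rwa [div_le_iff₀ H.pos] at hn
  have hL : 0 < n * T := by linarith
  have hk := H.one_le
  have h := isUnitCovering_toIcoMod hL hn1 0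
  have hVp : ∀ j ≤ k, (fun x => V j (toIcoMod hL 0 x)) = V j := fun j hj =>
    funext fun x => ((H.V_per j hj).nat_mul n).comp_toIcoMod hL 0 x
  have hVm : ∀ j ≤ k, MemLp (V j) 2 (volume.restrict (Set.Ico 0 (0 + n * T))) := fun j hj =>
    memLp_restrict_Ico_nat_mul H.pos (H.V_per j hj) (H.V_memLp j hj) n 0
  obtain ⟨R₁, h1, hR₁⟩ := IsWeakDeriv.exists_ae_bound h (f := V 0) (g := V 1)
    (by rw [hVp 0 (Nat.zero_le k), hVp 1 hk]; exact H.V_weakDeriv 1 hk)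
    (hVm 0 (Nat.zero_le k)) (hVm 1 hk)
  obtain ⟨R₂, h2, hR₂⟩ := IsWeakDeriv.exists_ae_bound isUnitCovering_id (f := Z 0) (g := Z 1)
    (H.Z_weakDeriv 1 hk) (H.Z_memLp 0 (Nat.zero_le k)) (H.Z_memLp 1 hk)
  refine ⟨max R₁ R₂, h1.trans (le_max_left _ _), ?_⟩
  filter_upwards [hR₁, hR₂] with x hx1 hx2
  rw [congrFun (hVp 0 (Nat.zero_le k)) x] at hx1
  exact ⟨hx1.trans (le_max_left _ _), hx2.trans (le_max_right _ _)⟩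

theorem exists_coeff_bound (H : IsPulse k T a N V Z) :
    ∃ M, 0 ≤ M ∧ ∀ i ≤ k, ∀ x, ‖a i x‖ ≤ M := by
  have : ∀ i ≤ k, ∃ M, ∀ x, ‖a i x‖ ≤ M := fun i hi =>
    continuous_periodic_bounded H.pos (H.coeff_cont i hi) (H.coeff_per i hi)
  choose! M hM using this
  refine ⟨∑ j ∈ Finset.range (k + 1), |M j|, Finset.sum_nonneg fun _ _ => abs_nonneg _,
    fun i hi x => (hM i hi x).trans ((le_abs_self _).trans ?_)⟩
  exact Finset.single_le_sum (f := fun j => |M j|) (fun _ _ => abs_nonneg _)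
    (Finset.mem_range.2 (Nat.lt_succ_of_le hi))

theorem aestronglyMeasurable_linCoeff (H : IsPulse k T a N V Z) {u : ℝ → E}
    (hu : AEStronglyMeasurable u volume) {i : ℕ} (hi : i ≤ k) :
    AEStronglyMeasurable (linCoeff a N u i) volume := by
  by_cases h0 : i = 0
  · have : linCoeff a N u i = fun x => a 0 x + fderivFst N (u x) x := by
      funext x; rw [linCoeff, if_pos h0]
    rw [this]
    exact (H.coeff_cont 0 (Nat.zero_le k)).aestronglyMeasurable.add
      (H.deriv_cont.comp_aestronglyMeasurable (hu.prodMk aestronglyMeasurable_id))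
  · have : linCoeff a N u i = a i := by
      funext x; rw [linCoeff, if_neg h0]
    rw [this]
    exact (H.coeff_cont i hi).aestronglyMeasurable

theorem norm_linCoeff_le {M M' R : ℝ} (hM : ∀ i ≤ k, ∀ x, ‖a i x‖ ≤ M) (hM'0 : 0 ≤ M')
    (hM' : ∀ y, ‖y‖ ≤ R → ∀ x, ‖fderivFst N y x‖ ≤ M') {u : ℝ → E} {x : ℝ} (hu : ‖u x‖ ≤ R)
    {i : ℕ} (hi : i ≤ k) : ‖linCoeff a N u i x‖ ≤ M + M' := by
  rw [linCoeff]
  split_ifs with h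
  · exact (norm_add_le _ _).trans (add_le_add (hM 0 (Nat.zero_le k) x) (hM' _ hu x))
  · linarith [hM i hi x]

section Profile

variable {L : ℝ} {ψ : ℝ → ℝ}

theorem leibnizSum_eq_zero_outside (hL : 0 < L) (hψs : ∀ x ∈ tsupport ψ, |x| ≤ L / 3) (j : ℕ) :
    ∀ x ∉ Set.Ico (-(L / 2)) (-(L / 2) + L), leibnizSum ψ Z j x = 0 := by
  intro x hx
  refine leibnizSum_eq_zero Z j fun hxs => hx ?_
  have := abs_le.1 (hψs x hxs)
  exact ⟨by linarith [this.1], by linarith [this.2]⟩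

theorem isWeakDeriv_periodicProfile (H : IsPulse k T a N V Z) (hL : 0 < L) (hψ : ContDiff ℝ ∞ ψ)
    (hψs : ∀ x ∈ tsupport ψ, |x| ≤ L / 3) {j : ℕ} (hj : j ≤ k) :
    IsWeakDeriv j (periodicProfile hL ψ Z V 0) (periodicProfile hL ψ Z V j) := by
  have h1 : IsWeakDeriv j (leibnizSum ψ Z 0) (leibnizSum ψ Z j) := by
    have := IsWeakDeriv.leibniz hψ H.Z_weakDeriv hj
    simp only [← leibnizSum_zero] at this
    exact this
  exact (h1.periodize hL (-(L / 2)) (leibnizSum_eq_zero_outside hL hψs 0)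
    (leibnizSum_eq_zero_outside hL hψs j)).add (H.V_weakDeriv j hj)

theorem periodic_periodicProfile (hL : 0 < L) (hV : ∀ j ≤ k, Function.Periodic (V j) L)
    {j : ℕ} (hj : j ≤ k) :
    Function.Periodic (periodicProfile hL ψ Z V j) L := fun x => by
  rw [periodicProfile, toIcoMod_add_right, hV j hj, periodicProfile]

theorem memLp_periodicProfile (H : IsPulse k T a N V Z) (hL : 0 < L) (hψ : ContDiff ℝ ∞ ψ)
    (hψd : ∀ j ≤ k, ∀ x, |iteratedDeriv j ψ x| ≤ 1)
    {j : ℕ} (hj : j ≤ k) {d : ℝ} (hV : MemLp (V j) 2 (volume.restrict (Set.Ico d (d + L)))) :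
    MemLp (periodicProfile hL ψ Z V j) 2 (volume.restrict (Set.Ico d (d + L))) := by
  refine MemLp.add ?_ hV
  have h1 : AEStronglyMeasurable (leibnizSum ψ Z j) volume :=
    (IsWeakDeriv.leibniz hψ H.Z_weakDeriv hj).locallyIntegrable_right.aestronglyMeasurable
  have h2 : MemLp (fun x => ∑ i ∈ Finset.range (k + 1), ‖Z i x‖) 2 volume :=
    memLp_finsetSum _ fun i hi => (H.Z_memLp i (Nat.lt_succ_iff.1 (Finset.mem_range.1 hi))).norm
  have h3 : MemLp (leibnizSum ψ Z j) 2 volume := by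
    refine (h2.const_mul (2 ^ k)).mono' h1 (.of_forall fun x => ?_)
    exact norm_leibnizSum_le hj fun i hi => hψd i hi x
  exact (h3.mono_measure Measure.restrict_le_self).comp_measurePreserving
    (measurePreserving_toIcoMod hL (-(L / 2)) d)

end Profile

end IsPulse

end Pulse

/-! ### Periodic solutions near the pulse -/

section PulseExistence

variable {E : Type*} [NormedAddCommGroup E] [NormedSpace ℝ E]

namespace IsPulse

variable {k : ℕ} {T : ℝ} {a : ℕ → ℝ → E →L[ℝ] E} {N : E → ℝ → E} {V Z : ℕ → ℝ → E}

/-- The residual of the periodic profile is controlled by the part of the pulse that is affected by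
the cut-off: where the cut-off is `1` the profile is the pulse itself, elsewhere it is compared
with the background `V`. -/
theorem exists_residual_bound [FiniteDimensional ℝ E] (H : IsPulse k T a N V Z) :
    ∃ C, 0 ≤ C ∧ ∀ (L : ℝ) (hL : 0 < L) (ψ : ℝ → ℝ), (∀ x, ψ x ∈ Set.Icc (0 : ℝ) 1) →
      (∀ j ≤ k, ∀ x, |iteratedDeriv j ψ x| ≤ 1) → (∀ x, |x| ≤ L / 6 → ψ x = 1) →
      eLpNorm (fun x => ∑ i ∈ Finset.range (k + 1), a i x (periodicProfile hL ψ Z V i x) +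
        N (periodicProfile hL ψ Z V 0 x) x) 2
          (volume.restrict (Set.Ico (-(L / 2)) (-(L / 2) + L))) ≤
      ENNReal.ofReal (C * tailNorm k Z (L / 6)) := by
  have : ProperSpace E := FiniteDimensional.proper ℝ E
  have : CompleteSpace E := FiniteDimensional.complete ℝ E
  obtain ⟨R, hR0, hR⟩ := H.exists_ae_bound
  obtain ⟨M, hM0, hM⟩ := H.exists_coeff_bound
  obtain ⟨M', hM'0, hM'⟩ := exists_bound_of_periodic H.pos H.deriv_cont H.fderivFst_per (R + R)
  set c : ℝ := ((k + 1) * M + M') * 2 ^ k with hc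
  refine ⟨c * (k + 1), by positivity, fun L hL ψ hψI hψd hψone => ?_⟩
  set S : ℝ → ℝ := fun x => ∑ i ∈ Finset.range (k + 1), ‖Z i x‖ with hS
  have hS0 : ∀ x, 0 ≤ S x := fun x => Finset.sum_nonneg fun _ _ => norm_nonneg _
  have hpt : ∀ᵐ x ∂(volume.restrict (Set.Ico (-(L / 2)) (-(L / 2) + L))),
      ‖∑ i ∈ Finset.range (k + 1), a i x (periodicProfile hL ψ Z V i x) +
        N (periodicProfile hL ψ Z V 0 x) x‖ ≤
      c * ‖(Set.Ioo (-(L / 6)) (L / 6))ᶜ.indicator S x‖ := by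
    filter_upwards [ae_restrict_mem measurableSet_Ico, ae_restrict_of_ae hR,
      ae_restrict_of_ae H.V_sol, ae_restrict_of_ae H.ZV_sol] with x hx hxR hxV hxZV
    have hπ : toIcoMod hL (-(L / 2)) x = x := (toIcoMod_eq_self hL).2 hx
    simp only [periodicProfile, hπ]
    by_cases hin : x ∈ Set.Ioo (-(L / 6)) (L / 6)
    · have hd : ∀ i, 1 ≤ i → i ≤ k → |iteratedDeriv i ψ x| ≤ 0 := by
        intro i hi _
        have h1 : ψ =ᶠ[𝓝 x] fun _ => 1 := by
          filter_upwards [Ioo_mem_nhds hin.1 hin.2] with y hy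
          exact hψone y (abs_le.2 ⟨hy.1.le, hy.2.le⟩)
        rw [h1.iteratedDeriv_eq i, iteratedDeriv_const, if_neg (by omega), abs_zero]
      have hone : ψ x = 1 := hψone x (abs_le.2 ⟨hin.1.le, hin.2.le⟩)
      have hP : ∀ i ≤ k, leibnizSum ψ Z i x = Z i x := by
        intro i hi
        have h1 := norm_leibnizSum_sub_le (w := Z) hi le_rfl hd
        rw [mul_zero, zero_mul, hone, one_smul] at h1
        exact sub_eq_zero.1 (norm_le_zero_iff.1 h1)
      have h2 : ∑ i ∈ Finset.range (k + 1), a i x (leibnizSum ψ Z i x + V i x) =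
          ∑ i ∈ Finset.range (k + 1), a i x (Z i x + V i x) :=
        Finset.sum_congr rfl fun i hi => by
          rw [hP i (Nat.lt_succ_iff.1 (Finset.mem_range.1 hi))]
      rw [h2, hP 0 (Nat.zero_le k), hxZV, norm_zero]
      positivity
    · rw [Set.indicator_of_mem (by exact hin), Real.norm_of_nonneg (hS0 x)]
      have hd : ∀ i ≤ k, |iteratedDeriv i ψ x| ≤ 1 := fun i hi => hψd i hi x
      have hP : ∀ i ≤ k, ‖leibnizSum ψ Z i x‖ ≤ 2 ^ k * S x := fun i hi =>
        norm_leibnizSum_le hi hd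
      have hP0 : ‖leibnizSum ψ Z 0 x‖ ≤ R := by
        rw [leibnizSum_zero, norm_smul, Real.norm_of_nonneg (hψI x).1]
        calc _ ≤ 1 * R := mul_le_mul (hψI x).2 hxR.2 (norm_nonneg _) zero_le_one
          _ = R := one_mul R
      have hlip : ‖N (leibnizSum ψ Z 0 x + V 0 x) x - N (V 0 x) x‖ ≤
          M' * ‖leibnizSum ψ Z 0 x‖ := by
        have h1 := (convex_closedBall (0 : E) (R + R)).norm_image_sub_le_of_norm_fderiv_le (𝕜 := ℝ)
          (f := fun y => N y x) (C := M') (fun y _ => H.diff x y)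
          (fun y hy => hM' y (by simpa using hy) x)
          (x := V 0 x) (y := leibnizSum ψ Z 0 x + V 0 x)
          (by simpa using hxR.1.trans (by linarith))
          (by simpa using (norm_add_le _ _).trans (add_le_add hP0 hxR.1))
        rwa [add_sub_cancel_right] at h1
      have hdec : ∑ i ∈ Finset.range (k + 1), a i x (leibnizSum ψ Z i x + V i x) +
          N (leibnizSum ψ Z 0 x + V 0 x) x =
          ∑ i ∈ Finset.range (k + 1), a i x (leibnizSum ψ Z i x) +
            (N (leibnizSum ψ Z 0 x + V 0 x) x - N (V 0 x) x) := by
        simp only [map_add, Finset.sum_add_distrib]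
        rw [eq_neg_of_add_eq_zero_left hxV]
        abel
      have hterm : ∀ i ∈ Finset.range (k + 1), ‖a i x (leibnizSum ψ Z i x)‖ ≤
          M * (2 ^ k * S x) := fun i hi => by
        have hi' := Nat.lt_succ_iff.1 (Finset.mem_range.1 hi)
        refine (ContinuousLinearMap.le_opNorm _ _).trans ?_
        gcongr
        · exact hM i hi' x
        · exact hP i hi'
      rw [hdec]
      refine (norm_add_le _ _).trans ((add_le_add ((norm_sum_le _ _).trans
        (Finset.sum_le_card_nsmul _ _ _ hterm)) (hlip.trans
          (mul_le_mul_of_nonneg_left (hP 0 (Nat.zero_le k)) hM'0))).trans (le_of_eq ?_))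
      rw [Finset.card_range, nsmul_eq_mul, hc]
      push_cast
      ring
  refine (eLpNorm_le_mul_eLpNorm_of_ae_le_mul hpt 2).trans ?_
  have h1 : eLpNorm ((Set.Ioo (-(L / 6)) (L / 6))ᶜ.indicator S) 2
      (volume.restrict (Set.Ico (-(L / 2)) (-(L / 2) + L))) ≤
      (k + 1 : ℕ) * ENNReal.ofReal (tailNorm k Z (L / 6)) := by
    refine (eLpNorm_mono_measure _ Measure.restrict_le_self).trans ?_
    rw [eLpNorm_indicator_eq_eLpNorm_restrict measurableSet_Ioo.compl]
    exact eLpNorm_sum_norm_le (fun j hj => (H.Z_memLp j hj).1.restrict) fun j hj =>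
      eLpNorm_tail_le H.Z_memLp (L / 6) hj
  rw [mul_assoc c, ENNReal.ofReal_mul (p := c) (by positivity)]
  refine mul_le_mul' le_rfl (h1.trans (le_of_eq ?_))
  rw [ENNReal.ofReal_mul (by positivity), ← ENNReal.ofReal_natCast]
  push_cast
  rfl

/-- Away from the pulse, and wherever the cut-off is `1`, the periodic profile is close to the
solution on the line. -/
theorem periodicProfile_sub_small [CompleteSpace E] {ε R₀ : ℝ}
    (hε : 0 ≤ ε) (hZ : ∀ᵐ x, R₀ ≤ |x| → ‖Z 0 x‖ ≤ ε) {L : ℝ} (hL : 0 < L) (hL1 : 1 ≤ L)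
    (hLR : R₀ ≤ L / 8) {ψ : ℝ → ℝ} (hψI : ∀ x, ψ x ∈ Set.Icc (0 : ℝ) 1)
    (hψone : ∀ x, |x| ≤ L / 6 → ψ x = 1) :
    ∀ᵐ x, |x| ≤ 3 * L / 8 ∨ |x - L / 2| ≤ 3 * L / 8 →
      ‖periodicProfile hL ψ Z V 0 x - (Z 0 x + V 0 x)‖ ≤ 2 * ε := by
  have h := isUnitCovering_toIcoMod hL hL1 (-(L / 2))
  filter_upwards [hZ, h.quasiMeasurePreserving.ae (ae_restrict_of_ae hZ)] with x h1 h2 hx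
  have key : (toIcoMod hL (-(L / 2)) x = x ∧ |x| ≤ L / 6) ∨
      (L / 8 ≤ |x| ∧ L / 8 ≤ |toIcoMod hL (-(L / 2)) x|) := by
    rcases lt_or_ge x (L / 2) with hlt | hge
    · have hmem : -(L / 2) ≤ x := by
        rcases hx with hx | hx
        · linarith [(abs_le.1 hx).1]
        · linarith [(abs_le.1 hx).1]
      have hπ : toIcoMod hL (-(L / 2)) x = x :=
        (toIcoMod_eq_self hL).2 ⟨hmem, by linarith⟩
      rw [hπ]
      rcases le_total |x| (L / 6) with h6 | h6
      · exact Or.inl ⟨rfl, h6⟩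
      · exact Or.inr ⟨by linarith, by linarith⟩
    · have hup : x ≤ 7 * L / 8 := by
        rcases hx with hx | hx
        · linarith [(abs_le.1 hx).2]
        · linarith [(abs_le.1 hx).2]
      have hπ : toIcoMod hL (-(L / 2)) x = x - L :=
        (toIcoMod_eq_iff hL).2 ⟨⟨by linarith, by linarith⟩, 1, by simp⟩
      rw [hπ]
      refine Or.inr ⟨by linarith [le_abs_self x], ?_⟩
      linarith [neg_abs_le (x - L)]
  have he : periodicProfile hL ψ Z V 0 x - (Z 0 x + V 0 x) =
      ψ (toIcoMod hL (-(L / 2)) x) • Z 0 (toIcoMod hL (-(L / 2)) x) - Z 0 x := by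
    rw [periodicProfile, leibnizSum_zero]; abel
  rw [he]
  rcases key with ⟨h3, h4⟩ | ⟨h3, h4⟩
  · rw [h3, hψone x h4, one_smul, sub_self, norm_zero]
    positivity
  · refine (norm_sub_le _ _).trans ?_
    have h5 := h1 (hLR.trans h3)
    have h6 := h2 (hLR.trans h4)
    rw [norm_smul, Real.norm_of_nonneg (hψI _).1]
    have h7 : ψ (toIcoMod hL (-(L / 2)) x) * ‖Z 0 (toIcoMod hL (-(L / 2)) x)‖ ≤ 1 * ε :=
      mul_le_mul (hψI _).2 h6 (norm_nonneg _) zero_le_one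
    linarith

/-- Existence of periodic solutions `W 0 + A 0` close to the cut-off pulse `W 0`; only surjectivity of
the linearization on the line enters. -/
theorem exists_periodic_solutions [FiniteDimensional ℝ E] (H : IsPulse k T a N V Z)
    (hsurj : ∀ g : ℝ → E, MemLp g 2 volume → ∃ f : ℝ → E, MemHk k f ∧
      ∀ᵐ x, ∑ i ∈ Finset.range (k + 1),
        linCoeff a N (fun x => Z 0 x + V 0 x) i x (weakDeriv i f x) = g x) :
    ∃ C L₀ : ℝ, 0 < C ∧ ∀ n : ℕ, L₀ ≤ n * T → ∀ χ : ℝ → ℝ, IsCutoff k (n * T) χ →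
      ∃ W A : ℕ → ℝ → E,
        (∀ j ≤ k, Function.Periodic (W j) (n * T) ∧ Function.Periodic (A j) (n * T) ∧
          IsWeakDeriv j (W 0) (W j) ∧ IsWeakDeriv j (A 0) (A j) ∧
          MemLp (W j) 2 (volume.restrict (Set.Ico (-(n * T / 2)) (-(n * T / 2) + n * T))) ∧
          MemLp (A j) 2 (volume.restrict (Set.Ico (-(n * T / 2)) (-(n * T / 2) + n * T))) ∧
          eLpNorm (A j) 2 (volume.restrict (Set.Ico (-(n * T / 2)) (-(n * T / 2) + n * T))) ≤
            ENNReal.ofReal (C * tailNorm k Z (n * T / 6))) ∧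
        (∀ x ∈ Set.Ico (-(n * T / 2)) (n * T / 2), W 0 x = χ x • Z 0 x + V 0 x) ∧
        ∀ᵐ x, ∑ i ∈ Finset.range (k + 1), a i x (W i x + A i x) + N (W 0 x + A 0 x) x = 0 := by
  have : ProperSpace E := FiniteDimensional.proper ℝ E
  have : CompleteSpace E := FiniteDimensional.complete ℝ E
  have hk := H.one_le
  have hZm0 : AEStronglyMeasurable (Z 0) volume := (H.Z_memLp 0 (Nat.zero_le k)).1
  have hVm0 : AEStronglyMeasurable (V 0) volume :=
    (H.V_weakDeriv 0 (Nat.zero_le k)).locallyIntegrable_left.aestronglyMeasurable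
  obtain ⟨R, hR0, hR⟩ := H.exists_ae_bound
  obtain ⟨M₁, hM₁0, hM₁⟩ := H.exists_coeff_bound
  obtain ⟨M₂, hM₂0, hM₂⟩ := exists_bound_of_periodic H.pos H.deriv_cont H.fderivFst_per (R + R)
  set b := linCoeff a N (fun x => Z 0 x + V 0 x) with hb
  have hbm : ∀ i ≤ k, AEStronglyMeasurable (b i) volume := fun i hi =>
    H.aestronglyMeasurable_linCoeff (hZm0.add hVm0) hi
  have hbM : ∀ i ≤ k, ∀ᵐ x, ‖b i x‖ ≤ M₁ + M₂ := fun i hi => by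
    filter_upwards [hR] with x hx
    exact norm_linCoeff_le (u := fun x => Z 0 x + V 0 x) hM₁ hM₂0 hM₂
      ((norm_add_le _ _).trans (add_le_add hx.2 hx.1)) hi
  obtain ⟨K, hK, hsol⟩ := exists_bounded_solution
    (fun i hi => memLp_top_of_bound (hbm i hi) _ (hbM i hi)) hsurj
  obtain ⟨C, δ, L₁, hC, hδ, hinv⟩ :=
    exists_periodic_right_inverse hK (by positivity) hbM hsol
  obtain ⟨Cr, hCr0, hres⟩ := H.exists_residual_bound
  obtain ⟨ρ₁, hρ₁, hunif₁⟩ := exists_uniform_of_periodic H.pos H.deriv_cont H.fderivFst_per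
    (R + R + 1) (δ := 1 / (2 * C)) (by positivity)
  obtain ⟨ρ₂, hρ₂, hunif₂⟩ := exists_uniform_of_periodic H.pos H.deriv_cont H.fderivFst_per
    (R + R) hδ
  obtain ⟨R₀, hR₀⟩ := (H.Z_weakDeriv 1 hk).eventually_ae_small (H.Z_memLp 0 (Nat.zero_le k))
    (H.Z_memLp 1 hk) (half_pos hρ₂)
  -- the cap `1` keeps the `ρ`-neighbourhood of the profile in the ball of radius `2 R + 1` on which
  -- `ρ₁` is a modulus of continuity
  set ρ := min ρ₁ 1 with hρdef
  have hρ : 0 < ρ := lt_min hρ₁ one_pos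
  have htail : ∀ᶠ r in atTop, tailNorm k Z r ≤ ρ / 2 / (2 * C * (Cr + 1)) :=
    (tendsto_tailNorm H.Z_memLp).eventually_le_const (by positivity)
  obtain ⟨L₂, hL₂⟩ := eventually_atTop.1 htail
  -- beyond `8 R₀` the pulse is small at distance `L / 8` from its centre; beyond `6 L₂` the residual
  -- is small enough for the Newton step
  refine ⟨2 * C * (Cr + 1), max (max 1 L₁) (max (8 * R₀) (6 * L₂)), by positivity,
    fun n hn χ hχ => ?_⟩
  have hL1 : 1 ≤ n * T := ((le_max_left _ _).trans (le_max_left _ _)).trans hn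
  have hLL₁ : L₁ ≤ n * T := ((le_max_right _ _).trans (le_max_left _ _)).trans hn
  have hLR₀ : R₀ ≤ n * T / 8 := by
    linarith [((le_max_left (8 * R₀) (6 * L₂)).trans (le_max_right _ _)).trans hn]
  have hLL₂ : L₂ ≤ n * T / 6 := by
    linarith [((le_max_right (8 * R₀) (6 * L₂)).trans (le_max_right _ _)).trans hn]
  have hVmemL : ∀ j ≤ k,
      MemLp (V j) 2 (volume.restrict (Set.Ico (-(n * T / 2)) (-(n * T / 2) + n * T))) :=
    fun j hj => memLp_restrict_Ico_nat_mul H.pos (H.V_per j hj) (H.V_memLp j hj) n _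
  have hVperL : ∀ j ≤ k, Function.Periodic (V j) (n * T) := fun j hj => (H.V_per j hj).nat_mul n
  have haperL : ∀ i ≤ k, Function.Periodic (a i) (n * T) := fun j hj =>
    (H.coeff_per j hj).nat_mul n
  have hNperL : ∀ y, Function.Periodic (N y) (n * T) := fun y => (H.per y).nat_mul n
  have hDperL : ∀ y, Function.Periodic (fderivFst N y) (n * T) := fun y =>
    (H.fderivFst_per y).nat_mul n
  clear hn
  -- from here on `n` enters only through the period
  generalize hLn : (n : ℝ) * T = L at *
  have hL : 0 < L := by linarith
  obtain ⟨ψ, hψ, hψχ, hψs, hψI, hψd, hψone⟩ := hχ.exists_compact hL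
  set μ := volume.restrict (Set.Ico (-(L / 2)) (-(L / 2) + L)) with hμ
  have h : IsUnitCovering (toIcoMod hL (-(L / 2))) μ := isUnitCovering_toIcoMod hL hL1 _
  set W := periodicProfile hL ψ Z V with hW
  have hWper : ∀ j ≤ k, Function.Periodic (W j) L := fun j hj =>
    periodic_periodicProfile hL hVperL hj
  have hWm : ∀ j ≤ k, MemLp (W j) 2 μ := fun j hj =>
    H.memLp_periodicProfile hL hψ hψd hj (hVmemL j hj)
  have hWd : ∀ j ≤ k, IsWeakDeriv j (W 0) (W j) := fun j hj =>
    H.isWeakDeriv_periodicProfile hL hψ hψs hj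
  have hWπ : ∀ j ≤ k, (fun x => W j (toIcoMod hL (-(L / 2)) x)) = W j := fun j hj =>
    funext fun x => (hWper j hj).comp_toIcoMod hL _ x
  have hWR : ∀ᵐ x, ‖W 0 x‖ ≤ R + R := by
    filter_upwards [hR, h.quasiMeasurePreserving.ae (ae_restrict_of_ae hR)] with x h1 h2
    refine (norm_add_le _ _).trans (add_le_add ?_ h1.1)
    rw [leibnizSum_zero, norm_smul, Real.norm_of_nonneg (hψI _).1]
    calc _ ≤ 1 * R := mul_le_mul (hψI _).2 h2.2 (norm_nonneg _) zero_le_one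
      _ = R := one_mul R
  set bn := linCoeff a N (W 0) with hbndef
  have hbnm : ∀ i ≤ k, AEStronglyMeasurable (bn i) volume := fun i hi =>
    H.aestronglyMeasurable_linCoeff
      (hWd 0 (Nat.zero_le k)).locallyIntegrable_left.aestronglyMeasurable hi
  have hbn : ∀ i ≤ k, MemLp (bn i) ⊤ μ := fun i hi =>
    memLp_top_of_bound (hbnm i hi).restrict (M₁ + M₂) (ae_restrict_of_ae (by
      filter_upwards [hWR] with x hx using norm_linCoeff_le hM₁ hM₂0 hM₂ hx hi))
  have hbnp : ∀ i ≤ k, Function.Periodic (bn i) L := by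
    intro i hi x
    simp only [hbndef, linCoeff]
    rw [hWper 0 (Nat.zero_le k) x, hDperL _ x, haperL 0 (Nat.zero_le k) x, haperL i hi x]
  have hb0 : ∀ᵐ x, |x| ≤ 3 * L / 8 ∨ |x - L / 2| ≤ 3 * L / 8 → ‖bn 0 x - b 0 x‖ ≤ δ := by
    filter_upwards [periodicProfile_sub_small (V := V) (half_pos hρ₂).le hR₀ hL hL1 hLR₀ hψI hψone,
      hR, hWR] with x h1 h2 h3 hx
    simp only [hbndef, hb, linCoeff, if_true, add_sub_add_left_eq_sub]
    refine hunif₂ _ _ h3 ((norm_add_le _ _).trans (add_le_add h2.2 h2.1)) ?_ x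
    linarith [h1 hx]
  have hinvL := hinv L hL hL1 hLL₁ bn hbn hbnm hbnp
    (fun i hi _ => by
      funext x
      simp only [hbndef, hb, linCoeff, if_neg (show i ≠ 0 by omega)]) hb0
  have hWd' : ∀ j ≤ k, IsWeakDeriv j (fun x => W 0 (toIcoMod hL (-(L / 2)) x))
      (fun x => W j (toIcoMod hL (-(L / 2)) x)) := fun j hj => by
    rw [hWπ 0 (Nat.zero_le k), hWπ j hj]; exact hWd j hj
  have hWc := h.coeFn_sobolevMk W hWd' hWm
  have hWc' : ∀ᵐ x ∂μ, ∀ i : Fin (k + 1), (h.sobolevMk W hWd' hWm).1 i x = W i x :=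
    ae_all_iff.2 hWc
  have hτ := hL₂ _ hLL₂
  have hτ0 : 0 ≤ tailNorm k Z (L / 6) := Real.sqrt_nonneg _
  obtain ⟨A, hA, hAsol⟩ := exists_solution_near h hk (a := a) (bn := bn) (N := N) (R := R + R)
    (ρ := ρ) (C := C) (res := Cr * tailNorm k Z (L / 6))
    (fun i hi => memLp_top_of_bound (H.coeff_cont i hi).aestronglyMeasurable M₁
      (.of_forall (hM₁ i hi)))
    H.cont (exists_bound_of_periodic H.pos H.cont H.per) H.diff hC (h.sobolevMk W hWd' hWm)
    (by filter_upwards [hWc', ae_restrict_of_ae hWR] with x h1 h2; rw [h1 0]; exact h2)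
    (fun y y' hy hyy x => hunif₁ _ _
      (by
        have h1 : ‖y'‖ ≤ ‖y‖ + ‖y' - y‖ := by
          have := norm_add_le y (y' - y)
          rwa [add_sub_cancel] at this
        linarith [hyy.trans (min_le_right ρ₁ 1)])
      (by linarith) (hyy.trans (min_le_left _ _)) x)
    hbn
    (by filter_upwards [hWc'] with x h1; rw [h1 0]; simp [hbndef, linCoeff])
    (fun i hi _ => by
      funext x
      simp only [hbndef, linCoeff, if_neg (show i ≠ 0 by omega)])
    hinvL (by positivity)
    (by
      refine le_trans (le_of_eq (eLpNorm_congr_ae ?_)) (hres L hL ψ hψI hψd hψone)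
      filter_upwards [hWc'] with x h1
      rw [Finset.sum_range]
      simp only [h1]
      rfl)
    (by
      rw [le_div_iff₀ (by positivity)] at hτ
      nlinarith [mul_nonneg hC.le hτ0])
  refine ⟨W, fun j x => if hj : j < k + 1 then A.1 ⟨j, hj⟩ (toIcoMod hL (-(L / 2)) x) else 0,
    fun j hj => ?_, fun x hx => ?_, ?_⟩
  · have hj' : j < k + 1 := Nat.lt_succ_of_le hj
    have h0' : 0 < k + 1 := Nat.succ_pos k
    simp only [hj', h0', dite_true]
    have hae : (fun x => A.1 ⟨j, hj'⟩ (toIcoMod hL (-(L / 2)) x)) =ᵐ[μ] A.1 ⟨j, hj'⟩ := by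
      filter_upwards [show ∀ᵐ x ∂μ, x ∈ Set.Ico (-(L / 2)) (-(L / 2) + L) from
        ae_restrict_mem measurableSet_Ico] with x hx
      rw [(toIcoMod_eq_self hL).2 hx]
    refine ⟨hWper j hj, fun x => ?_, hWd j hj, A.2 ⟨j, hj'⟩, hWm j hj,
      (memLp_congr_ae hae).2 (Lp.memLp _), ?_⟩
    · change A.1 ⟨j, hj'⟩ (toIcoMod hL _ (x + L)) = A.1 ⟨j, hj'⟩ (toIcoMod hL _ x)
      rw [toIcoMod_add_right]
    · rw [eLpNorm_congr_ae hae, ← ENNReal.ofReal_toReal (Lp.memLp (A.1 ⟨j, hj'⟩)).2.ne,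
        ← Lp.norm_def]
      refine ENNReal.ofReal_le_ofReal (((h.norm_apply_le A _).trans hA).trans ?_)
      nlinarith [mul_nonneg hC.le hτ0]
  · rw [hW, periodicProfile, (toIcoMod_eq_self hL).2 ⟨hx.1, by linarith [hx.2]⟩, leibnizSum_zero,
      hψχ x hx]
  · filter_upwards [h.quasiMeasurePreserving.ae hAsol, h.quasiMeasurePreserving.ae hWc']
      with x h1 h2
    rw [← h1, Finset.sum_range]
    have e1 : ∀ i : Fin (k + 1), a i (toIcoMod hL (-(L / 2)) x) = a i x := fun i =>
      (haperL i (Nat.lt_succ_iff.1 i.2)).comp_toIcoMod hL _ x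
    have e2 : ∀ i : Fin (k + 1), W i (toIcoMod hL (-(L / 2)) x) = W i x := fun i =>
      (hWper i (Nat.lt_succ_iff.1 i.2)).comp_toIcoMod hL _ x
    have e3 : ∀ y, N y (toIcoMod hL (-(L / 2)) x) = N y x := fun y =>
      (hNperL y).comp_toIcoMod hL _ x
    have e4 := e2 0
    rw [Fin.val_zero] at e4
    simp only [h2, e1, e2, e3, Fin.is_lt, dite_true, Fin.val_zero, e4, Nat.succ_pos]
    rfl

end IsPulse

end PulseExistence

/-! ### Periodic representatives and Sobolev norms -/

section Representatives

variable {E : Type*} [NormedAddCommGroup E] [NormedSpace ℝ E]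

/-- A weak derivative of a periodic function agrees almost everywhere with a periodic function. -/
theorem IsWeakDeriv.comp_toIcoMod_ae_eq [CompleteSpace E] {j : ℕ} {f g : ℝ → E}
    (H : IsWeakDeriv j f g) {T : ℝ} (hT : 0 < T) (hf : Function.Periodic f T) (c : ℝ) :
    (fun x => g (toIcoMod hT c x)) =ᵐ[volume] g := by
  have h : ∀ᵐ x, ∀ n : ℤ, g (x - n * T) = g x := by
    refine ae_all_iff.2 fun n => ?_
    have h1 := H.comp_sub_const (n * T)
    rw [show (fun x => f (x - n * T)) = f from funext fun x => hf.sub_int_mul_eq n] at h1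
    exact h1.ae_eq H
  filter_upwards [h] with x hx
  rw [toIcoMod_eq_sub_mul]
  exact hx _

/-- The weak derivatives of `f`, with `f` itself as the derivative of order `0`. -/
def weakDerivs (f : ℝ → E) (j : ℕ) : ℝ → E := if j = 0 then f else weakDeriv j f

theorem isWeakDeriv_weakDerivs {f g : ℝ → E} {j : ℕ} (H : IsWeakDeriv j f g) :
    IsWeakDeriv j f (weakDerivs f j) := by
  unfold weakDerivs
  split_ifs with hj
  · subst hj
    exact .zero_self H.locallyIntegrable_left
  · exact H.weakDeriv_spec

theorem eLpNorm_restrict_Ioo_eq_Ico {F : Type*} [NormedAddCommGroup F] {f : ℝ → F} {L : ℝ}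
    (hL : 0 < L) (hf : Function.Periodic f L) {c : ℝ}
    (hm : MemLp f 2 (volume.restrict (Set.Ico c (c + L)))) :
    MemLp f 2 (volume.restrict (Set.Ioo 0 L)) ∧ eLpNorm f 2 (volume.restrict (Set.Ioo 0 L)) =
      eLpNorm f 2 (volume.restrict (Set.Ico c (c + L))) := by
  have hμ : volume.restrict (Set.Ioo 0 L) = volume.restrict (Set.Ico 0 (0 + L)) := by
    rw [zero_add]; exact Measure.restrict_congr_set Ioo_ae_eq_Ico
  have h1 : f ∘ toIcoMod hL c = f := funext fun x => hf.comp_toIcoMod hL c x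
  have h2 := measurePreserving_toIcoMod hL c 0
  have h3 := hm.comp_measurePreserving h2
  have h4 := eLpNorm_comp_measurePreserving (p := 2) hm.1 h2
  rw [h1] at h3 h4
  rw [hμ]
  exact ⟨h3, h4⟩

theorem sobolevNorm_le [CompleteSpace E] {k : ℕ} {S : Set ℝ} {f : ℝ → E} {A : ℕ → ℝ → E} {D : ℝ}
    (hD : 0 ≤ D) (hA : ∀ j ≤ k, IsWeakDeriv j f (A j))
    (hm : ∀ j ≤ k, MemLp (A j) 2 (volume.restrict S))
    (hle : ∀ j ≤ k, eLpNorm (A j) 2 (volume.restrict S) ≤ ENNReal.ofReal D) :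
    sobolevNorm k S f ≤ √(k + 1) * D := by
  have h1 : ∀ j ∈ Finset.range (k + 1), ∫ x in S, ‖weakDeriv j f x‖ ^ 2 ≤ D ^ 2 := fun j hj => by
    have hj' := Nat.lt_succ_iff.1 (Finset.mem_range.1 hj)
    have h2 := hle j hj'
    rw [eLpNorm_two_eq_ofReal_sqrt (hm j hj'), ENNReal.ofReal_le_ofReal_iff hD,
      Real.sqrt_le_left hD] at h2
    refine (integral_congr_ae (ae_restrict_of_ae ?_)).trans_le h2
    filter_upwards [(hA j hj').weakDeriv_ae_eq] with x hx
    rw [hx]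
  rw [sobolevNorm]
  refine (Real.sqrt_le_sqrt (Finset.sum_le_card_nsmul _ _ _ h1)).trans (le_of_eq ?_)
  rw [Finset.card_range, nsmul_eq_mul, Real.sqrt_mul (Nat.cast_nonneg _), Real.sqrt_sq hD]
  push_cast
  rfl

theorem tailNorm_weakDerivs [CompleteSpace E] {k : ℕ} {f : ℝ → E} (hf : MemHk k f) (r : ℝ) :
    tailNorm k (weakDerivs f) r = sobolevNorm k (Set.Ioo (-r) r)ᶜ f := by
  rw [tailNorm, sobolevNorm]
  congr 1
  refine Finset.sum_congr rfl fun j hj => integral_congr_ae (ae_restrict_of_ae ?_)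
  obtain ⟨g, hg, -⟩ := hf j (Nat.lt_succ_iff.1 (Finset.mem_range.1 hj))
  filter_upwards [(isWeakDeriv_weakDerivs hg).weakDeriv_ae_eq] with x hx
  rw [hx]

end Representatives

/-! ### The stationary equation in operator form -/

section Equation

variable {𝕜 : Type*} [RCLike 𝕜] {m : ℕ}

/-- The coefficient matrices as real linear maps, with a zero coefficient of order `0`. -/
def diffCoeff (α : ℕ → ℝ → Matrix (Fin m) (Fin m) 𝕜) (i : ℕ) (x : ℝ) :
    EuclideanSpace 𝕜 (Fin m) →L[ℝ] EuclideanSpace 𝕜 (Fin m) :=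
  if i = 0 then 0 else (Matrix.toEuclideanCLM (𝕜 := 𝕜) (α i x)).restrictScalars ℝ

theorem sum_diffCoeff (α : ℕ → ℝ → Matrix (Fin m) (Fin m) 𝕜) (k : ℕ)
    (w : ℕ → EuclideanSpace 𝕜 (Fin m)) (x : ℝ) :
    ∑ i ∈ Finset.range (k + 1), diffCoeff α i x (w i) =
      ∑ i ∈ Finset.Icc 1 k, Matrix.toEuclideanCLM (𝕜 := 𝕜) (α i x) (w i) := by
  rw [Finset.range_eq_Ico, Finset.sum_eq_sum_Ico_succ_bot (Nat.succ_pos k)]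
  have h0 : diffCoeff α 0 x (w 0) = 0 := by simp [diffCoeff]
  rw [h0, zero_add]
  refine Finset.sum_congr (by ext i; simp) fun i hi => ?_
  rw [diffCoeff, if_neg (by have := (Finset.mem_Icc.1 hi).1; omega)]
  rfl

theorem diffOp_ae_eq {α : ℕ → ℝ → Matrix (Fin m) (Fin m) 𝕜} {k : ℕ}
    {u : ℝ → EuclideanSpace 𝕜 (Fin m)} {U : ℕ → ℝ → EuclideanSpace 𝕜 (Fin m)}
    (hU : ∀ j ≤ k, IsWeakDeriv j u (U j)) :
    ∀ᵐ x, diffOp k α u x = ∑ i ∈ Finset.range (k + 1), diffCoeff α i x (U i x) := by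
  have h : ∀ᵐ x, ∀ i : Fin (k + 1), weakDeriv i u x = U i x :=
    ae_all_iff.2 fun i => (hU i (Nat.lt_succ_iff.1 i.2)).weakDeriv_ae_eq
  filter_upwards [h] with x hx
  rw [sum_diffCoeff α k (fun i => U i x), diffOp]
  refine Finset.sum_congr rfl fun i hi => ?_
  rw [← hx ⟨i, Nat.lt_succ_iff.2 (Finset.mem_Icc.1 hi).2⟩]

theorem continuous_diffCoeff {α : ℕ → ℝ → Matrix (Fin m) (Fin m) 𝕜} {k : ℕ}
    (hα : ∀ i, 1 ≤ i → i ≤ k → Continuous (α i)) {i : ℕ} (hi : i ≤ k) :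
    Continuous (diffCoeff α i) := by
  rcases Nat.eq_zero_or_pos i with rfl | h
  · have : diffCoeff α 0 = fun _ => 0 := by funext x; simp [diffCoeff]
    rw [this]; exact continuous_const
  · have e : diffCoeff α i = fun x =>
        (Matrix.toEuclideanCLM (𝕜 := 𝕜) (α i x)).restrictScalars ℝ := by
      funext x; simp [diffCoeff, h.ne']
    rw [e]
    have hc : Continuous (Matrix.toEuclideanCLM (𝕜 := 𝕜) (n := Fin m)) :=
      LinearMap.continuous_of_finiteDimensional
        ((Matrix.toEuclideanCLM (𝕜 := 𝕜) (n := Fin m)).toAlgEquiv.toLinearEquiv.toLinearMap)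
    exact (ContinuousLinearMap.continuous_restrictScalars ℝ).comp (hc.comp (hα i h hi))

theorem diffCoeff_periodic {α : ℕ → ℝ → Matrix (Fin m) (Fin m) 𝕜} {k : ℕ} {T : ℝ}
    (hα : ∀ i, 1 ≤ i → i ≤ k → Function.Periodic (α i) T) {i : ℕ} (hi : i ≤ k) :
    Function.Periodic (diffCoeff α i) T := fun x => by
  rcases Nat.eq_zero_or_pos i with rfl | h
  · simp [diffCoeff]
  · simp only [diffCoeff, hα i h hi x]

/-- A periodic solution and a pulse on it, in terms of their weak derivatives. -/
theorem isPulse_weakDerivs {k : ℕ} (hk : 1 ≤ k) {T : ℝ} (hT : 0 < T)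
    {α : ℕ → ℝ → Matrix (Fin m) (Fin m) 𝕜}
    (hα_cont : ∀ i, 1 ≤ i → i ≤ k → Continuous (α i))
    (hα_per : ∀ i, 1 ≤ i → i ≤ k → Function.Periodic (α i) T)
    {N : EuclideanSpace 𝕜 (Fin m) → ℝ → EuclideanSpace 𝕜 (Fin m)}
    (hN_cont : Continuous (fun p : EuclideanSpace 𝕜 (Fin m) × ℝ => N p.1 p.2))
    (hN_diff : ∀ x, Differentiable ℝ (fun y => N y x))
    (hN_deriv : Continuous (fun p : EuclideanSpace 𝕜 (Fin m) × ℝ =>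
      fderiv ℝ (fun y => N y p.2) p.1))
    (hN_per : ∀ y, Function.Periodic (N y) T)
    {v z : ℝ → EuclideanSpace 𝕜 (Fin m)} (hv : MemHkPer k T v) (hz : MemHk k z)
    (hv_sol : SolvesStationary k α N v) (hzv_sol : SolvesStationary k α N (fun x => z x + v x)) :
    IsPulse k T (diffCoeff α) N (fun j x => weakDerivs v j (toIcoMod hT 0 x)) (weakDerivs z) := by
  have hv0 : (fun x => weakDerivs v 0 (toIcoMod hT 0 x)) = v :=
    funext fun x => hv.1.comp_toIcoMod hT 0 x
  have hvd : ∀ j ≤ k, IsWeakDeriv j v (weakDerivs v j) := fun j hj =>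
    let ⟨_, hg, _⟩ := hv.2 j hj
    isWeakDeriv_weakDerivs hg
  have hvae : ∀ j ≤ k, (fun x => weakDerivs v j (toIcoMod hT 0 x)) =ᵐ[volume] weakDerivs v j :=
    fun j hj => (hvd j hj).comp_toIcoMod_ae_eq hT hv.1 0
  have hvd' : ∀ j ≤ k, IsWeakDeriv j v (fun x => weakDerivs v j (toIcoMod hT 0 x)) :=
    fun j hj => (hvd j hj).congr (ae_eq_refl _) (hvae j hj).symm
  have hzd : ∀ j ≤ k, IsWeakDeriv j z (weakDerivs z j) := fun j hj =>
    let ⟨_, hg, _⟩ := hz j hj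
    isWeakDeriv_weakDerivs hg
  exact
    { one_le := hk
      pos := hT
      coeff_cont := fun i hi => continuous_diffCoeff hα_cont hi
      coeff_per := fun i hi => diffCoeff_periodic hα_per hi
      cont := hN_cont
      diff := hN_diff
      deriv_cont := hN_deriv
      per := hN_per
      V_weakDeriv := fun j hj => by rw [hv0]; exact hvd' j hj
      V_per := fun j _ x => by
        change weakDerivs v j (toIcoMod hT 0 (x + T)) = weakDerivs v j (toIcoMod hT 0 x)
        rw [toIcoMod_add_right]
      V_memLp := fun j hj => by
        obtain ⟨g, hg, hgm⟩ := hv.2 j hj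
        rw [zero_add, ← Measure.restrict_congr_set (Ioo_ae_eq_Ico (μ := volume))]
        exact (memLp_congr_ae (ae_restrict_of_ae (hg.ae_eq (hvd' j hj)))).1 hgm
      Z_weakDeriv := hzd
      Z_memLp := fun j hj => by
        obtain ⟨g, hg, hgm⟩ := hz j hj
        exact (memLp_congr_ae (hg.ae_eq (hzd j hj))).1 hgm
      V_sol := by
        filter_upwards [hv_sol.2, diffOp_ae_eq (α := α) hvd'] with x h1 h2
        rw [← h2, congrFun hv0 x, h1]
      ZV_sol := by
        filter_upwards [hzv_sol.2, diffOp_ae_eq (α := α)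
          fun j hj => (hzd j hj).add (hvd' j hj)] with x h1 h2
        rw [← h2, congrFun hv0 x]
        exact h1 }

end Equation

end

theorem theoremt {𝕜 : Type*} [RCLike 𝕜] (k m : ℕ) (hk : 1 ≤ k) (T : ℝ) (hT : 0 < T)
    (α : ℕ → ℝ → Matrix (Fin m) (Fin m) 𝕜)
    (hα_cont : ∀ i, 1 ≤ i → i ≤ k → Continuous (α i))
    (hα_per : ∀ i, 1 ≤ i → i ≤ k → Function.Periodic (α i) T)
    (hα_inv : ∀ x, IsUnit (α k x))
    (𝒩 : EuclideanSpace 𝕜 (Fin m) → ℝ → EuclideanSpace 𝕜 (Fin m))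
    (h𝒩_cont : Continuous (fun p : EuclideanSpace 𝕜 (Fin m) × ℝ => 𝒩 p.1 p.2))
    (h𝒩_diff : ∀ x, ContDiff ℝ 2 (fun y => 𝒩 y x))
    (h𝒩_deriv : Continuous (fun p : EuclideanSpace 𝕜 (Fin m) × ℝ =>
      fderiv ℝ (fun y => 𝒩 y p.2) p.1))
    (h𝒩_per : ∀ y, Function.Periodic (𝒩 y) T)
    (v z : ℝ → EuclideanSpace 𝕜 (Fin m))
    (hv : MemHkPer k T v) (hz : MemHk k z)
    (hv_sol : SolvesStationary k α 𝒩 v)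
    (hzv_sol : SolvesStationary k α 𝒩 (fun x => z x + v x))
    (hzv_nondeg : IsNondegenerate k α 𝒩 (fun x => z x + v x)) :
    ∃ C : ℝ, 0 < C ∧ ∃ N : ℕ,
      (∀ n : ℕ, N ≤ n → ∃ χ : ℝ → ℝ, IsCutoff k (n * T) χ) ∧
      ∀ χ : ℕ → ℝ → ℝ, (∀ n, N ≤ n → IsCutoff k (n * T) (χ n)) →
        ∃ u a : ℕ → ℝ → EuclideanSpace 𝕜 (Fin m),
          (∀ n, N ≤ n →
            MemHkPer k (n * T) (u n) ∧
            SolvesStationary k α 𝒩 (u n) ∧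
            MemHkPer k (n * T) (a n) ∧
            (∀ x ∈ Set.Ico (-(n * T / 2)) (n * T / 2), u n x = χ n x • z x + v x + a n x) ∧
            sobolevNorm k (Set.Ioo 0 (n * T)) (a n) ≤
              C * sobolevNorm k (Set.Ioo (-(n * T / 6)) (n * T / 6))ᶜ z) ∧
          Tendsto (fun n : ℕ => sobolevNorm k (Set.Ioo 0 (n * T)) (a n)) atTop (𝓝 0) := by
  have H := isPulse_weakDerivs hk hT hα_cont hα_per h𝒩_cont
    (fun x => (h𝒩_diff x).differentiable (by norm_num)) h𝒩_deriv h𝒩_per hv hz hv_sol hzv_sol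
  set V : ℕ → ℝ → EuclideanSpace 𝕜 (Fin m) := fun j x => weakDerivs v j (toIcoMod hT 0 x) with hV
  have hV0 : ∀ x, V 0 x = v x := hv.1.comp_toIcoMod hT 0
  have hsurj : ∀ g : ℝ → EuclideanSpace 𝕜 (Fin m), MemLp g 2 volume → ∃ f, MemHk k f ∧
      ∀ᵐ x, ∑ i ∈ Finset.range (k + 1), linCoeff (diffCoeff α) 𝒩
        (fun x => weakDerivs z 0 x + V 0 x) i x (weakDeriv i f x) = g x := fun g hg => by
    obtain ⟨w, ⟨hw, hwg⟩, -⟩ := hzv_nondeg g hg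
    obtain ⟨w₁, hw₁, -⟩ := hw 0 (Nat.zero_le k)
    refine ⟨w, hw, ?_⟩
    filter_upwards [hwg, hw₁.weakDeriv_ae_eq, hw₁.eq_of_zero] with x h1 h2 h3
    rw [← h1, linearization, diffOp, ← sum_diffCoeff α k (fun i => weakDeriv i w x),
      Finset.sum_range_succ', Finset.sum_range_succ']
    have h4 : diffCoeff α 0 x = 0 := by simp [diffCoeff]
    simp only [linCoeff, Nat.succ_ne_zero, if_false, if_true, h4, zero_add, h2, ← h3, hV0,
      zero_apply, add_zero]
    rfl
  obtain ⟨C, L₁, hC, hsol⟩ := H.exists_periodic_solutions hsurj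
  obtain ⟨L₂, hL₂1, hcut⟩ := exists_isCutoff k
  obtain ⟨N, hN⟩ := exists_nat_ge (max L₁ L₂ / T)
  have hNT : ∀ n : ℕ, N ≤ n → max L₁ L₂ ≤ n * T := fun n hn =>
    (div_le_iff₀ hT).1 (hN.trans (Nat.cast_le.2 hn))
  refine ⟨√(k + 1) * C, by positivity, N,
    fun n hn => hcut _ ((le_max_right _ _).trans (hNT n hn)), fun χ hχ => ?_⟩
  have hex : ∀ n : ℕ, ∃ u a : ℝ → EuclideanSpace 𝕜 (Fin m), N ≤ n →
      MemHkPer k (n * T) u ∧ SolvesStationary k α 𝒩 u ∧ MemHkPer k (n * T) a ∧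
      (∀ x ∈ Set.Ico (-(n * T / 2)) (n * T / 2), u x = χ n x • z x + v x + a x) ∧
      sobolevNorm k (Set.Ioo 0 (n * T)) a ≤
        √(k + 1) * C * sobolevNorm k (Set.Ioo (-(n * T / 6)) (n * T / 6))ᶜ z := fun n => by
    by_cases hn : N ≤ n
    swap
    · exact ⟨0, 0, fun h => absurd h hn⟩
    have hL : 0 < n * T :=
      zero_lt_one.trans_le (hL₂1.trans ((le_max_right _ _).trans (hNT n hn)))
    obtain ⟨W, A, hWA, hW0, hWAsol⟩ :=
      hsol n ((le_max_left _ _).trans (hNT n hn)) (χ n) (hχ n hn)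
    have hu : ∀ j ≤ k, IsWeakDeriv j (fun x => W 0 x + A 0 x) (fun x => W j x + A j x) :=
      fun j hj => (hWA j hj).2.2.1.add (hWA j hj).2.2.2.1
    refine ⟨fun x => W 0 x + A 0 x, A 0, fun _ => ⟨⟨?_, fun j hj => ⟨_, hu j hj, ?_⟩⟩,
      ⟨fun j hj => ⟨_, hu j hj⟩, ?_⟩, ⟨(hWA 0 (Nat.zero_le k)).2.1, fun j hj =>
        ⟨A j, (hWA j hj).2.2.2.1, ?_⟩⟩, fun x hx => ?_, ?_⟩⟩
    · exact (hWA 0 (Nat.zero_le k)).1.add (hWA 0 (Nat.zero_le k)).2.1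
    · exact (eLpNorm_restrict_Ioo_eq_Ico hL ((hWA j hj).1.add (hWA j hj).2.1)
        ((hWA j hj).2.2.2.2.1.add (hWA j hj).2.2.2.2.2.1)).1
    · filter_upwards [hWAsol, diffOp_ae_eq (α := α) hu] with x h1 h2
      rw [h2, h1]
    · exact (eLpNorm_restrict_Ioo_eq_Ico hL (hWA j hj).2.1 (hWA j hj).2.2.2.2.2.1).1
    · change W 0 x + A 0 x = _
      rw [hW0 x hx, hV0]
      rfl
    · rw [← tailNorm_weakDerivs hz, mul_assoc]
      refine sobolevNorm_le (mul_nonneg hC.le (Real.sqrt_nonneg _))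
        (fun j hj => (hWA j hj).2.2.2.1)
        (fun j hj => (eLpNorm_restrict_Ioo_eq_Ico hL (hWA j hj).2.1 (hWA j hj).2.2.2.2.2.1).1)
        fun j hj => ?_
      rw [(eLpNorm_restrict_Ioo_eq_Ico hL (hWA j hj).2.1 (hWA j hj).2.2.2.2.2.1).2]
      exact (hWA j hj).2.2.2.2.2.2
  choose u a hua using hex
  refine ⟨u, a, hua, ?_⟩
  have h1 : Tendsto (fun n : ℕ => (n : ℝ) * T / 6) atTop atTop :=
    (tendsto_natCast_atTop_atTop.atTop_mul_const hT).atTop_div_const (by norm_num)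
  have h2 := ((tendsto_tailNorm H.Z_memLp).comp h1).const_mul (√(k + 1) * C)
  rw [mul_zero] at h2
  refine squeeze_zero' (.of_forall fun n => Real.sqrt_nonneg _) ?_ h2
  filter_upwards [eventually_ge_atTop N] with n hn
  rw [Function.comp_apply, tailNorm_weakDerivs hz]
  exact (hua n hn).2.2.2.2
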